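/- Let $G$ be a connected real semisimple Lie group (possibly with infinite center) with Lie algebra $\mathfrak g$, let $\theta$ be a Cartan involution of $\mathfrak g$, $\mathfrak g=\mathfrak k+\mathfrak p$ the Cartan decomposition and $K$ the analytic subgroup of $G$ with Lie algebra $\mathfrak k$ (maximal compact modulo the center). Fix a maximal abelian subspace $\mathfrak a_{\mathfrak p}\subset\mathfrak p$ and a positive system $\Sigma^+$ of the restricted roots with simple roots $\Psi$; let $\rho$ be half the sum of the positive roots with multiplicities, $\mathfrak n=\sum_{\alpha\in\Sigma^+}\mathfrak g_\alpha$, $A=\exp\mathfrak a_{\mathfrak p}$, $N=\exp\mathfrak n$, and let $M$ be the centralizer of $\mathfrak a_{\mathfrak p}$ in $K$ and $\mathfrak m$ its Lie algebra, so that $P=MAN$ is a minimal parabolic subgroup with Lie algebra $\mathfrak m+\mathfrak a_{\mathfrak p}+\mathfrak n$. For $\Xi\subset\Psi$ let $\mathfrak a_\Xi\subset\mathfrak a_{\mathfrak p}$ be the common kernel of the roots in $\Xi$, let $P_\Xi=M_\Xi A_\Xi N_\Xi\supset P$ be the corresponding standard parabolic subgroup with Lie algebra $\mathfrak p_\Xi=\mathfrak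 m_\Xi+\mathfrak a_\Xi+\mathfrak n_\Xi$, and let $M_{\Xi,s}^o$ be the analytic subgroup with Lie algebra $[\mathfrak m_\Xi,\mathfrak m_\Xi]$. Let $\chi_\ell:K\to\mathbb C^\times$ be a continuous one-dimensional representation that is trivial on $M_{\Xi,s}^o\cap K$ (for $\ell=0$ the trivial one). Let $\mu$ be in the complex dual of $\mathfrak a_\Xi$, and let $\tau_{\Xi,\ell,\mu}$ be the character of $P_\Xi$ with $$\tau_{\Xi,\ell,\mu}(yman)=\chi_\ell(m)^{-1}a^{\mu-\rho}\qquad (y\in M_{\Xi,s}^o,\ m\in M,\ a\in A_\Xi,\ n\in N_\Xi).$$ Let $\mathcal F$ be one of $\mathcal A$ (real analytic functions), $C^\infty$, $\mathcal D'$ (distributions), $\mathcal B$ (hyperfunctions), and put $$\mathcal F(G/P_\Xi;\mathcal L^\ell_{\Xi,\mu})=\{f\in\mathcal F(G): f(gp)=\tau_{\Xi,\ell,\mu}(p)f(g)\ \text{for } p\in P_\Xi\},$$ $$\mathcal F(G/P;\mathcal L^\ell_{\nu})=\{f\in\mathcal F(G): f(gman)=\chi_\ell(m)^{-1}a^{\nu-\rho}f(g)\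 \text{for } (m,a,n)\in M\times A\times N\}.$$ Let $\rho(\Xi)=\rho-\rho|_{\mathfrak a_\Xi}$, where linear forms on $\mathfrak a_\Xi$ are extended to $\mathfrak a_{\mathfrak p}$ by zero on the orthogonal complement of $\mathfrak a_\Xi$ for the Killing form. Let $U(\mathfrak g)$ be the universal enveloping algebra of the complexification of $\mathfrak g$, let $\lambda$ be the character of $\mathfrak p_\Xi$ with $\tau_{\Xi,\ell,\mu}(e^X)=e^{\lambda(X)}$, and put $$J_\Theta(\lambda)=\sum_{X\in\mathfrak p_\Xi}U(\mathfrak g)(X-\lambda(X)),\qquad J_0(\lambda)=\sum_{X\in\mathfrak m+\mathfrak a_{\mathfrak p}+\mathfrak n}U(\mathfrak g)(X-\lambda(X)).$$ Let $\pi$ be the representation of $U(\mathfrak g)$ on $\mathcal F(G)$ induced by $(\pi(g)f)(x)=f(g^{-1}x)$, and let $a$ be the anti-automorphism of $U(\mathfrak g)$ with $a(X)=-X$ for $X\in\mathfrak g$. If $I_\Theta(\lambda)$ is a two-sided ideal of $U(\mathfrak g)$ with $J_\Theta(\lambda)=I_\Theta(\lambda)+J_0(\lambda)$, then $$\mathcal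 F(G/P_\Xi;\mathcal L^\ell_{\Xi,\mu})=\{f\in\mathcal F(G/P;\mathcal L^\ell_{\mu+\rho(\Xi)}):\ \pi(a(D))f=0\ \text{ for all } D\in I_\Theta(\lambda)\}.$$ -/

import Mathlib

namespace DegSeries
open scoped Manifold ContDiff TensorProduct
open VectorField Set Filter Topology

section Calculus
variable {E : Type*} [NormedAddCommGroup E] [NormedSpace ℝ E]
 {M : Type*} [TopologicalSpace M] [ChartedSpace E M]

/-- The differential of a function on a manifold. -/
noncomputable def dAt (f : M → ℂ) (x : M) : TangentSpace 𝓘(ℝ, E) x →L[ℝ] ℂ :=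
  mfderiv 𝓘(ℝ, E) 𝓘(ℝ, ℂ) f x

theorem dAt_congr {f g : M → ℂ} {x : M} (h : f =ᶠ[𝓝 x] g) :
    (dAt f x : TangentSpace 𝓘(ℝ, E) x →L[ℝ] ℂ) = dAt g x := h.mfderiv_eq

variable [IsManifold 𝓘(ℝ, E) 2 M]

theorem dAt_chart {x z : M} (hz : z ∈ (extChartAt 𝓘(ℝ, E) x).source)
    {F : E → ℂ} (hF : DifferentiableAt ℝ F (extChartAt 𝓘(ℝ, E) x z)) (v : TangentSpace 𝓘(ℝ, E) z) :
    dAt (F ∘ extChartAt 𝓘(ℝ, E) x) z v =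
      fderiv ℝ F (extChartAt 𝓘(ℝ, E) x z) (mfderiv 𝓘(ℝ, E) 𝓘(ℝ, E) (extChartAt 𝓘(ℝ, E) x) z v) := by
  have : IsManifold 𝓘(ℝ, E) 1 M := IsManifold.of_le (n := 2) one_le_two
  have h1 : MDifferentiableAt 𝓘(ℝ, E) 𝓘(ℝ, E) (extChartAt 𝓘(ℝ, E) x) z :=
    mdifferentiableAt_extChartAt (by simpa using hz)
  have h2 := mfderiv_comp z (I'' := 𝓘(ℝ, ℂ)) hF.mdifferentiableAt h1
  have h3 := congrArg (fun L => L v) h2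
  refine h3.trans ?_
  have h4 : mfderiv 𝓘(ℝ, E) 𝓘(ℝ, ℂ) F (extChartAt 𝓘(ℝ, E) x z) =
    fderiv ℝ F (extChartAt 𝓘(ℝ, E) x z) := mfderiv_eq_fderiv
  exact congrArg (fun L : E →L[ℝ] ℂ =>
    L (mfderiv 𝓘(ℝ, E) 𝓘(ℝ, E) (extChartAt 𝓘(ℝ, E) x) z v)) h4

theorem pullback_eq {x z : M} (hz : z ∈ (extChartAt 𝓘(ℝ, E) x).source)
    (U : (y : M) → TangentSpace 𝓘(ℝ, E) y) :
    (mpullbackWithin 𝓘(ℝ, E) 𝓘(ℝ, E) (extChartAt 𝓘(ℝ, E) x).symm U (range 𝓘(ℝ, E))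
      (extChartAt 𝓘(ℝ, E) x z) : E) = mfderiv 𝓘(ℝ, E) 𝓘(ℝ, E) (extChartAt 𝓘(ℝ, E) x) z (U z) := by
  have : IsManifold 𝓘(ℝ, E) 1 M := IsManifold.of_le (n := 2) one_le_two
  have h := mfderivWithin_extChartAt_symm_comp_mfderiv_extChartAt' (I := 𝓘(ℝ, E)) hz
  have hy := (extChartAt 𝓘(ℝ, E) x).map_source hz
  have h' := mfderiv_extChartAt_comp_mfderivWithin_extChartAt_symm (I := 𝓘(ℝ, E)) hy
  have hi := (extChartAt 𝓘(ℝ, E) x).left_inv hz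
  unfold mpullbackWithin
  rw [hi] at h' ⊢
  have := ContinuousLinearMap.inverse_eq h h'
  exact congrArg (fun L => L (U z)) this

variable [CompleteSpace E]

theorem dAt_mlieBracket {f : M → ℂ} {x : M}
    (hf : ContMDiff 𝓘(ℝ, E) 𝓘(ℝ, ℂ) 2 f)
    {V W : (y : M) → TangentSpace 𝓘(ℝ, E) y}
    (hV : MDifferentiableAt 𝓘(ℝ, E) 𝓘(ℝ, E).tangent
      (fun y ↦ (⟨y, V y⟩ : TangentBundle 𝓘(ℝ, E) M)) x)
    (hW : MDifferentiableAt 𝓘(ℝ, E) 𝓘(ℝ, E).tangent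
      (fun y ↦ (⟨y, W y⟩ : TangentBundle 𝓘(ℝ, E) M)) x) :
    dAt f x (mlieBracket 𝓘(ℝ, E) V W x) =
      dAt (fun y ↦ dAt f y (W y)) x (V x) - dAt (fun y ↦ dAt f y (V y)) x (W x) := by
  have : IsManifold 𝓘(ℝ, E) 1 M := IsManifold.of_le (n := 2) one_le_two
  set φ := extChartAt 𝓘(ℝ, E) x with hφ
  set F : E → ℂ := f ∘ φ.symm with hF
  have hFc : ContDiffAt ℝ 2 F (φ x) := by
    have h := (contMDiffAt_iff_of_mem_source (mem_chart_source E x)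
      (mem_chart_source ℂ (f x))).1 (hf x)
    have h2 := h.2
    simp only [mfld_simps] at h2
    exact contDiffWithinAt_univ.1 h2
  have hsrc : ∀ᶠ z in 𝓝 x, z ∈ φ.source := extChartAt_source_mem_nhds x
  have hfF : ∀ z ∈ φ.source, f =ᶠ[𝓝 z] F ∘ φ := by
    intro z hz
    filter_upwards [(isOpen_extChartAt_source x).mem_nhds hz] with w hw
    simp [hF, φ.left_inv hw]
  have hFd : ∀ᶠ y in 𝓝 (φ x), DifferentiableAt ℝ F y := by
    filter_upwards [hFc.eventually (by simp)] with y hy using hy.differentiableAt (by simp)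
  have hcont : ContinuousAt φ x := continuousAt_extChartAt x
  have hdiff : DifferentiableAt ℝ (fderiv ℝ F) (φ x) :=
    (hFc.fderiv_right (m := 1) le_rfl).differentiableAt (by simp)
  have key : ∀ U : (y : M) → TangentSpace 𝓘(ℝ, E) y, MDifferentiableAt 𝓘(ℝ, E) 𝓘(ℝ, E).tangent
      (fun y ↦ (⟨y, U y⟩ : TangentBundle 𝓘(ℝ, E) M)) x →
      ∀ U' : E → E, U' = mpullbackWithin 𝓘(ℝ, E) 𝓘(ℝ, E) φ.symm U (range 𝓘(ℝ, E)) →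
      DifferentiableAt ℝ U' (φ x) ∧ 
      ∀ v : TangentSpace 𝓘(ℝ, E) x, dAt (fun y ↦ dAt f y (U y)) x v =
        fderiv ℝ (fderiv ℝ F) (φ x) (mfderiv 𝓘(ℝ, E) 𝓘(ℝ, E) φ x v) (U' (φ x)) +
        fderiv ℝ F (φ x) (fderiv ℝ U' (φ x) (mfderiv 𝓘(ℝ, E) 𝓘(ℝ, E) φ x v)) := by
    intro U hU U' hU'
    have hd : DifferentiableAt ℝ U' (φ x) := by
      have h := MDifferentiableWithinAt.differentiableWithinAt_mpullbackWithin_vectorField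
        (mdifferentiableWithinAt_univ.2 hU)
      simp only [preimage_univ, univ_inter, mfld_simps] at h
      rw [hU']
      refine differentiableWithinAt_univ.1 ?_
      simpa only [mfld_simps] using! h
    refine ⟨hd, fun v => ?_⟩
    have e : (fun y ↦ dAt f y (U y)) =ᶠ[𝓝 x] (fun y => fderiv ℝ F y (U' y)) ∘ φ := by
      filter_upwards [hsrc, hcont.eventually hFd] with z hz hz2
      rw [dAt_congr (hfF z hz), dAt_chart hz hz2]
      subst hU'
      exact congrArg (fderiv ℝ F (φ z)) (pullback_eq hz U).symm
    rw [dAt_congr e, dAt_chart (mem_extChartAt_source x) (hdiff.clm_apply hd)]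
    rw [fderiv_clm_apply hdiff hd]
    simp [add_comm]
    rfl
  obtain ⟨dV, kV⟩ := key V hV _ rfl
  obtain ⟨dW, kW⟩ := key W hW _ rfl
  have pV := pullback_eq (mem_extChartAt_source x) V
  have pW := pullback_eq (mem_extChartAt_source x) W
  rw [kV, kW, dAt_congr (hfF x (mem_extChartAt_source x)),
    dAt_chart (mem_extChartAt_source x) hFd.self_of_nhds]
  set V' : E → E := mpullbackWithin 𝓘(ℝ, E) 𝓘(ℝ, E) φ.symm V (range 𝓘(ℝ, E))
  set W' : E → E := mpullbackWithin 𝓘(ℝ, E) 𝓘(ℝ, E) φ.symm W (range 𝓘(ℝ, E))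
  have hb : (mfderiv 𝓘(ℝ, E) 𝓘(ℝ, E) φ x (mlieBracket 𝓘(ℝ, E) V W x) : E) =
      fderiv ℝ W' (φ x) (V' (φ x)) - fderiv ℝ V' (φ x) (W' (φ x)) := by
    let B : E := lieBracketWithin ℝ V' W' (φ.symm ⁻¹' univ ∩ range 𝓘(ℝ, E)) (φ x)
    have h1 : mlieBracket 𝓘(ℝ, E) V W x = (mfderiv 𝓘(ℝ, E) 𝓘(ℝ, E) φ x).inverse B := by
      rw [← mlieBracketWithin_univ]; exact mlieBracketWithin_apply
    have h2 : (mfderiv 𝓘(ℝ, E) 𝓘(ℝ, E) φ x).IsInvertible :=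
      isInvertible_mfderiv_extChartAt (mem_extChartAt_source x)
    have h4 : φ.symm ⁻¹' univ ∩ range 𝓘(ℝ, E) = (univ : Set E) := by
      simp only [mfld_simps]
    have h3 : B = fderiv ℝ W' (φ x) (V' (φ x)) - fderiv ℝ V' (φ x) (W' (φ x)) := by
      simp only [B]
      rw [h4, lieBracketWithin_univ]
      rfl
    exact (congrArg (fun v => mfderiv 𝓘(ℝ, E) 𝓘(ℝ, E) φ x v) h1).trans
      ((h2.self_apply_inverse _).trans h3)
  have hs := (hFc.isSymmSndFDerivAt (by simp)) (V' (φ x)) (W' (φ x))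
  have e1 := congrArg (fderiv ℝ F (φ x)) hb
  have e2 : fderiv ℝ (fderiv ℝ F) (φ x) (mfderiv 𝓘(ℝ, E) 𝓘(ℝ, E) φ x (V x)) (W' (φ x)) +
        fderiv ℝ F (φ x) (fderiv ℝ W' (φ x) (mfderiv 𝓘(ℝ, E) 𝓘(ℝ, E) φ x (V x))) =
      fderiv ℝ (fderiv ℝ F) (φ x) (V' (φ x)) (W' (φ x)) +
        fderiv ℝ F (φ x) (fderiv ℝ W' (φ x) (V' (φ x))) :=
    congrArg (fun v : E => fderiv ℝ (fderiv ℝ F) (φ x) v (W' (φ x)) +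
        fderiv ℝ F (φ x) (fderiv ℝ W' (φ x) v)) pV.symm
  have e3 : fderiv ℝ (fderiv ℝ F) (φ x) (mfderiv 𝓘(ℝ, E) 𝓘(ℝ, E) φ x (W x)) (V' (φ x)) +
        fderiv ℝ F (φ x) (fderiv ℝ V' (φ x) (mfderiv 𝓘(ℝ, E) 𝓘(ℝ, E) φ x (W x))) =
      fderiv ℝ (fderiv ℝ F) (φ x) (W' (φ x)) (V' (φ x)) +
        fderiv ℝ F (φ x) (fderiv ℝ V' (φ x) (W' (φ x))) :=
    congrArg (fun v : E => fderiv ℝ (fderiv ℝ F) (φ x) v (V' (φ x)) +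
        fderiv ℝ F (φ x) (fderiv ℝ V' (φ x) v)) pW.symm
  refine e1.trans ?_
  refine Eq.trans ?_ (congrArg₂ (fun a b : ℂ => a - b) e2 e3).symm
  rw [map_sub, hs]
  ring
end Calculus

section Operators
set_option linter.unusedSectionVars false
variable {E : Type*} [NormedAddCommGroup E] [NormedSpace ℝ E] [FiniteDimensional ℝ E]
  {G : Type*} [TopologicalSpace G] [ChartedSpace E G] [Group G] [LieGroup 𝓘(ℝ, E) ω G]

variable (E G) in
/-- The Lie algebra of the Lie group `G`. -/
abbrev LieAlg : Type _ := GroupLieAlgebra 𝓘(ℝ, E) G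

/-- `(L_X φ)(x) = d/dt φ(x exp(tX))` at `t = 0`, written as the differential of `g ↦ φ(x g)`
at the identity in the direction `X`. -/
noncomputable def rightDeriv (X : LieAlg E G) (φ : G → ℂ) : G → ℂ :=
  fun x ↦ dAt (fun g ↦ φ (x * g)) (1 : G) X

/-- `(π(X) φ)(x) = d/dt φ(exp(-tX) x)` at `t = 0`, written as the differential of
`g ↦ (π(g) φ)(x) = φ(g⁻¹ x)` at the identity in the direction `X`. -/
noncomputable def leftDeriv (X : LieAlg E G) (φ : G → ℂ) : G → ℂ :=
  fun x ↦ dAt (fun g ↦ φ (g⁻¹ * x)) (1 : G) X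

theorem leftDeriv_contMDiff {m n : ℕ∞ω} (hmn : m + 1 ≤ n) (X : LieAlg E G) {φ : G → ℂ}
    (hφ : ContMDiff 𝓘(ℝ, E) 𝓘(ℝ, ℂ) n φ) :
    ContMDiff 𝓘(ℝ, E) 𝓘(ℝ, ℂ) m (leftDeriv X φ) := by
  have hn : n ≠ 0 := by
    rintro rfl
    simp at hmn
  let Φ : G × G → ℂ := fun p ↦ φ (p.1⁻¹ * p.2)
  have hΦ : ContMDiff (𝓘(ℝ, E).prod 𝓘(ℝ, E)) 𝓘(ℝ, ℂ) n Φ :=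
    hφ.comp ((contMDiff_fst.inv).mul contMDiff_snd)
  let fg : G → TangentBundle 𝓘(ℝ, E) G := fun g ↦ Bundle.TotalSpace.mk' E g 0
  have sfg : ContMDiff 𝓘(ℝ, E) 𝓘(ℝ, E).tangent m fg := Bundle.contMDiff_zeroSection _ _
  let fv : G → TangentBundle 𝓘(ℝ, E) G := fun _ ↦ Bundle.TotalSpace.mk' E 1 X
  have sfv : ContMDiff 𝓘(ℝ, E) 𝓘(ℝ, E).tangent m fv := contMDiff_const
  have S₂ : ContMDiff (𝓘(ℝ, E).tangent.prod 𝓘(ℝ, E).tangent) (𝓘(ℝ, E).prod 𝓘(ℝ, E)).tangent m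
    (equivTangentBundleProd 𝓘(ℝ, E) G 𝓘(ℝ, E) G).symm := contMDiff_equivTangentBundleProd_symm
  have S₃ := (hΦ.contMDiff_tangentMap hmn).comp (S₂.comp (sfv.prodMk sfg))
  have S₄ := (contMDiff_snd_tangentBundle_modelSpace ℂ 𝓘(ℝ, ℂ)).comp S₃
  refine S₄.congr fun x ↦ ?_
  have h := mfderiv_prod_eq_add_apply (I := 𝓘(ℝ, E)) (I' := 𝓘(ℝ, E)) (I'' := 𝓘(ℝ, ℂ))
    (p := ((1 : G), x)) (v := ((X, (0 : TangentSpace 𝓘(ℝ, E) x)) :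
      TangentSpace (𝓘(ℝ, E).prod 𝓘(ℝ, E)) ((1 : G), x))) (hΦ.mdifferentiable hn _)
  refine Eq.trans ?_ h.symm
  refine Eq.trans (add_zero _).symm ?_
  exact congrArg (fun w : ℂ ↦ leftDeriv X φ x + w) (map_zero (dAt (fun z ↦ Φ (1, z)) x)).symm

theorem leftDeriv_eq_rightDeriv (X : LieAlg E G) (φ : G → ℂ) (x : G) :
    leftDeriv X φ x = rightDeriv X (fun y ↦ φ y⁻¹) x⁻¹ := by
  simp [leftDeriv, rightDeriv]

theorem rightDeriv_eq (X : LieAlg E G) {φ : G → ℂ} (hφ : ContMDiff 𝓘(ℝ, E) 𝓘(ℝ, ℂ) 1 φ) (x : G) :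
    rightDeriv X φ x = dAt φ x (mulInvariantVectorField X x) := by
  have h1 : MDifferentiableAt 𝓘(ℝ, E) 𝓘(ℝ, ℂ) φ (x * 1) := hφ.mdifferentiable one_ne_zero _
  have h2 : MDifferentiableAt 𝓘(ℝ, E) 𝓘(ℝ, E) (fun g : G ↦ x * g) 1 :=
    (contMDiff_mul_left (n := 1)).mdifferentiable one_ne_zero _
  have h := mfderiv_comp (1 : G) h1 h2
  refine (congrArg (fun L ↦ L X) h).trans ?_
  have h3 : ∀ y, y = x → ∀ v : E, (mfderiv 𝓘(ℝ, E) 𝓘(ℝ, ℂ) φ y : E →L[ℝ] ℂ) v =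
    (mfderiv 𝓘(ℝ, E) 𝓘(ℝ, ℂ) φ x : E →L[ℝ] ℂ) v := by rintro y rfl v; rfl
  exact h3 _ (mul_one x) _

theorem rightDeriv_lie (X Y : LieAlg E G) {φ : G → ℂ} (hφ : ContMDiff 𝓘(ℝ, E) 𝓘(ℝ, ℂ) 2 φ)
    (hX : ContMDiff 𝓘(ℝ, E) 𝓘(ℝ, ℂ) 1 (rightDeriv X φ))
    (hY : ContMDiff 𝓘(ℝ, E) 𝓘(ℝ, ℂ) 1 (rightDeriv Y φ)) (x : G) :
    rightDeriv ⁅X, Y⁆ φ x = rightDeriv X (rightDeriv Y φ) x - rightDeriv Y (rightDeriv X φ) x := by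
  have h1 : ContMDiff 𝓘(ℝ, E) 𝓘(ℝ, ℂ) 1 φ := hφ.of_le one_le_two
  rw [rightDeriv_eq _ h1, rightDeriv_eq _ hX, rightDeriv_eq _ hY]
  have e : ∀ Z : LieAlg E G, rightDeriv Z φ = fun y ↦ dAt φ y (mulInvariantVectorField Z y) :=
    fun Z ↦ funext (rightDeriv_eq Z h1)
  rw [e X, e Y, GroupLieAlgebra.bracket_def, mulInvariantVector_mlieBracket]
  exact dAt_mlieBracket hφ (mdifferentiableAt_mulInvariantVectorField X)
    (mdifferentiableAt_mulInvariantVectorField Y)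

theorem rightDeriv_eq_leftDeriv (X : LieAlg E G) (φ : G → ℂ) :
    rightDeriv X (fun y ↦ φ y⁻¹) = fun x ↦ leftDeriv X φ x⁻¹ := by
  funext x
  rw [leftDeriv_eq_rightDeriv, inv_inv]

theorem leftDeriv_lie (X Y : LieAlg E G) {φ : G → ℂ} (hφ : ContMDiff 𝓘(ℝ, E) 𝓘(ℝ, ℂ) 2 φ) :
    leftDeriv ⁅X, Y⁆ φ = leftDeriv X (leftDeriv Y φ) - leftDeriv Y (leftDeriv X φ) := by
  have hi : ContMDiff 𝓘(ℝ, E) 𝓘(ℝ, E) ω (fun y : G ↦ y⁻¹) := contMDiff_inv _ _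
  have hl : ∀ Z : LieAlg E G, ContMDiff 𝓘(ℝ, E) 𝓘(ℝ, ℂ) 1 (leftDeriv Z φ) := fun Z ↦
    leftDeriv_contMDiff (by norm_num) Z hφ
  have hr : ∀ Z : LieAlg E G, ContMDiff 𝓘(ℝ, E) 𝓘(ℝ, ℂ) 1 (rightDeriv Z fun y ↦ φ y⁻¹) := by
    intro Z
    rw [rightDeriv_eq_leftDeriv]
    exact (hl Z).comp (hi.of_le le_top)
  have hφi : ContMDiff 𝓘(ℝ, E) 𝓘(ℝ, ℂ) 2 (fun y : G ↦ φ y⁻¹) := hφ.comp (hi.of_le le_top)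
  funext x
  rw [leftDeriv_eq_rightDeriv, rightDeriv_lie X Y hφi (hr X) (hr Y),
    rightDeriv_eq_leftDeriv, rightDeriv_eq_leftDeriv, rightDeriv_eq_leftDeriv,
    rightDeriv_eq_leftDeriv]
  simp

theorem leftDeriv_add (X : LieAlg E G) {φ ψ : G → ℂ} (hφ : ContMDiff 𝓘(ℝ, E) 𝓘(ℝ, ℂ) 1 φ)
    (hψ : ContMDiff 𝓘(ℝ, E) 𝓘(ℝ, ℂ) 1 ψ) :
    leftDeriv X (φ + ψ) = leftDeriv X φ + leftDeriv X ψ := by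
  funext x
  have h : ContMDiff 𝓘(ℝ, E) 𝓘(ℝ, E) 1 (fun g : G ↦ g⁻¹ * x) :=
    (contMDiff_id.inv).mul contMDiff_const
  exact congrArg (fun L ↦ L X) (mfderiv_add ((hφ.comp h).mdifferentiable one_ne_zero 1)
    ((hψ.comp h).mdifferentiable one_ne_zero 1))

theorem leftDeriv_smul (X : LieAlg E G) (c : ℂ) {φ : G → ℂ}
    (hφ : ContMDiff 𝓘(ℝ, E) 𝓘(ℝ, ℂ) 1 φ) :
    leftDeriv X (c • φ) = c • leftDeriv X φ := by
  funext x
  have h : ContMDiff 𝓘(ℝ, E) 𝓘(ℝ, E) 1 (fun g : G ↦ g⁻¹ * x) :=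
    (contMDiff_id.inv).mul contMDiff_const
  have h1 := ((hφ.comp h).mdifferentiable one_ne_zero (1 : G)).hasMFDerivAt
  let L : ℂ →L[ℝ] ℂ := (ContinuousLinearMap.mul ℝ ℂ c)
  have h2 : HasMFDerivAt 𝓘(ℝ, ℂ) 𝓘(ℝ, ℂ) L ((φ ∘ fun g : G ↦ g⁻¹ * x) 1) L :=
    L.hasMFDerivAt
  exact congrArg (fun L ↦ L X) (h2.comp _ h1).mfderiv

theorem leftDeriv_hasCompactSupport (X : LieAlg E G) {φ : G → ℂ} (hφ : HasCompactSupport φ) :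
    HasCompactSupport (leftDeriv X φ) := by
  have : ContinuousMul G := (topologicalGroup_of_lieGroup 𝓘(ℝ, E) ω (G := G)).toContinuousMul
  have : ContinuousInv G := (topologicalGroup_of_lieGroup 𝓘(ℝ, E) ω (G := G)).toContinuousInv
  refine hφ.mono' fun x hx ↦ ?_
  by_contra hc
  apply hx
  have h1 : φ =ᶠ[𝓝 x] 0 := notMem_tsupport_iff_eventuallyEq.1 hc
  have h2 : Tendsto (fun g : G ↦ g⁻¹ * x) (𝓝 1) (𝓝 x) := by
    have : Continuous fun g : G ↦ g⁻¹ * x := by fun_prop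
    simpa using this.tendsto 1
  have h3 : (fun g : G ↦ φ (g⁻¹ * x)) =ᶠ[𝓝 1] fun _ ↦ 0 := h2.eventually h1
  have h4 := dAt_congr (E := E) h3
  have h5 : dAt (E := E) (fun _ : G ↦ (0 : ℂ)) 1 = 0 := mfderiv_const
  exact (congrArg (fun L ↦ L X) (h4.trans h5))


end Operators

section Representation

set_option linter.unusedSectionVars false

variable (E : Type*) [NormedAddCommGroup E] [NormedSpace ℝ E] [FiniteDimensional ℝ E]
  (G : Type*) [TopologicalSpace G] [ChartedSpace E G] [Group G] [LieGroup 𝓘(ℝ, E) ω G]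

attribute [local instance 100] LieRing.ofAssociativeRing

/-- The universal enveloping algebra of the complexification of the Lie algebra of `G`. -/
abbrev UAlg : Type _ := UniversalEnvelopingAlgebra ℂ (ℂ ⊗[ℝ] LieAlg E G)

variable {E G} in
/-- The canonical map from the real Lie algebra to its enveloping algebra. -/
noncomputable def toU (X : LieAlg E G) : UAlg E G :=
  UniversalEnvelopingAlgebra.ι ℂ ((1 : ℂ) ⊗ₜ[ℝ] X)

/-- The `ℂ`-linear extension of a real Lie algebra homomorphism into a complex associative
algebra. -/
noncomputable def complexify {L A : Type*} [LieRing L] [LieAlgebra ℝ L] [Ring A] [Algebra ℂ A]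
    (f : L →ₗ[ℝ] A) (hf : ∀ X Y, f ⁅X, Y⁆ = f X * f Y - f Y * f X) : (ℂ ⊗[ℝ] L) →ₗ⁅ℂ⁆ A :=
  { f.liftBaseChange ℂ with
    map_lie' := by
      intro x y
      change f.liftBaseChange ℂ ⁅x, y⁆ = ⁅f.liftBaseChange ℂ x, f.liftBaseChange ℂ y⁆
      induction x using TensorProduct.induction_on with
      | zero => simp
      | add x₁ x₂ h₁ h₂ => rw [add_lie, map_add, map_add, add_lie, h₁, h₂]
      | tmul a X =>
        induction y using TensorProduct.induction_on with
        | zero =>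
          have h := LieRing.lie_add (a ⊗ₜ[ℝ] X) (0 : ℂ ⊗[ℝ] L) 0
          rw [add_zero] at h
          rw [left_eq_add.1 h, map_zero, lie_zero]
        | add y₁ y₂ h₁ h₂ => rw [LieRing.lie_add, map_add, map_add, lie_add, h₁, h₂]
        | tmul b Y =>
          simp [LieAlgebra.ExtendScalars.bracket_tmul, LieRing.of_associative_ring_bracket, hf,
            smul_sub, mul_smul, smul_comm a b] }

/-- The anti-automorphism `a` of the enveloping algebra with `a(X) = -X`, `a(XY) = YX` for `X`,
`Y` in the Lie algebra, as a homomorphism to the opposite algebra. -/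
noncomputable def antiAutOp : UAlg E G →ₐ[ℂ] (UAlg E G)ᵐᵒᵖ :=
  UniversalEnvelopingAlgebra.lift ℂ
    { toFun := fun X ↦ -MulOpposite.op (UniversalEnvelopingAlgebra.ι ℂ X)
      map_add' := by
        intro X Y
        simp [add_comm]
      map_smul' := by
        intro c X
        simp
      map_lie' := by
        intro X Y
        simp [LieRing.of_associative_ring_bracket] }

variable {E G} in
/-- The anti-automorphism `a` of the enveloping algebra. -/
noncomputable def antiAut (D : UAlg E G) : UAlg E G := (antiAutOp E G D).unop

/-- A space of smooth functions on `G` that is stable under right translations and under the left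
regular representation of the Lie algebra. -/
structure RegularSpace where
  carrier : Submodule ℂ (G → ℂ)
  smooth : ∀ φ ∈ carrier, ContMDiff 𝓘(ℝ, E) 𝓘(ℝ, ℂ) ∞ φ
  leftDeriv_mem : ∀ (X : LieAlg E G), ∀ φ ∈ carrier, leftDeriv X φ ∈ carrier
  translate_mem : ∀ (p : G), ∀ φ ∈ carrier, (fun x ↦ φ (x * p)) ∈ carrier

namespace RegularSpace

variable {E G} (V : RegularSpace E G)

/-- The operator `π(X)` on a space of functions. -/
noncomputable def lieAct : LieAlg E G →ₗ[ℝ] Module.End ℂ V.carrier where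
  toFun X :=
    { toFun := fun φ ↦ ⟨leftDeriv X φ.1, V.leftDeriv_mem X φ.1 φ.2⟩
      map_add' := fun φ ψ ↦ Subtype.ext <| leftDeriv_add X ((V.smooth _ φ.2).of_le (by simp))
        ((V.smooth _ ψ.2).of_le (by simp))
      map_smul' := fun c φ ↦ Subtype.ext <| leftDeriv_smul X c ((V.smooth _ φ.2).of_le (by simp)) }
  map_add' X Y := by
    ext φ x
    exact map_add (dAt (fun g ↦ φ.1 (g⁻¹ * x)) (1 : G)) X Y
  map_smul' r X := by
    ext φ x
    exact (map_smul (dAt (fun g ↦ φ.1 (g⁻¹ * x)) (1 : G)) r X)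

/-- The left regular representation `π` of the enveloping algebra on a space of functions. -/
noncomputable def rep : UAlg E G →ₐ[ℂ] Module.End ℂ V.carrier :=
  UniversalEnvelopingAlgebra.lift ℂ (complexify (A := Module.End ℂ V.carrier) V.lieAct (by
    intro X Y
    refine LinearMap.ext fun φ ↦ Subtype.ext ?_
    exact leftDeriv_lie X Y ((V.smooth _ φ.2).of_le (WithTop.coe_le_coe.2 le_top))))

/-- The right translation `(R_p φ)(x) = φ(xp)`. -/
def translate (p : G) : V.carrier →ₗ[ℂ] V.carrier where
  toFun φ := ⟨fun x ↦ φ.1 (x * p), V.translate_mem p φ.1 φ.2⟩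
  map_add' _ _ := rfl
  map_smul' _ _ := rfl

end RegularSpace

/-- Functions of class `C^n`. -/
def contMDiffFunctions (n : ℕ∞ω) : Submodule ℂ (G → ℂ) where
  carrier := {φ | ContMDiff 𝓘(ℝ, E) 𝓘(ℝ, ℂ) n φ}
  add_mem' h₁ h₂ := h₁.add h₂
  zero_mem' := contMDiff_const
  smul_mem' c _ h := (((ContinuousLinearMap.mul ℝ ℂ) c).contMDiff (n := n)).comp h

/-- The space `C^∞(G)` of complex valued smooth functions. -/
def smoothSpace : RegularSpace E G where
  carrier := contMDiffFunctions E G ∞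
  smooth _ h := h
  leftDeriv_mem X _ h := leftDeriv_contMDiff (by simp) X h
  translate_mem p φ h := ContMDiff.comp (g := φ) h contMDiff_mul_right

/-- The space `𝒜(G)` of complex valued real analytic functions. -/
def analyticSpace : RegularSpace E G where
  carrier := contMDiffFunctions E G ω
  smooth _ h := ContMDiff.of_le h le_top
  leftDeriv_mem X _ h := leftDeriv_contMDiff (by simp) X h
  translate_mem p φ h := ContMDiff.comp (g := φ) h contMDiff_mul_right

/-- The space `C_c^∞(G)` of complex valued smooth functions with compact support. -/
def testSpace : RegularSpace E G where
  carrier := contMDiffFunctions E G ∞ ⊓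
    { carrier := {φ | HasCompactSupport φ}
      add_mem' := fun h₁ h₂ ↦ h₁.add h₂
      zero_mem' := HasCompactSupport.zero
      smul_mem' := fun _ _ h ↦ HasCompactSupport.smul_left h }
  smooth _ h := h.1
  leftDeriv_mem X _ h := ⟨leftDeriv_contMDiff (by simp) X h.1, leftDeriv_hasCompactSupport X h.2⟩
  translate_mem p φ h := by
    have : ContinuousMul G := (topologicalGroup_of_lieGroup 𝓘(ℝ, E) ω (G := G)).toContinuousMul
    exact ⟨ContMDiff.comp (g := φ) h.1 contMDiff_mul_right,
      HasCompactSupport.comp_homeomorph h.2 (Homeomorph.mulRight p)⟩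

end Representation

section FunctionSpaces

universe u v

set_option linter.unusedSectionVars false

variable (E : Type u) [NormedAddCommGroup E] [NormedSpace ℝ E] [FiniteDimensional ℝ E]
  (G : Type v) [TopologicalSpace G] [ChartedSpace E G] [Group G] [LieGroup 𝓘(ℝ, E) ω G]

/-- A space of generalized functions on `G`, with the relation `f(x p) = c f(x)` and the relation
`π(D) f = 0`. -/
structure FunctionSpace where
  /-- The generalized functions. -/
  Obj : Type v
  /-- `IsTranslateEq f p c` says that `f(x p) = c f(x)` as generalized functions of `x`. -/
  IsTranslateEq : Obj → G → ℂ → Prop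
  /-- `IsKilledBy f D` says that `π(D) f = 0`. -/
  IsKilledBy : Obj → UAlg E G → Prop

/-- A space of functions as a space of generalized functions. -/
def RegularSpace.toFunctionSpace {E : Type u} [NormedAddCommGroup E] [NormedSpace ℝ E]
    [FiniteDimensional ℝ E] {G : Type v} [TopologicalSpace G] [ChartedSpace E G] [Group G]
    [LieGroup 𝓘(ℝ, E) ω G] (V : RegularSpace E G) : FunctionSpace E G where
  Obj := V.carrier
  IsTranslateEq f p c := ∀ x, f.1 (x * p) = c * f.1 x
  IsKilledBy f D := V.rep D f = 0

section Dual

variable {E G} (V : RegularSpace E G)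

/-- Right translation of a functional, `(R_p u)(φ) = u(R_{p⁻¹} φ)`: on the functional
`φ ↦ ∫ f φ` given by a function `f` and a Haar measure (a semisimple group is unimodular) it is
the translation `f(x) ↦ f(x p)`. -/
def RegularSpace.dualTranslate (p : G) (u : V.carrier →ₗ[ℂ] ℂ) : V.carrier →ₗ[ℂ] ℂ :=
  u ∘ₗ V.translate p⁻¹

/-- The representation `(π(D) u)(φ) = u(π(a(D)) φ)` of the enveloping algebra on functionals; it
extends the action of `π(D)` on functions for the pairing `φ ↦ ∫ f φ` with a Haar measure. -/
noncomputable def RegularSpace.dualRep (D : UAlg E G) (u : V.carrier →ₗ[ℂ] ℂ) :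
    V.carrier →ₗ[ℂ] ℂ :=
  u ∘ₗ V.rep (antiAut D)

/-- The iterated derivative `L_{X₁} ⋯ L_{X_k} φ` along left invariant vector fields. -/
noncomputable def wordDeriv (w : List (LieAlg E G)) (φ : G → ℂ) : G → ℂ :=
  w.foldr rightDeriv φ

/-- A linear functional on `C_c^∞(G)` is a distribution if, on the test functions supported in a
given compact set, it is bounded by finitely many suprema of derivatives. -/
def IsDistribution (T : (testSpace E G).carrier →ₗ[ℂ] ℂ) : Prop :=
  ∀ C : Set G, IsCompact C → ∃ (S : Finset (List (LieAlg E G))) (c : ℝ), ∀ φ : (testSpace E G).carrier,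
    tsupport φ.1 ⊆ C → ∀ M : ℝ, 0 ≤ M → (∀ w ∈ S, ∀ x, ‖wordDeriv w φ.1 x‖ ≤ M) → ‖T φ‖ ≤ c * M

/-- A linear functional `u` on `𝒜(G)` is an analytic functional carried by the compact set `C` if
it is continuous for the topology of the space of germs of real analytic functions at `C`: for
each open `U ⊇ C` and each `h > 0` it is bounded on the functions that satisfy the Cauchy estimates
`|L_{X₁} ⋯ L_{X_k} φ| ≤ M h^k k!` on `U` for all `X₁, …, X_k` in the unit ball. -/
def IsCarriedBy (u : (analyticSpace E G).carrier →ₗ[ℂ] ℂ) (C : Set G) : Prop :=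
  ∀ U : Set G, IsOpen U → C ⊆ U → ∀ h : ℝ, 0 < h → ∃ c : ℝ, ∀ φ : (analyticSpace E G).carrier,
    ∀ M : ℝ, 0 ≤ M →
    (∀ w : List (LieAlg E G), (∀ X ∈ w, @norm E _ X ≤ 1) → ∀ x ∈ U,
      ‖wordDeriv w φ.1 x‖ ≤ M * h ^ w.length * w.length.factorial) → ‖u φ‖ ≤ c * M

theorem IsCarriedBy.mono {u : (analyticSpace E G).carrier →ₗ[ℂ] ℂ} {C C' : Set G}
    (h : IsCarriedBy u C) (hC : C ⊆ C') : IsCarriedBy u C' :=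
  fun U hU hCU ↦ h U hU (hC.trans hCU)

theorem isCarriedBy_zero (C : Set G) : IsCarriedBy (0 : (analyticSpace E G).carrier →ₗ[ℂ] ℂ) C :=
  fun _ _ _ _ _ ↦ ⟨0, fun _ _ _ _ ↦ by simp⟩

theorem IsCarriedBy.add {u v : (analyticSpace E G).carrier →ₗ[ℂ] ℂ} {C : Set G}
    (hu : IsCarriedBy u C) (hv : IsCarriedBy v C) : IsCarriedBy (u + v) C := by
  intro U hU hCU h hh
  obtain ⟨c, hc⟩ := hu U hU hCU h hh
  obtain ⟨d, hd⟩ := hv U hU hCU h hh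
  refine ⟨c + d, fun φ M hM hφ ↦ ?_⟩
  rw [add_mul]
  exact (norm_add_le _ _).trans (add_le_add (hc φ M hM hφ) (hd φ M hM hφ))

theorem IsCarriedBy.smul {u : (analyticSpace E G).carrier →ₗ[ℂ] ℂ} {C : Set G}
    (hu : IsCarriedBy u C) (a : ℂ) : IsCarriedBy (a • u) C := by
  intro U hU hCU h hh
  obtain ⟨c, hc⟩ := hu U hU hCU h hh
  refine ⟨‖a‖ * c, fun φ M hM hφ ↦ ?_⟩
  rw [LinearMap.smul_apply, norm_smul, mul_assoc]
  exact mul_le_mul_of_nonneg_left (hc φ M hM hφ) (norm_nonneg a)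

/-- The analytic functional `u` vanishes on the open set `U`: it is carried by a compact set that
does not meet `U`. -/
def VanishesOn (u : (analyticSpace E G).carrier →ₗ[ℂ] ℂ) (U : Set G) : Prop :=
  ∃ C : Set G, IsCompact C ∧ Disjoint C U ∧ IsCarriedBy u C

/-- The analytic functionals, i.e. the hyperfunctions with compact support, that vanish on `U`. -/
def vanishing (U : Set G) : Submodule ℂ ((analyticSpace E G).carrier →ₗ[ℂ] ℂ) where
  carrier := {u | VanishesOn u U}
  add_mem' := by
    rintro u v ⟨C, hC, hCU, hu⟩ ⟨C', hC', hCU', hv⟩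
    exact ⟨C ∪ C', hC.union hC', Set.disjoint_union_left.2 ⟨hCU, hCU'⟩,
      (hu.mono subset_union_left).add (hv.mono subset_union_right)⟩
  zero_mem' := ⟨∅, isCompact_empty, Set.empty_disjoint U, isCarriedBy_zero ∅⟩
  smul_mem' := by
    rintro a u ⟨C, hC, hCU, hu⟩
    exact ⟨C, hC, hCU, hu.smul a⟩

variable (G) in
/-- The relatively compact open subsets of `G`. -/
abbrev RelCompactOpens : Type _ := {U : Set G // IsOpen U ∧ IsCompact (closure U)}

/-- The open set `U p`. -/
def RelCompactOpens.translate (p : G) (U : RelCompactOpens G) : RelCompactOpens G :=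
  ⟨(fun x ↦ x * p⁻¹) ⁻¹' U.1, by
    have : ContinuousMul G := (topologicalGroup_of_lieGroup 𝓘(ℝ, E) ω (G := G)).toContinuousMul
    have h : (fun x ↦ x * p⁻¹) ⁻¹' U.1 = Homeomorph.mulRight p⁻¹ ⁻¹' U.1 := rfl
    rw [h, ← Homeomorph.preimage_closure]
    exact ⟨U.2.1.preimage (Homeomorph.continuous _),
      (Homeomorph.isCompact_preimage _).2 U.2.2⟩⟩

variable (E G) in
/-- Families of functionals indexed by the relatively compact open subsets of `G`. -/
abbrev FunctionalFamily : Type _ := RelCompactOpens G → (analyticSpace E G).carrier →ₗ[ℂ] ℂ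

variable (E G) in
/-- The compatible families of analytic functionals. Over a relatively compact open set `U` a
hyperfunction is the class of a compactly supported analytic functional modulo those that vanish
on `U`; the family is compatible if `u_U` restricts to `u_V` for `V ⊆ U`. -/
def compatibleFamilies : Submodule ℂ (FunctionalFamily E G) where
  carrier := {u | (∀ U, ∃ C, IsCompact C ∧ IsCarriedBy (u U) C) ∧
    ∀ U V : RelCompactOpens G, V.1 ⊆ U.1 → u U - u V ∈ vanishing V.1}
  add_mem' := by
    rintro u v ⟨hu, hu'⟩ ⟨hv, hv'⟩
    refine ⟨fun U ↦ ?_, fun U V h ↦ ?_⟩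
    · obtain ⟨C, hC, h⟩ := hu U
      obtain ⟨C', hC', h'⟩ := hv U
      exact ⟨C ∪ C', hC.union hC', (h.mono subset_union_left).add (h'.mono subset_union_right)⟩
    · rw [Pi.add_apply, Pi.add_apply, add_sub_add_comm]
      exact add_mem (hu' U V h) (hv' U V h)
  zero_mem' := ⟨fun _ ↦ ⟨∅, isCompact_empty, isCarriedBy_zero ∅⟩, fun U V _ ↦ by simp⟩
  smul_mem' := by
    rintro a u ⟨hu, hu'⟩
    refine ⟨fun U ↦ ?_, fun U V h ↦ ?_⟩
    · obtain ⟨C, hC, h⟩ := hu U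
      exact ⟨C, hC, h.smul a⟩
    · rw [Pi.smul_apply, Pi.smul_apply, ← smul_sub]
      exact Submodule.smul_mem _ a (hu' U V h)

variable (E G) in
/-- The families that represent the hyperfunction zero. -/
def nullFamilies : Submodule ℂ (FunctionalFamily E G) where
  carrier := {u | ∀ U, u U ∈ vanishing U.1}
  add_mem' hu hv U := (vanishing (E := E) U.1).add_mem (hu U) (hv U)
  zero_mem' U := (vanishing (E := E) U.1).zero_mem
  smul_mem' a _ hu U := (vanishing (E := E) U.1).smul_mem a (hu U)

variable (E G) in
/-- The space `ℬ(G)` of hyperfunctions on `G`. -/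
abbrev Hyperfunction : Type _ :=
  compatibleFamilies E G ⧸ (nullFamilies E G).comap (compatibleFamilies E G).subtype

/-- Right translation of families: `f(x p)` on `U` comes from `f` on `U p`. -/
def familyTranslate (p : G) (u : FunctionalFamily E G) : FunctionalFamily E G :=
  fun U ↦ (analyticSpace E G).dualTranslate p (u (U.translate (E := E) p))

/-- The action of the enveloping algebra on families. -/
noncomputable def familyRep (D : UAlg E G) (u : FunctionalFamily E G) : FunctionalFamily E G :=
  fun U ↦ (analyticSpace E G).dualRep D (u U)

end Dual

/-- Real analytic functions `𝒜(G)`. -/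
noncomputable def analyticFunctions : FunctionSpace E G := (analyticSpace E G).toFunctionSpace

/-- Smooth functions `C^∞(G)`. -/
noncomputable def smoothFunctions : FunctionSpace E G := (smoothSpace E G).toFunctionSpace

/-- Distributions `𝒟'(G)`. -/
noncomputable def distributions : FunctionSpace E G where
  Obj := {T : (testSpace E G).carrier →ₗ[ℂ] ℂ // IsDistribution T}
  IsTranslateEq T p c := (testSpace E G).dualTranslate p T.1 = c • T.1
  IsKilledBy T D := (testSpace E G).dualRep D T.1 = 0

/-- Hyperfunctions `ℬ(G)`. -/
noncomputable def hyperfunctions : FunctionSpace E G where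
  Obj := Hyperfunction E G
  IsTranslateEq f p c := ∀ u : compatibleFamilies E G, Submodule.Quotient.mk u = f →
    familyTranslate p u.1 - c • u.1 ∈ nullFamilies E G
  IsKilledBy f D := ∀ u : compatibleFamilies E G, Submodule.Quotient.mk u = f →
    familyRep D u.1 ∈ nullFamilies E G

end FunctionSpaces

section Structure

set_option linter.unusedSectionVars false

universe u v

variable {E : Type u} [NormedAddCommGroup E] [NormedSpace ℝ E] [FiniteDimensional ℝ E]
  {G : Type v} [TopologicalSpace G] [ChartedSpace E G] [Group G] [LieGroup 𝓘(ℝ, E) ω G]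

instance : FiniteDimensional ℝ (LieAlg E G) := inferInstanceAs (FiniteDimensional ℝ E)

open Classical in
/-- The exponential map: `exp X = γ(1)` for the integral curve `γ` with `γ(0) = 1` of the left
invariant vector field defined by `X`. -/
noncomputable def lieExp (X : LieAlg E G) : G :=
  if h : ∃ γ : ℝ → G, γ 0 = 1 ∧ IsMIntegralCurve (I := 𝓘(ℝ, E)) γ (mulInvariantVectorField X) then
    h.choose 1 else 1

/-- The analytic subgroup of `G` with Lie algebra `s`: the subgroup generated by `exp s`. -/
noncomputable def analyticSubgroup (s : Submodule ℝ (LieAlg E G)) : Subgroup G :=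
  Subgroup.closure (lieExp '' (s : Set (LieAlg E G)))

theorem lieExp_mem {s : Submodule ℝ (LieAlg E G)} {X : LieAlg E G} (h : X ∈ s) :
    lieExp X ∈ analyticSubgroup s :=
  Subgroup.subset_closure ⟨X, h, rfl⟩

/-- The adjoint action of `G` on its Lie algebra. -/
noncomputable def adjointAction (g : G) (X : LieAlg E G) : LieAlg E G :=
  mfderiv 𝓘(ℝ, E) 𝓘(ℝ, E) (fun x : G ↦ g * x * g⁻¹) 1 X

/-- The simultaneous eigenspace `{X | [H, X] = α(H) X for all H ∈ 𝔞}`. -/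
noncomputable def restrictedRootSpace (a : Submodule ℝ (LieAlg E G)) (α : Module.Dual ℝ a) :
    Submodule ℝ (LieAlg E G) :=
  ⨅ H : a, LinearMap.ker (LieAlgebra.ad ℝ (LieAlg E G) (H : LieAlg E G) - α H • LinearMap.id)

/-- The restricted roots. -/
noncomputable def restrictedRoots (a : Submodule ℝ (LieAlg E G)) : Set (Module.Dual ℝ a) :=
  {α | α ≠ 0 ∧ restrictedRootSpace a α ≠ ⊥}

variable (E G) in
/-- A Cartan involution `θ`, a maximal abelian subspace `𝔞` of the `-1` eigenspace `𝔭` of `θ`, and a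
positive system of the restricted roots. -/
structure IwasawaData where
  /-- The Cartan involution. -/
  θ : LieAlg E G ≃ₗ⁅ℝ⁆ LieAlg E G
  θ_involutive : ∀ X, θ (θ X) = X
  θ_pos : ∀ X, X ≠ 0 → 0 < -killingForm ℝ (LieAlg E G) X (θ X)
  /-- The maximal abelian subspace of `𝔭`. -/
  a : Submodule ℝ (LieAlg E G)
  a_le : ∀ H ∈ a, θ H = -H
  a_comm : ∀ H ∈ a, ∀ H' ∈ a, ⁅H, H'⁆ = 0
  a_maximal : ∀ X, θ X = -X → (∀ H ∈ a, ⁅H, X⁆ = 0) → X ∈ a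
  /-- The positive system, the set of the roots that are positive on some Weyl chamber. -/
  positive : Set (Module.Dual ℝ a)
  positive_spec : ∃ H₀ : a, (∀ α ∈ restrictedRoots a, α H₀ ≠ 0) ∧
    positive = {α ∈ restrictedRoots a | 0 < α H₀}

namespace IwasawaData

variable (D : IwasawaData E G)

/-- The Lie algebra `𝔨` of the fixed points of the Cartan involution. -/
noncomputable def k : Submodule ℝ (LieAlg E G) := LinearMap.eqLocus (D.θ : LieAlg E G →ₗ[ℝ] LieAlg E G)
  LinearMap.id

/-- The group `K`, a maximal compact subgroup modulo the center of `G` if `G` is connected. -/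
noncomputable def K : Subgroup G := analyticSubgroup D.k

/-- The centralizer `𝔪` of `𝔞` in `𝔨`. -/
noncomputable def m : Submodule ℝ (LieAlg E G) :=
  D.k ⊓ ⨅ H : D.a, LinearMap.ker (LieAlgebra.ad ℝ (LieAlg E G) (H : LieAlg E G))

/-- The centralizer `M` of `𝔞` in `K`. -/
noncomputable def M : Set G := {g | g ∈ D.K ∧ ∀ H ∈ D.a, adjointAction g H = H}

/-- The restricted root space of `α`. -/
noncomputable def rootSpace (α : Module.Dual ℝ D.a) : Submodule ℝ (LieAlg E G) := restrictedRootSpace D.a α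

/-- The simple roots of the positive system. -/
noncomputable def simple : Set (Module.Dual ℝ D.a) :=
  {α ∈ D.positive | ¬∃ β ∈ D.positive, ∃ γ ∈ D.positive, α = β + γ}

/-- The nilpotent algebra `𝔫`, the sum of the positive root spaces. -/
noncomputable def n : Submodule ℝ (LieAlg E G) := ⨆ α ∈ D.positive, D.rootSpace α

/-- The group `N`. -/
noncomputable def N : Subgroup G := analyticSubgroup D.n

/-- The Lie algebra `𝔭₀ = 𝔪 + 𝔞 + 𝔫` of the minimal parabolic subgroup `P = MAN`. -/
noncomputable def p₀ : Submodule ℝ (LieAlg E G) := D.m ⊔ D.a ⊔ D.n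

/-- Half the sum `ρ` of the positive roots counted with multiplicities. -/
noncomputable def rho : Module.Dual ℝ D.a :=
  (1 / 2 : ℝ) • ∑ᶠ α ∈ D.positive, (Module.finrank ℝ (D.rootSpace α) : ℝ) • α

section Parabolic

variable (Ξ : Set (Module.Dual ℝ D.a))

/-- `𝔞_Ξ`, the common zeros in `𝔞` of the roots in `Ξ`. -/
noncomputable def aXi : Submodule ℝ D.a := ⨅ α ∈ Ξ, LinearMap.ker (α : D.a →ₗ[ℝ] ℝ)

/-- `𝔪_Ξ`, the orthogonal complement of `𝔞_Ξ`, for the Killing form, in its centralizer. -/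
noncomputable def mXi : Submodule ℝ (LieAlg E G) :=
  (⨅ H : D.aXi Ξ, LinearMap.ker (LieAlgebra.ad ℝ (LieAlg E G) (H : LieAlg E G))) ⊓
    ⨅ H : D.aXi Ξ, LinearMap.ker (killingForm ℝ (LieAlg E G) (H : LieAlg E G))

/-- The derived algebra `[𝔪_Ξ, 𝔪_Ξ]`. -/
noncomputable def derivedMXi : Submodule ℝ (LieAlg E G) :=
  Submodule.span ℝ {Z | ∃ X ∈ D.mXi Ξ, ∃ Y ∈ D.mXi Ξ, (⁅X, Y⁆ : LieAlg E G) = Z}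

/-- `𝔫_Ξ`, the sum of the root spaces of the positive roots that do not vanish on `𝔞_Ξ`. -/
noncomputable def nXi : Submodule ℝ (LieAlg E G) :=
  ⨆ α ∈ {α ∈ D.positive | ∃ H ∈ D.aXi Ξ, α H ≠ 0}, D.rootSpace α

/-- The Lie algebra `𝔭_Ξ = 𝔪_Ξ + 𝔞_Ξ + 𝔫_Ξ` of the parabolic subgroup `P_Ξ = M_Ξ A_Ξ N_Ξ`. -/
noncomputable def pXi : Submodule ℝ (LieAlg E G) := D.mXi Ξ ⊔ (D.aXi Ξ).map D.a.subtype ⊔ D.nXi Ξ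

/-- The semisimple part `M_{Ξ,s}^o` of `M_Ξ`, the analytic subgroup with Lie algebra
`[𝔪_Ξ, 𝔪_Ξ]`. -/
noncomputable def semisimplePart : Subgroup G := analyticSubgroup (D.derivedMXi Ξ)

/-- The group `N_Ξ`. -/
noncomputable def NXi : Subgroup G := analyticSubgroup (D.nXi Ξ)

theorem isCompl_aXi :
    IsCompl (D.aXi Ξ)
      (LinearMap.BilinForm.orthogonal
        (LinearMap.BilinForm.restrict (killingForm ℝ (LieAlg E G)) D.a) (D.aXi Ξ)) := by
  have hs : LinearMap.BilinForm.IsSymm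
      (LinearMap.BilinForm.restrict (killingForm ℝ (LieAlg E G)) D.a) :=
    ⟨fun x y ↦ LieModule.traceForm_comm ℝ _ _ _ _⟩
  rw [LinearMap.BilinForm.isCompl_orthogonal_iff_disjoint hs.isRefl, Submodule.disjoint_def]
  intro x hx hx'
  by_contra h0
  have h1 := hx' x hx
  have h2 := D.θ_pos x (by simpa using h0)
  rw [D.a_le x x.2, map_neg, neg_neg] at h2
  exact h2.ne' h1

/-- The orthogonal projection of `𝔞` onto `𝔞_Ξ` for the Killing form. -/
noncomputable def projXi : D.a →ₗ[ℝ] D.aXi Ξ :=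
  (D.aXi Ξ).projectionOnto _ (D.isCompl_aXi Ξ)

/-- `ρ(Ξ) = ρ - ρ_Ξ`, where `ρ_Ξ` is the restriction of `ρ` to `𝔞_Ξ`, extended to `𝔞` by zero on the
orthogonal complement. -/
noncomputable def rhoXi : Module.Dual ℝ D.a :=
  D.rho - (D.rho ∘ₗ (D.aXi Ξ).subtype) ∘ₗ D.projXi Ξ

/-- The element `μ + ρ(Ξ)` of the complex dual of `𝔞`; `μ` is extended by zero on the orthogonal
complement of `𝔞_Ξ`. -/
noncomputable def shift (μ : D.aXi Ξ →ₗ[ℝ] ℂ) : D.a →ₗ[ℝ] ℂ :=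
  μ ∘ₗ D.projXi Ξ + Complex.ofRealCLM.toLinearMap ∘ₗ D.rhoXi Ξ

variable (χ : D.K →* ℂˣ)

/-- The differential of the character `χ` of `K`. -/
noncomputable def dchi (X : D.k) : ℂ :=
  deriv (fun t : ℝ ↦
    ((χ ⟨lieExp (t • (X : LieAlg E G)), lieExp_mem (D.k.smul_mem t X.2)⟩ : ℂˣ) : ℂ)) 0

/-- The graph of the character `λ` of `𝔭_Ξ` that is the differential of the character
`τ(y m a n) = χ(m)⁻¹ a^{μ - ρ}` of `P_Ξ`, for `y` in the semisimple part of `M_Ξ`, `m` in `M`, `a` in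
`A_Ξ` and `n` in `N_Ξ`. -/
noncomputable def IsLambda (μ : D.aXi Ξ →ₗ[ℝ] ℂ) (X : LieAlg E G) (c : ℂ) : Prop :=
  ∃ Y ∈ D.derivedMXi Ξ, ∃ Z : D.k, (Z : LieAlg E G) ∈ D.m ∧ ∃ H : D.aXi Ξ, ∃ W ∈ D.nXi Ξ,
    X = Y + (Z : LieAlg E G) + (H : LieAlg E G) + W ∧
    c = -D.dchi χ Z + (μ H - (D.rho (H : D.a) : ℂ))

/-- The left ideal `∑_{X ∈ q} U(𝔤) (X - λ(X))`. -/
noncomputable def leftIdeal (μ : D.aXi Ξ →ₗ[ℝ] ℂ) (q : Submodule ℝ (LieAlg E G)) :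
    Ideal (UAlg E G) :=
  Ideal.span {T | ∃ X ∈ q, ∃ c : ℂ, D.IsLambda Ξ χ μ X c ∧
    T = toU X - algebraMap ℂ (UAlg E G) c}

/-- `J_Θ(λ)`. -/
noncomputable def JTheta (μ : D.aXi Ξ →ₗ[ℝ] ℂ) : Ideal (UAlg E G) :=
  D.leftIdeal Ξ χ μ (D.pXi Ξ)

/-- `J_0(λ)`. -/
noncomputable def JZero (μ : D.aXi Ξ →ₗ[ℝ] ℂ) : Ideal (UAlg E G) :=
  D.leftIdeal Ξ χ μ D.p₀

/-- `ℱ(G/P_Ξ; L_{Ξ,μ})`: `f(g y m a n) = χ(m)⁻¹ a^{μ - ρ} f(g)`. -/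
noncomputable def sectionsXi (F : FunctionSpace E G) (μ : D.aXi Ξ →ₗ[ℝ] ℂ) : Set F.Obj :=
  {f | ∀ y ∈ D.semisimplePart Ξ, ∀ m : D.K, (m : G) ∈ D.M → ∀ H : D.aXi Ξ, ∀ n ∈ D.NXi Ξ,
    F.IsTranslateEq f (y * m * lieExp (H : LieAlg E G) * n)
      (((χ m)⁻¹ : ℂˣ) * Complex.exp (μ H - (D.rho (H : D.a) : ℂ)))}

/-- `ℱ(G/P; L_ν)`: `f(g m a n) = χ(m)⁻¹ a^{ν - ρ} f(g)`. -/
noncomputable def sections (F : FunctionSpace E G) (ν : D.a →ₗ[ℝ] ℂ) : Set F.Obj :=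
  {f | ∀ m : D.K, (m : G) ∈ D.M → ∀ H : D.a, ∀ n ∈ D.N,
    F.IsTranslateEq f (m * lieExp (H : LieAlg E G) * n)
      (((χ m)⁻¹ : ℂˣ) * Complex.exp (ν H - (D.rho H : ℂ)))}

end Parabolic

end IwasawaData

end Structure

end DegSeries

open scoped Manifold ContDiff

/-!
The proof turns the two equivariance conditions into conditions on annihilators for the right
regular action of the enveloping algebra. For `X` in the Lie algebra let `L_X` be the derivative
along `t ↦ x exp(tX)`, extended to `U(𝔤)`, and let `ann f` be the left ideal of all `T` with
`L_T f = 0`. A `RightModel` of one of the four function spaces consists of these left ideals and of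
three facts about them.

* If `toU X - c ∈ ann f`, then `f(x exp X) = e^c f(x)`; conversely, if `f(x exp(tX)) = e^{tc} f(x)`
  for all `t`, then `toU X - c ∈ ann f`.
* The numbers `c` with `f(x p) = c f(x)` multiply when the elements `p` do.
* If `I` is a two-sided ideal, then `π(a(T)) f = 0` for all `T ∈ I` if and only if `I ≤ ann f`.

Given such a model, the theorem is algebra (`mem_sectionsXi_of_JTheta_le_ann`, `JTheta_le_ann`,
`JZero_le_ann`, `sectionsXi_subset_sections`). A section over `G/P_Ξ` is annihilated by `J_Θ(λ)`,
hence by `I`; a section over `G/P` is annihilated by `J_0(λ)`, and if it is also annihilated by `I`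
it is annihilated by `J_Θ(λ) = I + J_0(λ)`, which integrates to equivariance under `P_Ξ`. This needs
the following from structure theory: `𝔫 ⊆ [𝔪_Ξ, 𝔪_Ξ] + 𝔫_Ξ`, the elements of `𝔞` orthogonal to `𝔞_Ξ`
lie in `[𝔪_Ξ, 𝔪_Ξ]`, and `[𝔪_Ξ, 𝔪_Ξ] ∩ (𝔪 + 𝔞 + 𝔫)` is spanned by its intersections with `𝔪` and
`𝔞` modulo `𝔫`.

The models are constructed as follows. The relation between the left and the right regular
representation is `L_T φ (x) = (π(a(Ad(x) T)) φ)(x)`. A two-sided ideal is stable under `Ad(x)`, by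
uniqueness for linear differential equations and connectedness, and `Ad(x) T` is a combination of
finitely many elements with analytic coefficients, which gives the third fact for functions
(`forall_rep_antiAut_eq_zero_iff`). For functionals the same argument needs that left and right
derivatives are exchanged after multiplication of the test function with the coefficients
(`forall_comp_rep_mem_iff`); here the semisimple group enters by being unimodular.

The first fact is the differential equation of the exponential function; for functionals it
rests on Taylor's formula for `t ↦ φ(x exp(tX))`. For hyperfunctions, which are analytic functionals
modulo functionals carried by a compact set away from the given open set, all statements have to be
proved for representatives with a control of carriers. The converse half is the delicate one: it
assumes that for each single `t` the difference of the translate of a representative and its multiple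
is carried by some compact set, and it needs one compact set for all small `t`. By countability of an
exhaustion this holds on a set of positive measure of parameters `t`, and by Steinhaus' theorem the
differences of such parameters fill a neighbourhood of zero (`exists_isCarriedBy_comp_rightRep`).
-/

namespace DegSeries
open scoped Manifold ContDiff TensorProduct
open VectorField Set Filter Topology
set_option linter.unusedSectionVars false

/-! ### One-parameter subgroups -/

section Exponential

variable {E : Type*} [NormedAddCommGroup E] [NormedSpace ℝ E] [FiniteDimensional ℝ E]
  {G : Type*} [TopologicalSpace G] [ChartedSpace E G] [Group G] [LieGroup 𝓘(ℝ, E) ω G]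

theorem mdifferentiableAt_mul_left (g h : G) :
    MDifferentiableAt 𝓘(ℝ, E) 𝓘(ℝ, E) (fun x : G ↦ g * x) h :=
  (contMDiff_mul_left (I := 𝓘(ℝ, E)) (n := ω) (a := g)).mdifferentiable (by simp) h

theorem mfderiv_mul_left_mulInvariantVectorField (g h : G) (X : LieAlg E G) :
    (mfderiv 𝓘(ℝ, E) 𝓘(ℝ, E) (fun x : G ↦ g * x) h (mulInvariantVectorField X h) : E) =
      mulInvariantVectorField X (g * h) := by
  have h1 : MDifferentiableAt 𝓘(ℝ, E) 𝓘(ℝ, E) (fun x : G ↦ g * x) (h * 1) :=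
    mdifferentiableAt_mul_left _ _
  have h2 := mfderiv_comp (1 : G) h1 (mdifferentiableAt_mul_left h 1)
  have h3 : (fun x : G ↦ g * x) ∘ (fun x ↦ h * x) = fun x ↦ (g * h) * x := by
    funext x; simp [mul_assoc]
  rw [h3] at h2
  have h4 : ∀ y, y = h → ∀ v : E, (mfderiv 𝓘(ℝ, E) 𝓘(ℝ, E) (fun x : G ↦ g * x) y : E →L[ℝ] E) v =
    (mfderiv 𝓘(ℝ, E) 𝓘(ℝ, E) (fun x : G ↦ g * x) h : E →L[ℝ] E) v := by rintro y rfl v; rfl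
  exact ((congrArg (fun L : E →L[ℝ] E ↦ L X) h2).trans (h4 _ (mul_one h) _)).symm

theorem contMDiff_one_mulInvariantVectorField (X : LieAlg E G) :
    ContMDiff 𝓘(ℝ, E) 𝓘(ℝ, E).tangent 1
      (fun g : G ↦ (⟨g, mulInvariantVectorField X g⟩ : TangentBundle 𝓘(ℝ, E) G)) :=
  (contMDiff_mulInvariantVectorField (I := 𝓘(ℝ, E)) X).of_le (by simp)

theorem isMIntegralCurveOn_mul_left {γ : ℝ → G} {X : LieAlg E G} {s : Set ℝ}
    (h : IsMIntegralCurveOn (I := 𝓘(ℝ, E)) γ (mulInvariantVectorField X) s) (g : G) :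
    IsMIntegralCurveOn (I := 𝓘(ℝ, E)) (fun t ↦ g * γ t) (mulInvariantVectorField X) s := by
  intro t ht
  have h1 := (mdifferentiableAt_mul_left (E := E) g (γ t)).hasMFDerivAt
  have h2 := h1.comp_hasMFDerivWithinAt t (h t ht)
  have e : ((mfderiv 𝓘(ℝ, E) 𝓘(ℝ, E) (fun x : G ↦ g * x) (γ t)).comp
      ((1 : ℝ →L[ℝ] ℝ).smulRight (mulInvariantVectorField X (γ t))) : ℝ →L[ℝ] E) =
      (1 : ℝ →L[ℝ] ℝ).smulRight (mulInvariantVectorField X (g * γ t) : E) := by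
    refine ContinuousLinearMap.ext_ring ?_
    refine Eq.trans ?_ ((mfderiv_mul_left_mulInvariantVectorField g (γ t) X).trans
      (one_smul ℝ (mulInvariantVectorField X (g * γ t) : E)).symm)
    exact congrArg (mfderiv 𝓘(ℝ, E) 𝓘(ℝ, E) (fun x : G ↦ g * x) (γ t))
      (one_smul ℝ (mulInvariantVectorField X (γ t)))
  have h3 : HasMFDerivAt[s] (fun t ↦ g * γ t) t
    ((mfderiv 𝓘(ℝ, E) 𝓘(ℝ, E) (fun x : G ↦ g * x) (γ t)).comp
      ((1 : ℝ →L[ℝ] ℝ).smulRight (mulInvariantVectorField X (γ t)))) := h2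
  exact h3.congr_mfderiv e

theorem isMIntegralCurve_mul_left {γ : ℝ → G} {X : LieAlg E G}
    (h : IsMIntegralCurve (I := 𝓘(ℝ, E)) γ (mulInvariantVectorField X)) (g : G) :
    IsMIntegralCurve (I := 𝓘(ℝ, E)) (fun t ↦ g * γ t) (mulInvariantVectorField X) := by
  rw [isMIntegralCurve_iff_isMIntegralCurveOn] at h ⊢
  exact isMIntegralCurveOn_mul_left h g

variable [T2Space G]

theorem exists_isMIntegralCurve (X : LieAlg E G) :
    ∃ γ : ℝ → G, γ 0 = 1 ∧ IsMIntegralCurve (I := 𝓘(ℝ, E)) γ (mulInvariantVectorField X) := by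
  have : IsManifold 𝓘(ℝ, E) 1 G := IsManifold.of_le (n := ω) le_top
  have hX := contMDiff_one_mulInvariantVectorField X
  obtain ⟨γ, h0, hγ⟩ := exists_isMIntegralCurveAt_of_contMDiffAt_boundaryless (t₀ := 0)
    (hX.contMDiffAt (x := (1 : G)))
  obtain ⟨ε, hε, h⟩ := isMIntegralCurveAt_iff'.1 hγ
  rw [Real.ball_eq_Ioo, zero_sub, zero_add] at h
  exact exists_isMIntegralCurve_of_isMIntegralCurveOn hX hε
    (fun x ↦ ⟨fun t ↦ x * γ t, by simp [h0], isMIntegralCurveOn_mul_left h x⟩) 1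

theorem eq_of_isMIntegralCurve {X : LieAlg E G} {γ γ' : ℝ → G}
    (h : IsMIntegralCurve (I := 𝓘(ℝ, E)) γ (mulInvariantVectorField X))
    (h' : IsMIntegralCurve (I := 𝓘(ℝ, E)) γ' (mulInvariantVectorField X)) (h0 : γ 0 = γ' 0) :
    γ = γ' := by
  have : IsManifold 𝓘(ℝ, E) 1 G := IsManifold.of_le (n := ω) le_top
  exact isMIntegralCurve_Ioo_eq_of_contMDiff_boundaryless
    (contMDiff_one_mulInvariantVectorField X) h h' h0

theorem lieExp_eq {X : LieAlg E G} {γ : ℝ → G} (h0 : γ 0 = 1)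
    (h : IsMIntegralCurve (I := 𝓘(ℝ, E)) γ (mulInvariantVectorField X)) : lieExp X = γ 1 := by
  have hX := exists_isMIntegralCurve X
  rw [lieExp, dif_pos hX, eq_of_isMIntegralCurve hX.choose_spec.2 h (by rw [hX.choose_spec.1, h0])]

theorem lieExp_smul_eq {X : LieAlg E G} {γ : ℝ → G} (h0 : γ 0 = 1)
    (h : IsMIntegralCurve (I := 𝓘(ℝ, E)) γ (mulInvariantVectorField X)) (t : ℝ) :
    lieExp (t • X) = γ t := by
  have h1 := h.comp_mul t
  have h2 : (t • mulInvariantVectorField X : (g : G) → TangentSpace 𝓘(ℝ, E) g) =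
      mulInvariantVectorField (t • X) := (mulInvariantVectorField_smul t X).symm
  rw [h2] at h1
  rw [lieExp_eq (by simpa using h0) h1]
  simp

theorem isMIntegralCurve_lieExp (X : LieAlg E G) :
    IsMIntegralCurve (I := 𝓘(ℝ, E)) (fun t : ℝ ↦ (lieExp (t • X) : G))
      (mulInvariantVectorField X) := by
  obtain ⟨γ, h0, h⟩ := exists_isMIntegralCurve X
  have : (fun t : ℝ ↦ (lieExp (t • X) : G)) = γ := funext (lieExp_smul_eq h0 h)
  rwa [this]

theorem lieExp_zero : (lieExp (0 : LieAlg E G) : G) = 1 := by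
  obtain ⟨γ, h0, h⟩ := exists_isMIntegralCurve (0 : LieAlg E G)
  have := lieExp_smul_eq h0 h 0
  rwa [smul_zero, h0] at this

theorem lieExp_add_smul (X : LieAlg E G) (s t : ℝ) :
    (lieExp ((s + t) • X) : G) = lieExp (s • X) * lieExp (t • X) := by
  have h1 := (isMIntegralCurve_lieExp X).comp_add s
  have h2 := isMIntegralCurve_mul_left (isMIntegralCurve_lieExp X) (lieExp (s • X))
  have := congrFun (eq_of_isMIntegralCurve h1 h2 (by simp [lieExp_zero])) t
  simpa [add_comm] using this

theorem lieExp_neg (X : LieAlg E G) : (lieExp (-X) : G) = (lieExp X)⁻¹ := by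
  have := lieExp_add_smul X (-1) 1
  simp only [neg_add_cancel, zero_smul, lieExp_zero, one_smul, neg_smul] at this
  exact eq_inv_of_mul_eq_one_left this.symm

theorem lieExp_neg_smul (X : LieAlg E G) (t : ℝ) :
    (lieExp (-t • X) : G) = (lieExp (t • X))⁻¹ := by
  rw [neg_smul, lieExp_neg]

theorem continuous_lieExp_smul (X : LieAlg E G) : Continuous fun t : ℝ ↦ (lieExp (t • X) : G) :=
  (isMIntegralCurve_lieExp X).continuous

theorem hasDerivAt_of_mdifferentiableAt {φ : G → ℂ} {X : LieAlg E G} {γ : ℝ → G} {t : ℝ}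
    (h : IsMIntegralCurve (I := 𝓘(ℝ, E)) γ (mulInvariantVectorField X))
    (hφ : MDifferentiableAt 𝓘(ℝ, E) 𝓘(ℝ, ℂ) φ (γ t)) :
    HasDerivAt (fun t ↦ φ (γ t)) (dAt φ (γ t) (mulInvariantVectorField X (γ t))) t := by
  have h1 : HasFDerivAt (fun t ↦ φ (γ t)) ((mfderiv 𝓘(ℝ, E) 𝓘(ℝ, ℂ) φ (γ t)).comp
      ((1 : ℝ →L[ℝ] ℝ).smulRight (mulInvariantVectorField X (γ t))) : ℝ →L[ℝ] ℂ) t :=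
    (hφ.hasMFDerivAt.comp t (h t)).hasFDerivAt
  have h2 : HasFDerivAt (𝕜 := ℝ) (E := ℝ) (F := ℂ) (fun t ↦ φ (γ t))
      (ContinuousLinearMap.toSpanSingleton ℝ (dAt φ (γ t) (mulInvariantVectorField X (γ t)))) t := by
    refine h1.congr_fderiv (ContinuousLinearMap.ext_ring ?_)
    refine Eq.trans ?_ (one_smul ℝ (dAt φ (γ t) (mulInvariantVectorField X (γ t)))).symm
    exact congrArg (mfderiv 𝓘(ℝ, E) 𝓘(ℝ, ℂ) φ (γ t))
      (one_smul ℝ (mulInvariantVectorField X (γ t)))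
  rw [hasDerivAt_iff_hasFDerivAt]
  exact h2

/-- The fundamental property of `L_X`: it differentiates `t ↦ φ(x exp(tX))`. -/
theorem hasDerivAt_mul_lieExp {φ : G → ℂ} (hφ : ContMDiff 𝓘(ℝ, E) 𝓘(ℝ, ℂ) 1 φ) (X : LieAlg E G)
    (x : G) (t : ℝ) :
    HasDerivAt (fun t : ℝ ↦ φ (x * lieExp (t • X))) (rightDeriv X φ (x * lieExp (t • X))) t := by
  rw [rightDeriv_eq X hφ]
  exact hasDerivAt_of_mdifferentiableAt (isMIntegralCurve_mul_left (isMIntegralCurve_lieExp X) x)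
    (hφ.mdifferentiable one_ne_zero _)

theorem hasDerivAt_zero_lieExp {φ : G → ℂ} (hφ : ContMDiff 𝓘(ℝ, E) 𝓘(ℝ, ℂ) 1 φ) (X : LieAlg E G) :
    HasDerivAt (fun t : ℝ ↦ φ (lieExp (t • X))) (dAt φ 1 X) 0 := by
  have := hasDerivAt_mul_lieExp hφ X 1 0
  simpa [rightDeriv, lieExp_zero] using this

end Exponential

/-! ### The adjoint action -/

section Adjoint

variable {E : Type*} [NormedAddCommGroup E] [NormedSpace ℝ E] [FiniteDimensional ℝ E]
  {G : Type*} [TopologicalSpace G] [ChartedSpace E G] [Group G] [LieGroup 𝓘(ℝ, E) ω G]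

theorem rightDeriv_contMDiff {m n : ℕ∞ω} (hmn : m + 1 ≤ n) (X : LieAlg E G) {φ : G → ℂ}
    (hφ : ContMDiff 𝓘(ℝ, E) 𝓘(ℝ, ℂ) n φ) :
    ContMDiff 𝓘(ℝ, E) 𝓘(ℝ, ℂ) m (rightDeriv X φ) := by
  have hi : ContMDiff 𝓘(ℝ, E) 𝓘(ℝ, E) ω (fun y : G ↦ y⁻¹) := contMDiff_inv _ _
  have h1 := leftDeriv_contMDiff hmn X (hφ.comp (hi.of_le le_top))
  have h2 := h1.comp (hi.of_le (m := m) le_top)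
  have h3 := rightDeriv_eq_leftDeriv X (fun y ↦ φ y⁻¹)
  simp only [inv_inv] at h3
  rw [h3]
  exact h2

theorem contMDiff_translate {n : ℕ∞ω} {φ : G → ℂ} (hφ : ContMDiff 𝓘(ℝ, E) 𝓘(ℝ, ℂ) n φ) (p : G) :
    ContMDiff 𝓘(ℝ, E) 𝓘(ℝ, ℂ) n (fun x ↦ φ (x * p)) := by
  have h : ContMDiff 𝓘(ℝ, E) 𝓘(ℝ, E) ω (fun x : G ↦ x * p) := contMDiff_mul_right
  exact hφ.comp (h.of_le le_top)

theorem contMDiff_translate_left {n : ℕ∞ω} {φ : G → ℂ} (hφ : ContMDiff 𝓘(ℝ, E) 𝓘(ℝ, ℂ) n φ)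
    (p : G) : ContMDiff 𝓘(ℝ, E) 𝓘(ℝ, ℂ) n (fun x ↦ φ (p * x)) := by
  have h : ContMDiff 𝓘(ℝ, E) 𝓘(ℝ, E) ω (fun x : G ↦ p * x) := contMDiff_mul_left
  exact hφ.comp (h.of_le le_top)

theorem dAt_conj_of_mdifferentiableAt {ψ : G → ℂ} (hψ : MDifferentiableAt 𝓘(ℝ, E) 𝓘(ℝ, ℂ) ψ 1)
    (p : G) (Y : LieAlg E G) :
    dAt (fun g ↦ ψ (p * g * p⁻¹)) (1 : G) Y = dAt ψ (1 : G) (adjointAction p Y) := by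
  have e : p * 1 * p⁻¹ = 1 := by simp
  have h1 : MDifferentiableAt 𝓘(ℝ, E) 𝓘(ℝ, ℂ) ψ (p * 1 * p⁻¹) := by rwa [e]
  have hc : ContMDiff 𝓘(ℝ, E) 𝓘(ℝ, E) ω (fun g : G ↦ p * g * p⁻¹) :=
    (contMDiff_const.mul contMDiff_id).mul contMDiff_const
  have h := mfderiv_comp (1 : G) h1 (hc.mdifferentiable (by simp) 1)
  refine (congrArg (fun L ↦ L Y) h).trans ?_
  have h3 : ∀ y, y = 1 → ∀ v : E, (mfderiv 𝓘(ℝ, E) 𝓘(ℝ, ℂ) ψ y : E →L[ℝ] ℂ) v =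
    (mfderiv 𝓘(ℝ, E) 𝓘(ℝ, ℂ) ψ (1 : G) : E →L[ℝ] ℂ) v := by rintro y rfl v; rfl
  exact h3 _ e _

theorem dAt_conj {ψ : G → ℂ} (hψ : ContMDiff 𝓘(ℝ, E) 𝓘(ℝ, ℂ) 1 ψ) (p : G) (Y : LieAlg E G) :
    dAt (fun g ↦ ψ (p * g * p⁻¹)) (1 : G) Y = dAt ψ (1 : G) (adjointAction p Y) :=
  dAt_conj_of_mdifferentiableAt (hψ.mdifferentiable one_ne_zero _) p Y

theorem dAt_comp_extChartAt_one (L : E →L[ℝ] ℂ) (u : LieAlg E G) :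
    dAt (L ∘ extChartAt 𝓘(ℝ, E) (1 : G)) (1 : G) u = L u := by
  have : IsManifold 𝓘(ℝ, E) 2 G := IsManifold.of_le (n := ω) le_top
  have : IsManifold 𝓘(ℝ, E) 1 G := IsManifold.of_le (n := ω) le_top
  have h1 := dAt_chart (mem_extChartAt_source (I := 𝓘(ℝ, E)) (1 : G)) (F := L)
    L.differentiableAt u
  refine h1.trans ?_
  rw [L.fderiv]
  exact congrArg (fun A : E →L[ℝ] E ↦ L (A u)) (mfderiv_extChartAt_self (I := 𝓘(ℝ, E)))

/-- `L_Y R_p = R_p L_{Ad(p⁻¹) Y}`. -/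
theorem rightDeriv_translate {φ : G → ℂ} (hφ : ContMDiff 𝓘(ℝ, E) 𝓘(ℝ, ℂ) 1 φ) (p x : G)
    (Y : LieAlg E G) :
    rightDeriv Y (fun x ↦ φ (x * p)) x = rightDeriv (adjointAction p⁻¹ Y) φ (x * p) := by
  have h := dAt_conj (contMDiff_translate_left hφ (x * p)) p⁻¹ Y
  rw [rightDeriv, rightDeriv, ← h]
  congr 2
  funext g
  simp [mul_assoc]

theorem adjointAction_add (p : G) (X Y : LieAlg E G) :
    adjointAction p (X + Y) = adjointAction p X + adjointAction p Y :=
  map_add (mfderiv 𝓘(ℝ, E) 𝓘(ℝ, E) (fun x : G ↦ p * x * p⁻¹) 1) X Y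

theorem adjointAction_smul (p : G) (c : ℝ) (X : LieAlg E G) :
    adjointAction p (c • X) = c • adjointAction p X :=
  map_smul (mfderiv 𝓘(ℝ, E) 𝓘(ℝ, E) (fun x : G ↦ p * x * p⁻¹) 1) c X

variable [T2Space G]

/-- Every linear form on the Lie algebra is the differential at the identity of a smooth function:
cut off a coordinate function. -/
theorem exists_contMDiff_dAt_eq (L : E →L[ℝ] ℂ) :
    ∃ ψ : G → ℂ, ContMDiff 𝓘(ℝ, E) 𝓘(ℝ, ℂ) ∞ ψ ∧ ∀ u : LieAlg E G, dAt ψ (1 : G) u = L u := by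
  have : IsManifold 𝓘(ℝ, E) ∞ G := IsManifold.of_le (n := ω) le_top
  let f : SmoothBumpFunction 𝓘(ℝ, E) (1 : G) := Classical.arbitrary _
  let g : G → ℂ := L ∘ extChartAt 𝓘(ℝ, E) (1 : G)
  have hg : ContMDiffOn 𝓘(ℝ, E) 𝓘(ℝ, ℂ) ∞ g (chartAt E (1 : G)).source :=
    L.contMDiff.comp_contMDiffOn contMDiffOn_extChartAt
  refine ⟨fun x ↦ f x • g x, f.contMDiff_smul hg, fun u ↦ ?_⟩
  have e : (fun x ↦ f x • g x) =ᶠ[𝓝 1] g := by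
    filter_upwards [f.eventuallyEq_one] with x hx
    simp [hx]
  exact (congrArg (fun L ↦ L u) (dAt_congr e)).trans (dAt_comp_extChartAt_one L u)

/-- A tangent vector at the identity is determined by its action on smooth functions. -/
theorem eq_of_forall_dAt {v w : LieAlg E G}
    (h : ∀ ψ : G → ℂ, ContMDiff 𝓘(ℝ, E) 𝓘(ℝ, ℂ) ∞ ψ → dAt ψ (1 : G) v = dAt ψ (1 : G) w) :
    v = w := by
  have h1 : ∀ ℓ : E →L[ℝ] ℝ, ℓ v = ℓ w := by
    intro ℓ
    obtain ⟨ψ, hs, hd⟩ := exists_contMDiff_dAt_eq (G := G) (Complex.ofRealCLM.comp ℓ)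
    exact Complex.ofReal_injective ((hd v).symm.trans ((h ψ hs).trans (hd w)))
  have h2 : ∀ v w : E, (∀ ℓ : E →L[ℝ] ℝ, ℓ v = ℓ w) → v = w := fun v w h ↦
    SeparatingDual.eq_iff_forall_dual_eq.2 h
  exact h2 v w h1

theorem adjointAction_one (X : LieAlg E G) : adjointAction (1 : G) X = X :=
  eq_of_forall_dAt fun ψ hψ ↦ by
    rw [← dAt_conj (hψ.of_le (by simp))]
    simp

theorem adjointAction_mul (g h : G) (X : LieAlg E G) :
    adjointAction (g * h) X = adjointAction g (adjointAction h X) :=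
  eq_of_forall_dAt fun ψ hψ ↦ by
    have hψ1 := hψ.of_le (m := 1) (by simp)
    have hc : ContMDiff 𝓘(ℝ, E) 𝓘(ℝ, E) ω (fun x : G ↦ g * x * g⁻¹) :=
      (contMDiff_const.mul contMDiff_id).mul contMDiff_const
    rw [← dAt_conj hψ1, ← dAt_conj hψ1, ← dAt_conj (ψ := fun x ↦ ψ (g * x * g⁻¹)) (hψ1.comp (hc.of_le le_top))]
    congr 2
    funext x
    simp [mul_assoc]

theorem adjointAction_inv_apply (g : G) (X : LieAlg E G) :
    adjointAction g⁻¹ (adjointAction g X) = X := by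
  rw [← adjointAction_mul, inv_mul_cancel, adjointAction_one]

theorem adjointAction_apply_inv (g : G) (X : LieAlg E G) :
    adjointAction g (adjointAction g⁻¹ X) = X := by
  rw [← adjointAction_mul, mul_inv_cancel, adjointAction_one]

theorem rightDeriv_add_left (X Y : LieAlg E G) (φ : G → ℂ) :
    rightDeriv (X + Y) φ = rightDeriv X φ + rightDeriv Y φ := by
  funext x
  exact map_add (dAt (fun g ↦ φ (x * g)) (1 : G)) X Y

theorem rightDeriv_smul_left (c : ℝ) (X : LieAlg E G) (φ : G → ℂ) :
    rightDeriv (c • X) φ = (c : ℂ) • rightDeriv X φ := by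
  funext x
  exact map_smul (dAt (fun g ↦ φ (x * g)) (1 : G)) c X

theorem rightDeriv_lie' (X Y : LieAlg E G) {φ : G → ℂ} (hφ : ContMDiff 𝓘(ℝ, E) 𝓘(ℝ, ℂ) 2 φ) :
    rightDeriv ⁅X, Y⁆ φ = rightDeriv X (rightDeriv Y φ) - rightDeriv Y (rightDeriv X φ) :=
  funext fun x ↦ rightDeriv_lie X Y hφ (rightDeriv_contMDiff (by norm_num) X hφ)
    (rightDeriv_contMDiff (by norm_num) Y hφ) x

theorem adjointAction_lie (g : G) (X Y : LieAlg E G) :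
    adjointAction g ⁅X, Y⁆ = ⁅adjointAction g X, adjointAction g Y⁆ := by
  refine eq_of_forall_dAt fun ψ hψ ↦ ?_
  have h2 := hψ.of_le (m := 2) (WithTop.coe_le_coe.2 le_top)
  have h1 := hψ.of_le (m := 1) (WithTop.coe_le_coe.2 le_top)
  -- `L_{Ad(g) Z}` is the conjugate of `L_Z` by a right translation
  have key : ∀ (Z : LieAlg E G) (φ : G → ℂ), ContMDiff 𝓘(ℝ, E) 𝓘(ℝ, ℂ) 1 φ →
      (fun x ↦ rightDeriv (adjointAction g Z) φ (x * g⁻¹)) = rightDeriv Z fun x ↦ φ (x * g⁻¹) := by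
    intro Z φ hφ
    funext x
    rw [rightDeriv_translate hφ, inv_inv]
  have hr : ∀ Z : LieAlg E G, ContMDiff 𝓘(ℝ, E) 𝓘(ℝ, ℂ) 1 (rightDeriv Z ψ) := fun Z ↦
    rightDeriv_contMDiff (by norm_num) Z h2
  have e : rightDeriv (adjointAction g ⁅X, Y⁆) ψ (g * g⁻¹) =
      rightDeriv ⁅adjointAction g X, adjointAction g Y⁆ ψ (g * g⁻¹) := by
    rw [rightDeriv_lie' _ _ h2, congrFun (key _ ψ h1) g,
      rightDeriv_lie' _ _ (contMDiff_translate h2 _), ← key _ ψ h1, ← key _ ψ h1,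
      ← key _ _ (hr _), ← key _ _ (hr _)]
    rfl
  simpa [rightDeriv] using e

theorem leftDeriv_eq {φ : G → ℂ} (hφ : ContMDiff 𝓘(ℝ, E) 𝓘(ℝ, ℂ) 1 φ) (X : LieAlg E G) (x : G) :
    leftDeriv X φ x = -rightDeriv (adjointAction x⁻¹ X) φ x := by
  have hi : ContMDiff 𝓘(ℝ, E) 𝓘(ℝ, E) ω (fun y : G ↦ y⁻¹) := contMDiff_inv _ _
  have h1 := hasDerivAt_zero_lieExp ((contMDiff_translate hφ x).comp (hi.of_le le_top)) X
  have h2 := hasDerivAt_zero_lieExp (contMDiff_translate hφ x) X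
  have h3 := HasDerivAt.scomp_of_eq (0 : ℝ) h2 (hasDerivAt_neg (0 : ℝ)) (by simp)
  have e : (fun t : ℝ ↦ φ ((lieExp (t • X))⁻¹ * x)) =
      (fun t : ℝ ↦ φ (lieExp (t • X) * x)) ∘ fun t : ℝ ↦ -t := by
    funext t
    simp [lieExp_neg]
  have h4 := h1.unique (by simpa [Function.comp_def, e] using h3)
  refine h4.trans ?_
  have h5 := rightDeriv_translate hφ x 1 X
  simpa [rightDeriv] using h5

/-- The adjoint action depends analytically on the group element. -/
theorem contMDiff_adjointAction (ℓ : E →L[ℝ] ℂ) (X : LieAlg E G) :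
    ContMDiff 𝓘(ℝ, E) 𝓘(ℝ, ℂ) ω (fun x : G ↦ ℓ (adjointAction x X)) := by
  have : IsManifold 𝓘(ℝ, E) 1 G := IsManifold.of_le (n := ω) le_top
  intro x₀
  let ψ : G → ℂ := ℓ ∘ extChartAt 𝓘(ℝ, E) (1 : G)
  have hψ : ContMDiffAt 𝓘(ℝ, E) 𝓘(ℝ, ℂ) ω ψ 1 :=
    ℓ.contMDiff.contMDiffAt.comp _ (contMDiffAt_extChartAt)
  let f : G → G → ℂ := fun x g ↦ ψ (x * g * x⁻¹)
  have hf : ContMDiffAt (𝓘(ℝ, E).prod 𝓘(ℝ, E)) 𝓘(ℝ, ℂ) ω (Function.uncurry f) (x₀, 1) := by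
    have hc : ContMDiff (𝓘(ℝ, E).prod 𝓘(ℝ, E)) 𝓘(ℝ, E) ω (fun p : G × G ↦ p.1 * p.2 * p.1⁻¹) :=
      (contMDiff_fst.mul contMDiff_snd).mul contMDiff_fst.inv
    exact ContMDiffAt.comp_of_eq (g := ψ) hψ hc.contMDiffAt (by simp)
  have h := ContMDiffAt.mfderiv f (fun _ ↦ (1 : G)) hf contMDiffAt_const (m := ω) (by simp)
  let Y : E := X
  have h2 := h.clm_apply (contMDiffAt_const (I' := 𝓘(ℝ, E)) (c := Y))
  refine h2.congr_of_eventuallyEq (Eventually.of_forall fun x ↦ ?_)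
  have e := inTangentCoordinates_eq (I := 𝓘(ℝ, E)) (I' := 𝓘(ℝ, ℂ)) (fun _ : G ↦ (1 : G))
    (fun x ↦ f x 1) (fun x ↦ mfderiv 𝓘(ℝ, E) 𝓘(ℝ, ℂ) (f x) 1) (x₀ := x₀) (x := x)
    (mem_chart_source E 1) (by rw [chartAt_self_eq]; exact mem_univ _)
  refine Eq.trans ?_ (congrArg (fun A : E →L[ℝ] ℂ ↦ A X) e).symm
  have e1 : (tangentBundleCore 𝓘(ℝ, E) G).coordChange (achart E (1 : G)) (achart E (1 : G)) 1 X = X :=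
    (tangentBundleCore 𝓘(ℝ, E) G).coordChange_self _ _ (mem_chart_source E 1) _
  have e2 : dAt (f x) (1 : G) X = ℓ (adjointAction x X) :=
    (dAt_conj_of_mdifferentiableAt (hψ.mdifferentiableAt (by simp)) x X).trans
      (dAt_comp_extChartAt_one ℓ _)
  rw [tangentBundleCore_coordChange_model_space]
  refine e2.symm.trans ?_
  exact (congrArg (mfderiv 𝓘(ℝ, E) 𝓘(ℝ, ℂ) (f x) 1 : E →L[ℝ] ℂ) e1).symm

end Adjoint

section AdjointDerivative

variable {E : Type*} [NormedAddCommGroup E] [NormedSpace ℝ E] [FiniteDimensional ℝ E]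
  {G : Type*} [TopologicalSpace G] [ChartedSpace E G] [Group G] [LieGroup 𝓘(ℝ, E) ω G]

theorem fderiv_apply_comp {V : Type*} [NormedAddCommGroup V] [NormedSpace ℝ V]
    {D : V → V →L[ℝ] ℂ} {f : E → V} {f' : E →L[ℝ] V} {e : E} (hD : DifferentiableAt ℝ D (f e))
    (hf : HasFDerivAt f f' e) (w : V) (u : E) :
    fderiv ℝ (fun v ↦ D (f v) w) e u = fderiv ℝ D (f e) (f' u) w := by
  have h := ((hD.hasFDerivAt.comp e hf).clm_apply (hasFDerivAt_const w e)).fderiv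
  refine (congrArg (fun L : E →L[ℝ] ℂ ↦ L u) h).trans ?_
  simp

/-- The differential at the identity in the chart at the identity. -/
theorem dAt_one_eq_fderiv {f : G → ℂ} (hf : MDifferentiableAt 𝓘(ℝ, E) 𝓘(ℝ, ℂ) f 1)
    (X : LieAlg E G) :
    dAt f (1 : G) X = fderiv ℝ (f ∘ (extChartAt 𝓘(ℝ, E) (1 : G)).symm)
      (extChartAt 𝓘(ℝ, E) (1 : G) 1) X := by
  have h := hf.mfderiv
  have h2 : (mfderiv 𝓘(ℝ, E) 𝓘(ℝ, ℂ) f (1 : G) : E →L[ℝ] ℂ) =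
      fderiv ℝ (f ∘ (extChartAt 𝓘(ℝ, E) (1 : G)).symm) (extChartAt 𝓘(ℝ, E) (1 : G) 1) := by
    refine h.trans ?_
    simp only [mfld_simps, fderivWithin_univ]
    rfl
  exact congrArg (fun L ↦ L X) h2

/-- Mixed partial derivatives on the product of a Lie group with itself commute. -/
theorem dAt_dAt_comm {Ψ : G × G → ℂ} (hΨ : ContMDiff (𝓘(ℝ, E).prod 𝓘(ℝ, E)) 𝓘(ℝ, ℂ) ∞ Ψ)
    (X Y : LieAlg E G)
    (h1 : MDifferentiableAt 𝓘(ℝ, E) 𝓘(ℝ, ℂ) (fun g ↦ dAt (fun h ↦ Ψ (g, h)) (1 : G) Y) 1)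
    (h2 : MDifferentiableAt 𝓘(ℝ, E) 𝓘(ℝ, ℂ) (fun h ↦ dAt (fun g ↦ Ψ (g, h)) (1 : G) X) 1) :
    dAt (fun g ↦ dAt (fun h ↦ Ψ (g, h)) (1 : G) Y) (1 : G) X =
      dAt (fun h ↦ dAt (fun g ↦ Ψ (g, h)) (1 : G) X) (1 : G) Y := by
  set c := extChartAt 𝓘(ℝ, E) (1 : G) with hc
  set e : E := c 1 with he
  let F : E × E → ℂ := fun p ↦ Ψ (c.symm p.1, c.symm p.2)
  have hF : ContDiffAt ℝ ∞ F (e, e) := by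
    have hs : ContMDiffAt 𝓘(ℝ, E) 𝓘(ℝ, E) ∞ c.symm e := by
      have : IsManifold 𝓘(ℝ, E) ∞ G := IsManifold.of_le (n := ω) le_top
      exact (contMDiffOn_extChartAt_symm (1 : G)).contMDiffAt
        (extChartAt_target_mem_nhds (I := 𝓘(ℝ, E)) (1 : G))
    have h3 : ContMDiffAt 𝓘(ℝ, E × E) (𝓘(ℝ, E).prod 𝓘(ℝ, E)) ∞
        (fun p : E × E ↦ (c.symm p.1, c.symm p.2)) (e, e) :=
      (hs.comp (e, e) (contDiff_fst.contMDiff (n := ∞)).contMDiffAt).prodMk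
        (hs.comp (e, e) (contDiff_snd.contMDiff (n := ∞)).contMDiffAt)
    exact (hΨ.contMDiffAt.comp (e, e) h3).contDiffAt
  have hev : ∀ᶠ p in 𝓝 (e, e), DifferentiableAt ℝ F p := by
    filter_upwards [(hF.of_le (m := 1) (WithTop.coe_le_coe.2 le_top)).eventually (by simp)] with p hp
    exact hp.differentiableAt one_ne_zero
  have hd : DifferentiableAt ℝ (fderiv ℝ F) (e, e) :=
    (hF.fderiv_right (m := 1) (WithTop.coe_le_coe.2 le_top)).differentiableAt one_ne_zero
  have hsl : ∀ g : G, MDifferentiableAt 𝓘(ℝ, E) 𝓘(ℝ, ℂ) (fun h ↦ Ψ (g, h)) 1 := fun g ↦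
    (hΨ.comp (contMDiff_const.prodMk contMDiff_id)).mdifferentiable (by simp) 1
  have hsr : ∀ h : G, MDifferentiableAt 𝓘(ℝ, E) 𝓘(ℝ, ℂ) (fun g ↦ Ψ (g, h)) 1 := fun g ↦
    (hΨ.comp (contMDiff_id.prodMk contMDiff_const)).mdifferentiable (by simp) 1
  have hce : c.symm e = 1 := c.left_inv (mem_extChartAt_source (1 : G))
  have cl : Continuous fun u : E ↦ (u, e) := by fun_prop
  have cr : Continuous fun u : E ↦ (e, u) := by fun_prop
  -- both sides are values of the second derivative of `F`
  have L1 : dAt (fun g ↦ dAt (fun h ↦ Ψ (g, h)) (1 : G) Y) (1 : G) X =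
      fderiv ℝ (fderiv ℝ F) (e, e) ((X : E), (0 : E)) ((0 : E), (Y : E)) := by
    rw [dAt_one_eq_fderiv h1]
    have e1 : (fun g ↦ dAt (fun h ↦ Ψ (g, h)) (1 : G) Y) ∘ c.symm =ᶠ[𝓝 e]
        fun u ↦ fderiv ℝ F (u, e) ((0 : E), (Y : E)) := by
      filter_upwards [(cl.tendsto e).eventually hev] with u hu
      refine (dAt_one_eq_fderiv (hsl _) Y).trans ?_
      have := hu.hasFDerivAt.comp e (hasFDerivAt_prodMk_right u e)
      exact congrArg (fun L : E →L[ℝ] ℂ ↦ L Y) this.fderiv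
    rw [e1.fderiv_eq]
    refine (fderiv_apply_comp (f := fun u ↦ (u, e)) hd (hasFDerivAt_prodMk_left e e) ((0 : E), (Y : E)) X).trans ?_
    rfl
  have L2 : dAt (fun h ↦ dAt (fun g ↦ Ψ (g, h)) (1 : G) X) (1 : G) Y =
      fderiv ℝ (fderiv ℝ F) (e, e) ((0 : E), (Y : E)) ((X : E), (0 : E)) := by
    rw [dAt_one_eq_fderiv h2]
    have e1 : (fun h ↦ dAt (fun g ↦ Ψ (g, h)) (1 : G) X) ∘ c.symm =ᶠ[𝓝 e]
        fun u ↦ fderiv ℝ F (e, u) ((X : E), (0 : E)) := by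
      filter_upwards [(cr.tendsto e).eventually hev] with u hu
      refine (dAt_one_eq_fderiv (hsr _) X).trans ?_
      have := HasFDerivAt.comp (g := F) (f := fun v ↦ (v, u)) e hu.hasFDerivAt
        (hasFDerivAt_prodMk_left e u)
      exact congrArg (fun L : E →L[ℝ] ℂ ↦ L X) this.fderiv
    rw [e1.fderiv_eq]
    refine (fderiv_apply_comp (f := fun u ↦ (e, u)) hd (hasFDerivAt_prodMk_right e e) ((X : E), (0 : E)) Y).trans ?_
    rfl
  rw [L1, L2]
  exact ((hF.of_le (m := 2) (WithTop.coe_le_coe.2 le_top)).isSymmSndFDerivAt (by simp)) _ _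

variable [T2Space G]

theorem rightDeriv_one (X : LieAlg E G) (φ : G → ℂ) : rightDeriv X φ 1 = dAt φ (1 : G) X := by
  simp [rightDeriv]

theorem rightDeriv_eq_of_hasDerivAt {φ : G → ℂ} (hφ : ContMDiff 𝓘(ℝ, E) 𝓘(ℝ, ℂ) 1 φ)
    {X : LieAlg E G} {x : G} {c : ℂ} (h : HasDerivAt (fun t : ℝ ↦ φ (x * lieExp (t • X))) c 0) :
    rightDeriv X φ x = c := by
  have := hasDerivAt_mul_lieExp hφ X x 0
  simp only [zero_smul, lieExp_zero, mul_one] at this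
  exact this.unique h

theorem hasDerivAt_rightDeriv {φ : G → ℂ} (hφ : ContMDiff 𝓘(ℝ, E) 𝓘(ℝ, ℂ) 1 φ)
    (X : LieAlg E G) (x : G) :
    HasDerivAt (fun t : ℝ ↦ φ (x * lieExp (t • X))) (rightDeriv X φ x) 0 := by
  have := hasDerivAt_mul_lieExp hφ X x 0
  simpa only [zero_smul, lieExp_zero, mul_one] using this

theorem contMDiff_const_smul {n : ℕ∞ω} (c : ℂ) {φ : G → ℂ}
    (hφ : ContMDiff 𝓘(ℝ, E) 𝓘(ℝ, ℂ) n φ) : ContMDiff 𝓘(ℝ, E) 𝓘(ℝ, ℂ) n (c • φ) :=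
  (contMDiffFunctions E G n).smul_mem c hφ

theorem contMDiff_sum {n : ℕ∞ω} {ι : Type*} {s : Finset ι} {φ : ι → G → ℂ}
    (hφ : ∀ i ∈ s, ContMDiff 𝓘(ℝ, E) 𝓘(ℝ, ℂ) n (φ i)) :
    ContMDiff 𝓘(ℝ, E) 𝓘(ℝ, ℂ) n (∑ i ∈ s, φ i) :=
  (contMDiffFunctions E G n).sum_mem hφ

theorem contMDiff_fun_mul {n : ℕ∞ω} {φ ψ : G → ℂ} (hφ : ContMDiff 𝓘(ℝ, E) 𝓘(ℝ, ℂ) n φ)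
    (hψ : ContMDiff 𝓘(ℝ, E) 𝓘(ℝ, ℂ) n ψ) : ContMDiff 𝓘(ℝ, E) 𝓘(ℝ, ℂ) n (φ * ψ) := by
  have h : ContDiff ℝ n fun p : ℂ × ℂ ↦ p.1 * p.2 := contDiff_mul
  exact ContMDiff.comp (g := fun p : ℂ × ℂ ↦ p.1 * p.2) h.contMDiff (hφ.prodMk_space hψ)

theorem rightDeriv_smul (X : LieAlg E G) (c : ℂ) {φ : G → ℂ}
    (hφ : ContMDiff 𝓘(ℝ, E) 𝓘(ℝ, ℂ) 1 φ) : rightDeriv X (c • φ) = c • rightDeriv X φ :=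
  funext fun x ↦ rightDeriv_eq_of_hasDerivAt (contMDiff_const_smul c hφ)
    ((hasDerivAt_rightDeriv hφ X x).const_mul c)

theorem rightDeriv_add (X : LieAlg E G) {φ ψ : G → ℂ} (hφ : ContMDiff 𝓘(ℝ, E) 𝓘(ℝ, ℂ) 1 φ)
    (hψ : ContMDiff 𝓘(ℝ, E) 𝓘(ℝ, ℂ) 1 ψ) :
    rightDeriv X (φ + ψ) = rightDeriv X φ + rightDeriv X ψ :=
  funext fun x ↦ rightDeriv_eq_of_hasDerivAt (hφ.add hψ)
    ((hasDerivAt_rightDeriv hφ X x).add (hasDerivAt_rightDeriv hψ X x))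

theorem rightDeriv_mul (X : LieAlg E G) {φ ψ : G → ℂ} (hφ : ContMDiff 𝓘(ℝ, E) 𝓘(ℝ, ℂ) 1 φ)
    (hψ : ContMDiff 𝓘(ℝ, E) 𝓘(ℝ, ℂ) 1 ψ) :
    rightDeriv X (φ * ψ) = rightDeriv X φ * ψ + φ * rightDeriv X ψ :=
  funext fun x ↦ rightDeriv_eq_of_hasDerivAt (contMDiff_fun_mul hφ hψ) (by
    have := (hasDerivAt_rightDeriv hφ X x).mul (hasDerivAt_rightDeriv hψ X x)
    simpa only [zero_smul, lieExp_zero, mul_one] using! this)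

theorem rightDeriv_sum (X : LieAlg E G) {ι : Type*} (s : Finset ι) {φ : ι → G → ℂ}
    (hφ : ∀ i ∈ s, ContMDiff 𝓘(ℝ, E) 𝓘(ℝ, ℂ) 1 (φ i)) :
    rightDeriv X (∑ i ∈ s, φ i) = ∑ i ∈ s, rightDeriv X (φ i) :=
  funext fun x ↦ rightDeriv_eq_of_hasDerivAt (contMDiff_sum hφ) (by
    have := HasDerivAt.fun_sum fun i hi ↦ hasDerivAt_rightDeriv (hφ i hi) X x
    simpa only [Finset.sum_apply] using this)

/-- The differential of the adjoint action at the identity is the adjoint representation. -/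
theorem dAt_adjointAction (ℓ : E →L[ℝ] ℂ) (X Y : LieAlg E G) :
    dAt (fun x : G ↦ ℓ (adjointAction x X)) (1 : G) Y = ℓ (⁅Y, X⁆ : LieAlg E G) := by
  obtain ⟨ψ, hψ, hd⟩ := exists_contMDiff_dAt_eq (G := G) ℓ
  have hψ1 : ContMDiff 𝓘(ℝ, E) 𝓘(ℝ, ℂ) 1 ψ := hψ.of_le (WithTop.coe_le_coe.2 le_top)
  have hψ2 : ContMDiff 𝓘(ℝ, E) 𝓘(ℝ, ℂ) 2 ψ := hψ.of_le (WithTop.coe_le_coe.2 le_top)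
  have hr : ∀ Z : LieAlg E G, ContMDiff 𝓘(ℝ, E) 𝓘(ℝ, ℂ) 1 (rightDeriv Z ψ) := fun Z ↦
    rightDeriv_contMDiff (by norm_num) Z hψ2
  have hl : ContMDiff 𝓘(ℝ, E) 𝓘(ℝ, ℂ) 1 (leftDeriv X ψ) :=
    leftDeriv_contMDiff (by norm_num) X hψ2
  have hq : ∀ h : G, dAt (fun g ↦ ψ (g * h)) (1 : G) X = rightDeriv (adjointAction h⁻¹ X) ψ h := by
    intro h
    have := rightDeriv_translate hψ1 h 1 X
    simpa [rightDeriv] using this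
  have hq' : (fun h : G ↦ dAt (fun g ↦ ψ (g * h)) (1 : G) X) = -leftDeriv X ψ := by
    funext h
    rw [hq, Pi.neg_apply, leftDeriv_eq hψ1, neg_neg]
  have hq1 : ContMDiff 𝓘(ℝ, E) 𝓘(ℝ, ℂ) 1 (fun h : G ↦ dAt (fun g ↦ ψ (g * h)) (1 : G) X) := by
    rw [hq']
    exact (contDiff_neg.contMDiff).comp hl
  have hcomm := dAt_dAt_comm (Ψ := fun p : G × G ↦ ψ (p.1 * p.2))
    (hψ.comp (contMDiff_fst.mul contMDiff_snd)) X Y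
    ((hr Y).mdifferentiable one_ne_zero 1) (hq1.mdifferentiable one_ne_zero 1)
  -- differentiate `h ↦ (L_{Ad(h⁻¹) X} ψ)(h)` at the identity by the product rule
  let b := Module.finBasis ℝ (LieAlg E G)
  let c : Fin _ → E →L[ℝ] ℂ := fun i ↦
    Complex.ofRealCLM.comp (LinearMap.toContinuousLinearMap (b.coord i) : E →L[ℝ] ℝ)
  have hsum : ∀ Z : LieAlg E G, rightDeriv Z ψ = ∑ i, c i Z • rightDeriv (b i) ψ := by
    intro Z
    conv_lhs => rw [← b.sum_repr Z]
    funext x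
    exact (map_sum (dAt (fun g ↦ ψ (x * g)) (1 : G)) _ _).trans (by
      simp only [map_smul, Finset.sum_apply, Pi.smul_apply]
      rfl)
  have d1 := hasDerivAt_zero_lieExp hq1 Y
  have hA : ∀ i, HasDerivAt (fun t : ℝ ↦ c i (adjointAction (lieExp (t • Y))⁻¹ X : LieAlg E G))
      (-dAt (fun x : G ↦ c i (adjointAction x X)) (1 : G) Y) 0 := by
    intro i
    have h := hasDerivAt_zero_lieExp ((contMDiff_adjointAction (G := G) (c i) X).of_le
      (m := 1) le_top) Y
    have h3 := HasDerivAt.scomp_of_eq (0 : ℝ) h (hasDerivAt_neg (0 : ℝ)) (by simp)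
    simpa [Function.comp_def, lieExp_neg] using h3
  have d2 : HasDerivAt (fun t : ℝ ↦ ∑ i, c i (adjointAction (lieExp (t • Y))⁻¹ X : LieAlg E G) *
      rightDeriv (b i) ψ (lieExp (t • Y)))
      (∑ i, (-dAt (fun x : G ↦ c i (adjointAction x X)) (1 : G) Y * rightDeriv (b i) ψ 1 +
        c i X * rightDeriv Y (rightDeriv (b i) ψ) 1)) 0 := by
    refine HasDerivAt.fun_sum fun i _ ↦ ?_
    have h := (hA i).mul (hasDerivAt_zero_lieExp (hr (b i)) Y)
    have e1 : dAt (rightDeriv (b i) ψ) (1 : G) Y = rightDeriv Y (rightDeriv (b i) ψ) 1 := by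
      rw [rightDeriv_one]
    simp only [zero_smul, lieExp_zero, inv_one, adjointAction_one, e1] at h
    exact h
  have e : (fun t : ℝ ↦ dAt (fun g ↦ ψ (g * lieExp (t • Y))) (1 : G) X) =
      fun t : ℝ ↦ ∑ i, c i (adjointAction (lieExp (t • Y))⁻¹ X : LieAlg E G) *
      rightDeriv (b i) ψ (lieExp (t • Y)) := by
    funext t
    rw [hq, hsum]
    simp
  rw [e] at d1
  have h1 := d1.unique d2
  rw [← hcomm] at h1
  have e2 : dAt (fun g ↦ dAt (fun h ↦ ψ (g * h)) (1 : G) Y) (1 : G) X =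
      rightDeriv X (rightDeriv Y ψ) 1 := by
    simp only [rightDeriv, one_mul]
  have e3 : ∑ i, c i X * rightDeriv Y (rightDeriv (b i) ψ) 1 =
      rightDeriv Y (rightDeriv X ψ) 1 := by
    rw [hsum X, rightDeriv_sum _ _ fun i _ ↦ contMDiff_const_smul _ (hr _)]
    simp only [rightDeriv_smul _ _ (hr _), Finset.sum_apply, Pi.smul_apply, smul_eq_mul]
  have e4 : ∑ i, dAt (fun x : G ↦ c i (adjointAction x X)) (1 : G) Y * rightDeriv (b i) ψ 1 =
      dAt (fun x : G ↦ ℓ (adjointAction x X)) (1 : G) Y := by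
    have e : (fun x : G ↦ ℓ (adjointAction x X)) =
        ∑ i, rightDeriv (b i) ψ 1 • fun x : G ↦ c i (adjointAction x X) := by
      funext x
      refine (hd _).symm.trans ?_
      rw [← rightDeriv_one, hsum]
      simp [mul_comm]
    have hc : ∀ i, ContMDiff 𝓘(ℝ, E) 𝓘(ℝ, ℂ) 1 fun x : G ↦ c i (adjointAction x X) := fun i ↦
      (contMDiff_adjointAction (c i) X).of_le le_top
    rw [e, ← rightDeriv_one, rightDeriv_sum _ _ fun i _ ↦ contMDiff_const_smul _ (hc i)]
    simp only [rightDeriv_smul _ _ (hc _), Finset.sum_apply, Pi.smul_apply, smul_eq_mul,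
      rightDeriv_one, mul_comm]
  have e5 : rightDeriv ⁅Y, X⁆ ψ 1 = ℓ (⁅Y, X⁆ : LieAlg E G) := by
    simp only [rightDeriv, one_mul, hd]
  rw [rightDeriv_lie' _ _ hψ2, Pi.sub_apply] at e5
  rw [e2, Finset.sum_add_distrib, e3] at h1
  simp only [neg_mul, Finset.sum_neg_distrib, e4] at h1
  rw [← e5, h1]
  ring

theorem rightDeriv_adjointAction (ℓ : E →L[ℝ] ℂ) (X Y : LieAlg E G) (x : G) :
    rightDeriv Y (fun x : G ↦ ℓ (adjointAction x X)) x =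
      ℓ (adjointAction x ⁅Y, X⁆ : LieAlg E G) := by
  let A : E →L[ℝ] E := mfderiv 𝓘(ℝ, E) 𝓘(ℝ, E) (fun g : G ↦ x * g * x⁻¹) 1
  have h := dAt_adjointAction (ℓ.comp A) X Y
  refine Eq.trans ?_ h
  unfold rightDeriv
  congr 2
  funext g
  exact congrArg ℓ (adjointAction_mul x g X)

end AdjointDerivative

/-! ### The enveloping algebra -/

section Enveloping

attribute [local instance 100] LieRing.ofAssociativeRing

variable {E : Type*} [NormedAddCommGroup E] [NormedSpace ℝ E] [FiniteDimensional ℝ E]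
  {G : Type*} [TopologicalSpace G] [ChartedSpace E G] [Group G] [LieGroup 𝓘(ℝ, E) ω G]

theorem toU_add (X Y : LieAlg E G) : toU (X + Y) = toU X + toU Y := by
  simp only [toU, TensorProduct.tmul_add, map_add]

theorem ι_tmul (z : ℂ) (X : LieAlg E G) :
    UniversalEnvelopingAlgebra.ι ℂ (z ⊗ₜ[ℝ] X) = z • toU X := by
  rw [toU, ← map_smul, TensorProduct.smul_tmul', smul_eq_mul, mul_one]

theorem toU_smul (c : ℝ) (X : LieAlg E G) : toU (c • X) = (c : ℂ) • toU X := by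
  rw [← ι_tmul, toU, TensorProduct.tmul_smul, TensorProduct.smul_tmul']
  simp

theorem toU_lie (X Y : LieAlg E G) : toU ⁅X, Y⁆ = toU X * toU Y - toU Y * toU X := by
  have h := (UniversalEnvelopingAlgebra.ι ℂ).map_lie ((1 : ℂ) ⊗ₜ[ℝ] X) ((1 : ℂ) ⊗ₜ[ℝ] Y)
  rw [LieAlgebra.ExtendScalars.bracket_tmul, mul_one, LieRing.of_associative_ring_bracket] at h
  exact h

variable (E G) in
/-- The canonical map as a linear map. -/
noncomputable def toULin : LieAlg E G →ₗ[ℝ] UAlg E G where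
  toFun := toU
  map_add' := toU_add
  map_smul' c X := by
    rw [toU_smul]
    exact (algebraMap_smul ℂ c (toU X))

theorem toU_sum {ι : Type*} (s : Finset ι) (c : ι → ℝ) (X : ι → LieAlg E G) :
    toU (∑ i ∈ s, c i • X i) = ∑ i ∈ s, (c i : ℂ) • toU (X i) := by
  have h := map_sum (toULin E G) (fun i ↦ c i • X i) s
  refine h.trans (Finset.sum_congr rfl fun i _ ↦ toU_smul _ _)

/-- The enveloping algebra is generated by the real Lie algebra. -/
theorem uAlg_induction {p : UAlg E G → Prop} (hc : ∀ c : ℂ, p (algebraMap ℂ (UAlg E G) c))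
    (hX : ∀ X : LieAlg E G, p (toU X)) (hadd : ∀ S T, p S → p T → p (S + T))
    (hmul : ∀ S T, p S → p T → p (S * T)) (T : UAlg E G) : p T := by
  obtain ⟨t, rfl⟩ : ∃ t, UniversalEnvelopingAlgebra.mkAlgHom ℂ (ℂ ⊗[ℝ] LieAlg E G) t = T :=
    Quotient.exists_rep T
  induction t using TensorAlgebra.induction with
  | algebraMap r => rw [AlgHom.commutes]; exact hc r
  | mul a b ha hb => rw [map_mul]; exact hmul _ _ ha hb
  | add a b ha hb => rw [map_add]; exact hadd _ _ ha hb
  | ι x =>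
    rw [← UniversalEnvelopingAlgebra.ι_apply]
    induction x using TensorProduct.induction_on with
    | zero => rw [map_zero, ← map_zero (algebraMap ℂ (UAlg E G))]; exact hc 0
    | add x y hx hy => rw [map_add]; exact hadd _ _ hx hy
    | tmul z X =>
      rw [ι_tmul, Algebra.smul_def]
      exact hmul _ _ (hc z) (hX X)

theorem uAlg_hom_ext {A : Type*} [Semiring A] [Algebra ℂ A] {f g : UAlg E G →ₐ[ℂ] A}
    (h : ∀ X : LieAlg E G, f (toU X) = g (toU X)) : f = g := by
  refine AlgHom.ext fun T ↦ ?_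
  induction T using uAlg_induction with
  | hc c => simp
  | hX X => exact h X
  | hadd S T hS hT => simp [hS, hT]
  | hmul S T hS hT => simp [hS, hT]

theorem lift_complexify_toU {A : Type*} [Ring A] [Algebra ℂ A] (f : LieAlg E G →ₗ[ℝ] A)
    (hf : ∀ X Y, f ⁅X, Y⁆ = f X * f Y - f Y * f X) (X : LieAlg E G) :
    UniversalEnvelopingAlgebra.lift ℂ (complexify f hf) (toU X) = f X := by
  rw [toU, UniversalEnvelopingAlgebra.lift_ι_apply]
  change f.liftBaseChange ℂ _ = _
  simp

theorem antiAut_toU (X : LieAlg E G) : antiAut (toU X) = -toU X := by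
  unfold antiAut antiAutOp toU
  rw [UniversalEnvelopingAlgebra.lift_ι_apply]
  simp

theorem antiAut_algebraMap (c : ℂ) :
    antiAut (algebraMap ℂ (UAlg E G) c) = algebraMap ℂ (UAlg E G) c := by
  simp [antiAut]

theorem antiAut_add (S T : UAlg E G) : antiAut (S + T) = antiAut S + antiAut T := by
  simp [antiAut]

theorem antiAut_sub (S T : UAlg E G) : antiAut (S - T) = antiAut S - antiAut T := by
  simp [antiAut]

theorem antiAut_zero : antiAut (0 : UAlg E G) = 0 := by
  simp [antiAut]

theorem antiAut_smul (c : ℂ) (T : UAlg E G) : antiAut (c • T) = c • antiAut T := by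
  simp [antiAut]

theorem antiAut_mul (S T : UAlg E G) : antiAut (S * T) = antiAut T * antiAut S := by
  simp [antiAut]

theorem antiAut_antiAut (T : UAlg E G) : antiAut (antiAut T) = T := by
  induction T using uAlg_induction with
  | hc c => simp only [antiAut_algebraMap]
  | hX X =>
    rw [antiAut_toU, ← neg_one_smul ℂ (toU X), antiAut_smul, antiAut_toU]
    simp
  | hadd S T hS hT => simp only [antiAut_add, hS, hT]
  | hmul S T hS hT => simp only [antiAut_mul, hS, hT]

variable [T2Space G]

/-- The adjoint action of the group on the enveloping algebra. -/
noncomputable def adU (g : G) : UAlg E G →ₐ[ℂ] UAlg E G :=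
  UniversalEnvelopingAlgebra.lift ℂ (complexify
    { toFun := fun X ↦ toU (adjointAction g X)
      map_add' := fun X Y ↦ by rw [adjointAction_add, toU_add]
      map_smul' := fun c X ↦ by
        rw [adjointAction_smul, toU_smul]
        exact (algebraMap_smul ℂ c (toU (adjointAction g X))) } fun X Y ↦ by
      simp only [LinearMap.coe_mk, AddHom.coe_mk]
      rw [adjointAction_lie, toU_lie])

theorem adU_toU (g : G) (X : LieAlg E G) : adU g (toU X) = toU (adjointAction g X) :=
  lift_complexify_toU _ _ X

theorem adU_one (T : UAlg E G) : adU (1 : G) T = T := by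
  have : adU (1 : G) = AlgHom.id ℂ (UAlg E G) :=
    uAlg_hom_ext fun X ↦ by rw [adU_toU, adjointAction_one]; rfl
  rw [this]; rfl

theorem adU_mul (g h : G) (T : UAlg E G) : adU (g * h) T = adU g (adU h T) := by
  have : adU (E := E) (g * h) = (adU g).comp (adU h) :=
    uAlg_hom_ext fun X ↦ by
      rw [AlgHom.comp_apply, adU_toU, adU_toU, adU_toU, adjointAction_mul]
  rw [this]; rfl

theorem adU_apply_inv (g : G) (T : UAlg E G) : adU g (adU g⁻¹ T) = T := by
  rw [← adU_mul, mul_inv_cancel, adU_one]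

/-- The matrix coefficients of the adjoint action on the enveloping algebra are analytic, and
their derivatives are matrix coefficients. -/
theorem exists_adU_eq_sum (T : UAlg E G) :
    ∃ (ι : Type) (_ : Fintype ι) (c : ι → G → ℂ) (S : ι → UAlg E G),
      (∀ i, ContMDiff 𝓘(ℝ, E) 𝓘(ℝ, ℂ) ω (c i)) ∧ (∀ x, adU x T = ∑ i, c i x • S i) ∧
      ∀ (X : LieAlg E G) (x : G),
        adU x (toU X * T - T * toU X) = ∑ i, rightDeriv X (c i) x • S i := by
  induction T using uAlg_induction with
  | hc a =>
    refine ⟨Unit, inferInstance, fun _ _ ↦ a, fun _ ↦ 1, fun _ ↦ contMDiff_const, fun x ↦ ?_,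
      fun X x ↦ ?_⟩
    · simp [Algebra.algebraMap_eq_smul_one]
    · have h : rightDeriv X (fun _ : G ↦ a) x = 0 :=
        rightDeriv_eq_of_hasDerivAt contMDiff_const (hasDerivAt_const _ _)
      simp [h, Algebra.commutes]
  | hX X =>
    let b := Module.finBasis ℝ (LieAlg E G)
    let c : Fin _ → E →L[ℝ] ℂ := fun i ↦
      Complex.ofRealCLM.comp (LinearMap.toContinuousLinearMap (b.coord i) : E →L[ℝ] ℝ)
    have hs : ∀ Z : LieAlg E G, toU Z = ∑ i, c i Z • toU (b i) := by
      intro Z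
      conv_lhs => rw [← b.sum_repr Z, toU_sum]
      rfl
    refine ⟨Fin (Module.finrank ℝ (LieAlg E G)), inferInstance,
      fun i x ↦ c i (adjointAction x X), fun i ↦ toU (b i),
      fun i ↦ contMDiff_adjointAction _ _, fun x ↦ ?_, fun Y x ↦ ?_⟩
    · rw [adU_toU, hs]
    · rw [← toU_lie, adU_toU, hs]
      simp only [rightDeriv_adjointAction]
  | hadd T T' hT hT' =>
    obtain ⟨ι, _, c, S, hc, h1, h2⟩ := hT
    obtain ⟨ι', _, c', S', hc', h1', h2'⟩ := hT'
    refine ⟨ι ⊕ ι', inferInstance, Sum.elim c c', Sum.elim S S', ?_, fun x ↦ ?_, fun X x ↦ ?_⟩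
    · rintro (i | i)
      exacts [hc i, hc' i]
    · simp [h1, h1']
    · rw [mul_add, add_mul, add_sub_add_comm, map_add, h2, h2']
      simp
  | hmul T T' hT hT' =>
    obtain ⟨ι, _, c, S, hc, h1, h2⟩ := hT
    obtain ⟨ι', _, c', S', hc', h1', h2'⟩ := hT'
    refine ⟨ι × ι', inferInstance, fun i ↦ c i.1 * c' i.2, fun i ↦ S i.1 * S' i.2,
      fun i ↦ contMDiff_fun_mul (hc _) (hc' _), fun x ↦ ?_, fun X x ↦ ?_⟩
    · simp only [map_mul, h1, h1', Finset.sum_mul_sum, Fintype.sum_prod_type, Pi.mul_apply,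
        smul_mul_smul_comm]
    · have e : toU X * (T * T') - T * T' * toU X =
          (toU X * T - T * toU X) * T' + T * (toU X * T' - T' * toU X) := by
        noncomm_ring
      rw [e, map_add, map_mul, map_mul, h2, h2', h1, h1']
      simp only [Finset.sum_mul_sum, Fintype.sum_prod_type, smul_mul_smul_comm,
        ← Finset.sum_add_distrib, ← add_smul]
      refine Finset.sum_congr rfl fun i _ ↦ Finset.sum_congr rfl fun j _ ↦ ?_
      rw [rightDeriv_mul _ ((hc i).of_le le_top) ((hc' j).of_le le_top)]
      rfl

/-- The functions `x ↦ ℓ(Ad(x) T)` are analytic, with `L_X ℓ(Ad(x) T) = ℓ(Ad(x) [X, T])`. -/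
theorem contMDiff_adU (ℓ : UAlg E G →ₗ[ℂ] ℂ) (T : UAlg E G) :
    ContMDiff 𝓘(ℝ, E) 𝓘(ℝ, ℂ) ω (fun x : G ↦ ℓ (adU x T)) := by
  obtain ⟨ι, _, c, S, hc, h1, h2⟩ := exists_adU_eq_sum (G := G) T
  have : (fun x : G ↦ ℓ (adU x T)) = ∑ i, ℓ (S i) • c i := by
    funext x
    simp [h1, mul_comm]
  rw [this]
  exact contMDiff_sum fun i _ ↦ contMDiff_const_smul _ (hc i)

theorem rightDeriv_adU (ℓ : UAlg E G →ₗ[ℂ] ℂ) (T : UAlg E G) (X : LieAlg E G) (x : G) :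
    rightDeriv X (fun x : G ↦ ℓ (adU x T)) x = ℓ (adU x (toU X * T - T * toU X)) := by
  obtain ⟨ι, _, c, S, hc, h1, h2⟩ := exists_adU_eq_sum (G := G) T
  have : (fun x : G ↦ ℓ (adU x T)) = ∑ i, ℓ (S i) • c i := by
    funext x
    simp [h1, mul_comm]
  rw [this, rightDeriv_sum _ _ fun i _ ↦ contMDiff_const_smul _ ((hc i).of_le le_top), h2]
  simp [rightDeriv_smul _ _ ((hc _).of_le le_top), mul_comm]

theorem exists_finiteDimensional_adU_mem (T : UAlg E G) :
    ∃ S : Submodule ℂ (UAlg E G), FiniteDimensional ℂ S ∧ ∀ x : G, adU x T ∈ S := by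
  obtain ⟨ι, _, c, S, hc, h1, h2⟩ := exists_adU_eq_sum (G := G) T
  refine ⟨Submodule.span ℂ (range S), FiniteDimensional.span_of_finite ℂ (finite_range S),
    fun x ↦ ?_⟩
  rw [h1]
  exact Submodule.sum_mem _ fun i _ ↦ Submodule.smul_mem _ _ (Submodule.subset_span ⟨i, rfl⟩)

end Enveloping

/-! ### Two-sided ideals are stable under the adjoint action -/

section Uniqueness

variable {E : Type*} [NormedAddCommGroup E] [NormedSpace ℝ E] [FiniteDimensional ℝ E]
  {G : Type*} [TopologicalSpace G] [ChartedSpace E G] [Group G] [LieGroup 𝓘(ℝ, E) ω G]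

theorem contMDiffAt_extChartAt_symm (n : ℕ∞ω) {x₀ : G} {y : E}
    (hy : y ∈ (extChartAt 𝓘(ℝ, E) x₀).target) :
    ContMDiffAt 𝓘(ℝ, E) 𝓘(ℝ, E) n (extChartAt 𝓘(ℝ, E) x₀).symm y := by
  have : IsManifold 𝓘(ℝ, E) n G := IsManifold.of_le (n := ω) le_top
  exact (contMDiffOn_extChartAt_symm x₀).contMDiffAt ((isOpen_extChartAt_target x₀).mem_nhds hy)

/-- The map `(y, y') ↦ x⁻¹ x'` in charts, where `y` and `y'` are the coordinates of `x` and `x'`. -/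
noncomputable def chartDiv (x₀ : G) (p : E × E) : E :=
  extChartAt 𝓘(ℝ, E) (1 : G)
    (((extChartAt 𝓘(ℝ, E) x₀).symm p.1)⁻¹ * (extChartAt 𝓘(ℝ, E) x₀).symm p.2)

theorem contDiffAt_chartDiv {x₀ : G} {y : E} (hy : y ∈ (extChartAt 𝓘(ℝ, E) x₀).target) :
    ContDiffAt ℝ ω (chartDiv x₀) (y, y) := by
  have hs := contMDiffAt_extChartAt_symm (G := G) ω hy
  have h1 : ContMDiffAt 𝓘(ℝ, E × E) 𝓘(ℝ, E) ω (fun p : E × E ↦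
      ((extChartAt 𝓘(ℝ, E) x₀).symm p.1)⁻¹ * (extChartAt 𝓘(ℝ, E) x₀).symm p.2) (y, y) :=
    (hs.comp (y, y) (contDiff_fst.contMDiff (n := ω)).contMDiffAt).inv.mul
      (hs.comp (y, y) (contDiff_snd.contMDiff (n := ω)).contMDiffAt)
  have h2 : ContMDiffAt 𝓘(ℝ, E) 𝓘(ℝ, E) ω (extChartAt 𝓘(ℝ, E) (1 : G)) 1 :=
    contMDiffAt_extChartAt
  exact (ContMDiffAt.comp_of_eq h2 h1 (by simp)).contDiffAt

/-- The differential of a function in a chart, in terms of its derivatives along left invariant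
vector fields. -/
theorem fderiv_comp_extChartAt_symm {φ : G → ℂ} (hφ : ContMDiff 𝓘(ℝ, E) 𝓘(ℝ, ℂ) 1 φ) {x₀ : G}
    {y : E} (hy : y ∈ (extChartAt 𝓘(ℝ, E) x₀).target) (v : E) :
    fderiv ℝ (φ ∘ (extChartAt 𝓘(ℝ, E) x₀).symm) y v =
      rightDeriv (fderiv ℝ (chartDiv x₀) (y, y) ((0 : E), v) : E) φ
        ((extChartAt 𝓘(ℝ, E) x₀).symm y) := by
  set c := extChartAt 𝓘(ℝ, E) x₀
  set x := c.symm y with hx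
  have h1 : ContMDiff 𝓘(ℝ, E) 𝓘(ℝ, ℂ) 1 (fun g ↦ φ (x * g)) := contMDiff_translate_left hφ x
  have h2 : HasFDerivAt (fun y' ↦ chartDiv x₀ (y, y'))
      ((fderiv ℝ (chartDiv x₀) (y, y)).comp (ContinuousLinearMap.inr ℝ E E)) y :=
    HasFDerivAt.comp (g := chartDiv x₀) y
      ((contDiffAt_chartDiv hy).differentiableAt (by simp)).hasFDerivAt
      (hasFDerivAt_prodMk_right y y)
  have h0 : chartDiv x₀ (y, y) = extChartAt 𝓘(ℝ, E) (1 : G) 1 := by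
    simp [chartDiv]
  have h3 : DifferentiableAt ℝ ((fun g ↦ φ (x * g)) ∘ (extChartAt 𝓘(ℝ, E) (1 : G)).symm)
      (extChartAt 𝓘(ℝ, E) (1 : G) 1) := by
    have h := h1.contMDiffAt.comp (extChartAt 𝓘(ℝ, E) (1 : G) 1)
      (contMDiffAt_extChartAt_symm (G := G) 1 (mem_extChartAt_target (1 : G)))
    exact h.contDiffAt.differentiableAt one_ne_zero
  have h4 := HasFDerivAt.comp y (h0 ▸ h3.hasFDerivAt) h2
  have e : φ ∘ c.symm =ᶠ[𝓝 y] ((fun g ↦ φ (x * g)) ∘ (extChartAt 𝓘(ℝ, E) (1 : G)).symm) ∘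
      fun y' ↦ chartDiv x₀ (y, y') := by
    have hcont : ContinuousAt (fun y' ↦ x⁻¹ * c.symm y') y :=
      (((contMDiffAt_const (c := x⁻¹)).mul
        (contMDiffAt_extChartAt_symm (G := G) 1 hy)).continuousAt)
    have hn : (extChartAt 𝓘(ℝ, E) (1 : G)).source ∈ 𝓝 (x⁻¹ * c.symm y) := by
      rw [← hx, inv_mul_cancel]
      exact extChartAt_source_mem_nhds 1
    filter_upwards [hcont.preimage_mem_nhds hn] with y' hy'
    simp only [Function.comp_apply, chartDiv]
    rw [(extChartAt 𝓘(ℝ, E) (1 : G)).left_inv hy', mul_inv_cancel_left]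
  rw [e.fderiv_eq, h4.fderiv]
  rw [h0]
  exact (dAt_one_eq_fderiv (h1.mdifferentiable one_ne_zero 1) _).symm

/-- A solution of a linear system of differential equations that vanishes at a point vanishes near
the point. -/
theorem eventually_eq_zero_of_rightDeriv {ι : Type*} [Fintype ι] {φ : ι → G → ℂ}
    (hφ : ∀ i, ContMDiff 𝓘(ℝ, E) 𝓘(ℝ, ℂ) 1 (φ i)) {m : ι → ι → E →L[ℝ] ℂ}
    (hm : ∀ i (X : LieAlg E G) x, rightDeriv X (φ i) x = ∑ j, m i j X * φ j x) {x₀ : G}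
    (h0 : ∀ i, φ i x₀ = 0) : ∀ᶠ x in 𝓝 x₀, ∀ i, φ i x = 0 := by
  set c := extChartAt 𝓘(ℝ, E) x₀ with hc
  set e := c x₀ with he
  have het : e ∈ c.target := mem_extChartAt_target x₀
  have hd : ContinuousAt (fderiv ℝ (chartDiv x₀)) (e, e) :=
    ((contDiffAt_chartDiv het).fderiv_right (m := 0) (by simp)).continuousAt
  have hd2 : ContinuousAt (fun y : E ↦ ‖fderiv ℝ (chartDiv x₀) (y, y)‖) e :=
    (ContinuousAt.comp (f := fun y : E ↦ (y, y)) hd (by fun_prop)).norm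
  obtain ⟨C, hC⟩ : ∃ C, ‖fderiv ℝ (chartDiv x₀) (e, e)‖ < C := exists_gt _
  obtain ⟨r, hr, hball⟩ := Metric.eventually_nhds_iff_ball.1
    ((hd2.eventually (gt_mem_nhds hC)).and ((isOpen_extChartAt_target x₀).mem_nhds het))
  let f : E → ι → ℂ := fun y i ↦ φ i (c.symm y)
  have hC0 : 0 ≤ C := (norm_nonneg _).trans hC.le
  let B : ℝ := ∑ i, ∑ j, ‖m i j‖
  have hB : 0 ≤ B := by positivity
  have hder : ∀ y ∈ Metric.ball e r, ∃ f' : E →L[ℝ] (ι → ℂ),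
      HasFDerivAt f f' y ∧ ∀ v, ‖f' v‖ ≤ B * (C * ‖v‖) * ‖f y‖ := by
    intro y hy
    obtain ⟨hyC, hyt⟩ := hball y hy
    have hd3 : ∀ i, DifferentiableAt ℝ (φ i ∘ c.symm) y := fun i ↦
      ((hφ i).contMDiffAt.comp y (contMDiffAt_extChartAt_symm (G := G) 1 hyt)).contDiffAt
        |>.differentiableAt one_ne_zero
    refine ⟨ContinuousLinearMap.pi fun i ↦ fderiv ℝ (φ i ∘ c.symm) y,
      hasFDerivAt_pi.2 fun i ↦ (hd3 i).hasFDerivAt, fun v ↦ ?_⟩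
    refine (pi_norm_le_iff_of_nonneg (by positivity)).2 fun i ↦ ?_
    have hv : fderiv ℝ (φ i ∘ c.symm) y v = ∑ j, m i j (fderiv ℝ (chartDiv x₀) (y, y) ((0 : E), v)) *
        f y j := (fderiv_comp_extChartAt_symm (hφ i) hyt v).trans (hm i _ _)
    have hw : ‖fderiv ℝ (chartDiv x₀) (y, y) ((0 : E), v)‖ ≤ C * ‖v‖ := by
      refine (ContinuousLinearMap.le_opNorm _ _).trans ?_
      refine mul_le_mul hyC.le (by simp) (norm_nonneg _) hC0
    rw [ContinuousLinearMap.pi_apply, hv]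
    calc _ ≤ ∑ j, ‖m i j‖ * (C * ‖v‖) * ‖f y‖ := by
          refine (norm_sum_le _ _).trans (Finset.sum_le_sum fun j _ ↦ ?_)
          rw [norm_mul]
          refine mul_le_mul ?_ (norm_le_pi_norm (f y) j) (norm_nonneg _) (by positivity)
          exact (ContinuousLinearMap.le_opNorm _ _).trans
            (mul_le_mul_of_nonneg_left hw (norm_nonneg _))
      _ = (∑ j, ‖m i j‖) * (C * ‖v‖) * ‖f y‖ := by simp only [Finset.sum_mul]
      _ ≤ _ := by
          gcongr
          exact Finset.single_le_sum (f := fun i ↦ ∑ j, ‖m i j‖) (fun i _ ↦ by positivity)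
            (Finset.mem_univ i)
  -- Grönwall's inequality on the segments from the center of the ball
  have hz : ∀ y ∈ Metric.ball e r, f y = 0 := by
    intro y hy
    have hline : ∀ t ∈ Icc (0 : ℝ) 1, e + t • (y - e) ∈ Metric.ball e r := by
      intro t ht
      rw [mem_ball_iff_norm] at hy ⊢
      rw [add_sub_cancel_left, norm_smul, Real.norm_of_nonneg ht.1]
      exact (mul_le_of_le_one_left (norm_nonneg _) ht.2).trans_lt hy
    choose! f' hf' hb using hder
    have hl : ∀ t ∈ Icc (0 : ℝ) 1, HasDerivAt (fun t : ℝ ↦ f (e + t • (y - e)))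
        (f' (e + t • (y - e)) (y - e)) t := by
      intro t ht
      have h1 : HasDerivAt (fun t : ℝ ↦ e + t • (y - e)) (y - e) t := by
        simpa using! ((hasDerivAt_id t).smul_const (y - e)).const_add e
      exact (hf' _ (hline t ht)).comp_hasDerivAt t h1
    have h := eq_zero_of_abs_deriv_le_mul_abs_self_of_eq_zero_right (a := 0) (b := 1)
      (f := fun t : ℝ ↦ f (e + t • (y - e))) (f' := fun t ↦ f' (e + t • (y - e)) (y - e))
      (K := B * (C * ‖y - e‖)) (fun t ht ↦ (hl t ht).continuousAt.continuousWithinAt)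
      (fun t ht ↦ (hl t ⟨ht.1, ht.2.le⟩).hasDerivWithinAt)
      (by
        funext i
        simp only [f, he, zero_smul, add_zero, hc]
        rw [(extChartAt 𝓘(ℝ, E) x₀).left_inv (mem_extChartAt_source x₀)]
        exact h0 i)
      (fun t ht ↦ hb _ (hline t ⟨ht.1, ht.2.le⟩) _) 1 (by simp)
    simpa using h
  have hcont : ContinuousAt c x₀ := continuousAt_extChartAt x₀
  filter_upwards [hcont.preimage_mem_nhds (Metric.ball_mem_nhds e hr),
    extChartAt_source_mem_nhds (I := 𝓘(ℝ, E)) x₀] with x hx hx' i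
  have := congrFun (hz (c x) hx) i
  simpa [f, c.left_inv hx'] using this

theorem eq_zero_of_rightDeriv [ConnectedSpace G] {ι : Type*} [Fintype ι] {φ : ι → G → ℂ}
    (hφ : ∀ i, ContMDiff 𝓘(ℝ, E) 𝓘(ℝ, ℂ) 1 (φ i)) {m : ι → ι → E →L[ℝ] ℂ}
    (hm : ∀ i (X : LieAlg E G) x, rightDeriv X (φ i) x = ∑ j, m i j X * φ j x) {x₀ : G}
    (h0 : ∀ i, φ i x₀ = 0) (i : ι) (x : G) : φ i x = 0 := by
  let Z : Set G := {x | ∀ i, φ i x = 0}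
  have h1 : IsOpen Z := isOpen_iff_mem_nhds.2 fun x hx ↦ eventually_eq_zero_of_rightDeriv hφ hm hx
  have h2 : IsClosed Z := by
    simp only [Z, Set.ofPred_forall]
    exact isClosed_iInter fun i ↦ isClosed_eq (hφ i).continuous continuous_const
  have h3 : Z = univ := IsClopen.eq_univ ⟨h2, h1⟩ ⟨x₀, h0⟩
  exact (h3 ▸ mem_univ x : x ∈ Z) i

variable [T2Space G] [ConnectedSpace G]

/-- A two-sided ideal is stable under the adjoint group: the values on `Ad(x) T` of the functionals
vanishing on the ideal solve a linear homogeneous system of first order on the connected group,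
and they are zero at `x = 1`. -/
theorem adU_mem_of_isTwoSided {I : Ideal (UAlg E G)} (hI : I.IsTwoSided) {T : UAlg E G}
    (hT : T ∈ I) (x : G) : adU x T ∈ I := by
  obtain ⟨S, hS, hSx⟩ := exists_finiteDimensional_adU_mem (G := G) T
  have hr : ∀ (a : UAlg E G), a ∈ I → ∀ b, a * b ∈ I := fun a ha b ↦ hI.mul_mem_of_left b ha
  -- a finite-dimensional subspace of the ideal that contains `T` and is stable under `ad`
  let J : Submodule ℂ (UAlg E G) :=
    { carrier := {T | T ∈ I ∧ ∀ x : G, adU x T ∈ S}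
      add_mem' := fun h h' ↦ ⟨I.add_mem h.1 h'.1, fun x ↦ by
        rw [map_add]; exact S.add_mem (h.2 x) (h'.2 x)⟩
      zero_mem' := ⟨I.zero_mem, fun x ↦ by rw [map_zero]; exact S.zero_mem⟩
      smul_mem' := fun c T h ↦ ⟨by
        rw [Algebra.smul_def]; exact I.mul_mem_left _ h.1, fun x ↦ by
        rw [map_smul]; exact S.smul_mem c (h.2 x)⟩ }
  have hJS : J ≤ S := fun T h ↦ by simpa [adU_one] using h.2 1
  have hJf : FiniteDimensional ℂ J := Submodule.finiteDimensional_of_le hJS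
  have had : ∀ (X : LieAlg E G), ∀ T ∈ J, toU X * T - T * toU X ∈ J := by
    rintro X T ⟨h1, h2⟩
    refine ⟨I.sub_mem (I.mul_mem_left _ h1) (hr _ h1 _), fun x ↦ ?_⟩
    by_contra hn
    obtain ⟨ℓ, hℓ, hle⟩ := Submodule.exists_le_ker_of_notMem hn
    apply hℓ
    rw [← rightDeriv_adU]
    have e : (fun x : G ↦ ℓ (adU x T)) = fun _ ↦ 0 := funext fun x ↦ hle (h2 x)
    rw [e]
    exact rightDeriv_eq_of_hasDerivAt contMDiff_const (hasDerivAt_const _ _)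
  by_contra hn
  obtain ⟨ℓ, hℓ, hle⟩ := Submodule.exists_le_ker_of_notMem (p := I.restrictScalars ℂ) hn
  let b := Module.finBasis ℂ J
  have hb : ∀ T' (h : T' ∈ J), T' = ∑ j, b.repr ⟨T', h⟩ j • (b j : UAlg E G) := by
    intro T' h
    have := congrArg (Subtype.val) (b.sum_repr ⟨T', h⟩)
    simpa only [AddSubmonoidClass.coe_finsetSum, Submodule.coe_smul] using this.symm
  let D : Fin (Module.finrank ℂ J) → Fin (Module.finrank ℂ J) → LieAlg E G →ₗ[ℝ] ℂ := fun i j ↦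
    { toFun := fun X ↦ b.repr ⟨_, had X (b i) (b i).2⟩ j
      map_add' := fun X Y ↦ by
        rw [← Finsupp.add_apply, ← map_add]
        congr 2
        refine Subtype.ext ?_
        simp only [Submodule.coe_add]
        rw [toU_add, add_mul, mul_add, add_sub_add_comm]
      map_smul' := fun c X ↦ by
        have h : (⟨_, had (c • X) (b i) (b i).2⟩ : J) = (c : ℂ) • ⟨_, had X (b i) (b i).2⟩ := by
          refine Subtype.ext ?_
          simp only [Submodule.coe_smul]
          rw [toU_smul, smul_mul_assoc, mul_smul_comm, ← smul_sub]
        rw [h, map_smul]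
        simp }
  let m : Fin (Module.finrank ℂ J) → Fin (Module.finrank ℂ J) → E →L[ℝ] ℂ := fun i j ↦
    LinearMap.toContinuousLinearMap (show E →ₗ[ℝ] ℂ from D i j)
  have hz := eq_zero_of_rightDeriv (φ := fun i (x : G) ↦ ℓ (adU x (b i : UAlg E G))) (m := m)
    (fun i ↦ (contMDiff_adU ℓ _).of_le le_top) (fun i X x ↦ by
      rw [rightDeriv_adU]
      refine (congrArg (fun T ↦ ℓ (adU x T)) (hb _ (had X (b i) (b i).2))).trans ?_
      simp only [map_sum, map_smul]
      rfl) (x₀ := 1)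
    (fun i ↦ by rw [adU_one]; exact hle (b i).2.1)
  apply hℓ
  rw [hb T ⟨hT, hSx⟩]
  simp only [map_sum, map_smul, hz, smul_zero, Finset.sum_const_zero]

end Uniqueness

/-! ### The right regular representation of the enveloping algebra -/

section RightRegular

attribute [local instance 100] LieRing.ofAssociativeRing

variable {E : Type*} [NormedAddCommGroup E] [NormedSpace ℝ E] [FiniteDimensional ℝ E]
  {G : Type*} [TopologicalSpace G] [ChartedSpace E G] [Group G] [LieGroup 𝓘(ℝ, E) ω G]

theorem uAlg_mul_induction {p : UAlg E G → Prop} (h1 : p 1) (hadd : ∀ S T, p S → p T → p (S + T))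
    (hsmul : ∀ (c : ℂ) T, p T → p (c • T)) (hX : ∀ (X : LieAlg E G) T, p T → p (toU X * T))
    (T : UAlg E G) : p T := by
  have h : ∀ S T : UAlg E G, p T → p (S * T) := by
    intro S
    induction S using uAlg_induction with
    | hc c => intro T hT; rw [← Algebra.smul_def]; exact hsmul c T hT
    | hX X => exact hX X
    | hadd S S' hS hS' => intro T hT; rw [add_mul]; exact hadd _ _ (hS T hT) (hS' T hT)
    | hmul S S' hS hS' => intro T hT; rw [mul_assoc]; exact hS _ (hS' T hT)
  simpa using h T 1 h1

/-- A regular space is a bimodule if it is stable under the right regular representation of the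
Lie algebra and under multiplication by analytic functions. -/
structure RegularSpace.IsBimodule (V : RegularSpace E G) : Prop where
  rightDeriv_mem : ∀ (X : LieAlg E G), ∀ φ ∈ V.carrier, rightDeriv X φ ∈ V.carrier
  mul_mem : ∀ c ∈ (analyticSpace E G).carrier, ∀ φ ∈ V.carrier, c * φ ∈ V.carrier

variable [T2Space G]

theorem analyticSpace_isBimodule : (analyticSpace E G).IsBimodule where
  rightDeriv_mem X _ h := rightDeriv_contMDiff (by simp) X h
  mul_mem _ hc _ h := contMDiff_fun_mul hc h

theorem rightDeriv_hasCompactSupport (X : LieAlg E G) {φ : G → ℂ}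
    (hφ : ContMDiff 𝓘(ℝ, E) 𝓘(ℝ, ℂ) 1 φ) (h : HasCompactSupport φ) :
    HasCompactSupport (rightDeriv X φ) := by
  refine h.mono' fun x hx ↦ ?_
  by_contra hc
  apply hx
  have h1 : φ =ᶠ[𝓝 x] 0 := notMem_tsupport_iff_eventuallyEq.1 hc
  rw [rightDeriv_eq X hφ]
  have h2 : (dAt φ x : TangentSpace 𝓘(ℝ, E) x →L[ℝ] ℂ) = 0 := (dAt_congr h1).trans mfderiv_const
  rw [h2]
  rfl

theorem testSpace_isBimodule : (testSpace E G).IsBimodule where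
  rightDeriv_mem X φ h := ⟨rightDeriv_contMDiff (by simp) X h.1,
    rightDeriv_hasCompactSupport X (h.1.of_le (WithTop.coe_le_coe.2 le_top)) h.2⟩
  mul_mem c hc φ h := ⟨contMDiff_fun_mul (ContMDiff.of_le hc le_top) h.1, HasCompactSupport.mul_left h.2⟩

theorem smoothSpace_isBimodule : (smoothSpace E G).IsBimodule where
  rightDeriv_mem X _ h := rightDeriv_contMDiff (by simp) X h
  mul_mem _ hc _ h := contMDiff_fun_mul (ContMDiff.of_le hc le_top) h

namespace RegularSpace

variable {V : RegularSpace E G}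

theorem contMDiff_one (φ : V.carrier) : ContMDiff 𝓘(ℝ, E) 𝓘(ℝ, ℂ) 1 φ.1 :=
  (V.smooth _ φ.2).of_le (WithTop.coe_le_coe.2 le_top)

theorem contMDiff_two (φ : V.carrier) : ContMDiff 𝓘(ℝ, E) 𝓘(ℝ, ℂ) 2 φ.1 :=
  (V.smooth _ φ.2).of_le (WithTop.coe_le_coe.2 le_top)

theorem rep_toU (X : LieAlg E G) (φ : V.carrier) : (V.rep (toU X) φ).1 = leftDeriv X φ.1 := by
  rw [rep, lift_complexify_toU]
  rfl

/-- The derivation `L_X` as an operator on a bimodule. -/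
noncomputable def lieActRight (hV : V.IsBimodule) : LieAlg E G →ₗ[ℝ] Module.End ℂ V.carrier where
  toFun X :=
    { toFun := fun φ ↦ ⟨rightDeriv X φ.1, hV.rightDeriv_mem X φ.1 φ.2⟩
      map_add' := fun φ ψ ↦ Subtype.ext <| rightDeriv_add X (contMDiff_one φ) (contMDiff_one ψ)
      map_smul' := fun c φ ↦ Subtype.ext <| rightDeriv_smul X c (contMDiff_one φ) }
  map_add' X Y := LinearMap.ext fun φ ↦ Subtype.ext <| rightDeriv_add_left X Y φ.1
  map_smul' r X := LinearMap.ext fun φ ↦ Subtype.ext <| rightDeriv_smul_left r X φ.1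

/-- The right regular representation of the enveloping algebra, `X ↦ L_X`. -/
noncomputable def rightRep (hV : V.IsBimodule) : UAlg E G →ₐ[ℂ] Module.End ℂ V.carrier :=
  UniversalEnvelopingAlgebra.lift ℂ (complexify (A := Module.End ℂ V.carrier) (lieActRight hV) (by
    intro X Y
    exact LinearMap.ext fun φ ↦ Subtype.ext <| rightDeriv_lie' X Y (contMDiff_two φ)))

theorem rightRep_toU (hV : V.IsBimodule) (X : LieAlg E G) (φ : V.carrier) :
    (rightRep hV (toU X) φ).1 = rightDeriv X φ.1 := by
  rw [rightRep, lift_complexify_toU]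
  rfl

/-- Multiplication by an analytic function on a bimodule. -/
noncomputable def mulBy (hV : V.IsBimodule) (c : (analyticSpace E G).carrier) :
    V.carrier →ₗ[ℂ] V.carrier where
  toFun φ := ⟨c.1 * φ.1, hV.mul_mem c.1 c.2 φ.1 φ.2⟩
  map_add' φ ψ := Subtype.ext (mul_add c.1 φ.1 ψ.1)
  map_smul' r φ := Subtype.ext (mul_smul_comm r c.1 φ.1)

theorem mulBy_coe (hV : V.IsBimodule) (c : (analyticSpace E G).carrier) (φ : V.carrier) :
    (mulBy hV c φ).1 = c.1 * φ.1 := rfl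

theorem rightDeriv_eq_neg_leftDeriv {φ : G → ℂ} (hφ : ContMDiff 𝓘(ℝ, E) 𝓘(ℝ, ℂ) 1 φ)
    (X : LieAlg E G) (x : G) : rightDeriv X φ x = -leftDeriv (adjointAction x X) φ x := by
  rw [leftDeriv_eq hφ, adjointAction_inv_apply, neg_neg]

theorem leftDeriv_mul (X : LieAlg E G) {φ ψ : G → ℂ} (hφ : ContMDiff 𝓘(ℝ, E) 𝓘(ℝ, ℂ) 1 φ)
    (hψ : ContMDiff 𝓘(ℝ, E) 𝓘(ℝ, ℂ) 1 ψ) :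
    leftDeriv X (φ * ψ) = leftDeriv X φ * ψ + φ * leftDeriv X ψ := by
  funext x
  rw [leftDeriv_eq (contMDiff_fun_mul hφ hψ), rightDeriv_mul _ hφ hψ]
  simp only [Pi.add_apply, Pi.mul_apply, leftDeriv_eq hφ, leftDeriv_eq hψ]
  ring

theorem sum_apply {ι : Type*} (s : Finset ι) (φ : ι → V.carrier) (x : G) :
    (∑ i ∈ s, φ i).1 x = ∑ i ∈ s, (φ i).1 x := by
  rw [AddSubmonoidClass.coe_finsetSum, Finset.sum_apply]

/-- At the point `x` the right regular representation of `T` is the left regular representation of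
the image of `Ad(x) T` under the anti-automorphism. -/
theorem rightRep_apply (hV : V.IsBimodule) (T : UAlg E G) (φ : V.carrier) (x : G) :
    (rightRep hV T φ).1 x = (V.rep (antiAut (adU x T)) φ).1 x := by
  induction T using uAlg_mul_induction generalizing x with
  | h1 =>
    have h : antiAut (1 : UAlg E G) = 1 := by simpa using antiAut_algebraMap (E := E) (G := G) 1
    rw [map_one, map_one, h, map_one]
  | hadd S T hS hT =>
    simp only [map_add, antiAut_add, LinearMap.add_apply, Submodule.coe_add, Pi.add_apply, hS, hT]
  | hsmul c T hT =>
    simp only [map_smul, antiAut_smul, LinearMap.smul_apply, Submodule.coe_smul, Pi.smul_apply, hT]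
  | hX X T hT =>
    obtain ⟨ι, _, c, S, hc, h1, h2⟩ := exists_adU_eq_sum (G := G) T
    have hrep : ∀ (y : G) (R : UAlg E G) (d : ι → ℂ), R = ∑ i, d i • S i →
        (V.rep (antiAut R) φ).1 y = ∑ i, d i * (V.rep (antiAut (S i)) φ).1 y := by
      rintro y R d rfl
      have e : antiAut (∑ i, d i • S i) = ∑ i, d i • antiAut (S i) := by
        simp [antiAut]
      rw [e, map_sum, LinearMap.sum_apply, sum_apply]
      simp only [map_smul, LinearMap.smul_apply, Submodule.coe_smul, Pi.smul_apply, smul_eq_mul]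
    have e : (rightRep hV T φ).1 = ∑ i, c i * (V.rep (antiAut (S i)) φ).1 := by
      funext y
      rw [hT, hrep y _ _ (h1 y)]
      simp
    rw [map_mul, Module.End.mul_apply, rightRep_toU, e, rightDeriv_sum _ _ fun i _ ↦
      contMDiff_fun_mul ((hc i).of_le le_top) (contMDiff_one _)]
    simp only [rightDeriv_mul _ ((hc _).of_le le_top) (contMDiff_one _), Finset.sum_apply,
      Pi.add_apply, Pi.mul_apply, Finset.sum_add_distrib]
    rw [← hrep x _ _ (h2 X x)]
    have e2 : ∑ i, c i x * rightDeriv X (V.rep (antiAut (S i)) φ).1 x =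
        (V.rep (antiAut (adU x (T * toU X))) φ).1 x := by
      rw [map_mul, adU_toU, h1, Finset.sum_mul]
      have e3 : antiAut (∑ i, c i x • S i * toU (adjointAction x X)) =
          ∑ i, c i x • (antiAut (toU (adjointAction x X)) * antiAut (S i)) := by
        simp [antiAut]
      rw [e3, map_sum, LinearMap.sum_apply, sum_apply]
      refine Finset.sum_congr rfl fun i _ ↦ ?_
      rw [rightDeriv_eq_neg_leftDeriv (contMDiff_one _), ← rep_toU, antiAut_toU, neg_mul, map_smul,
        map_neg, map_mul]
      rfl
    rw [e2, ← Pi.add_apply, ← Submodule.coe_add, ← LinearMap.add_apply, ← map_add, ← antiAut_add,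
      ← map_add, sub_add_cancel]

theorem sum_comp_mulBy_eq (hV : V.IsBimodule) (R : UAlg E G →ₗ[ℂ] Module.End ℂ V.carrier)
    {B : Type*} (b : Module.Basis B ℂ (UAlg E G)) (K : Finset B)
    {ι : Type*} [Fintype ι] (c : ι → (analyticSpace E G).carrier) (S : ι → UAlg E G)
    (hK : ∀ i, (b.repr (S i)).support ⊆ K) (φ : V.carrier) :
    ∑ i, R (S i) (mulBy hV (c i) φ) =
      ∑ k ∈ K, R (b k) (∑ i, b.repr (S i) k • mulBy hV (c i) φ) := by
  simp only [map_sum, map_smul]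
  rw [Finset.sum_comm]
  refine Finset.sum_congr rfl fun i _ ↦ ?_
  conv_lhs => rw [← b.linearCombination_repr (S i), Finsupp.linearCombination_apply,
    Finsupp.sum_of_support_subset _ (hK i) _ (by simp)]
  simp

/-- Expressions `∑ R(Sᵢ) cᵢ` depend only on the function `∑ cᵢ Sᵢ` with values in the enveloping
algebra. -/
theorem sum_comp_mulBy_congr (hV : V.IsBimodule) (R : UAlg E G →ₗ[ℂ] Module.End ℂ V.carrier)
    {ι κ : Type*} [Fintype ι] [Fintype κ] {c : ι → (analyticSpace E G).carrier}
    {d : κ → (analyticSpace E G).carrier} {S : ι → UAlg E G} {T : κ → UAlg E G}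
    (h : ∀ x : G, ∑ i, (c i).1 x • S i = ∑ j, (d j).1 x • T j) (φ : V.carrier) :
    ∑ i, R (S i) (mulBy hV (c i) φ) = ∑ j, R (T j) (mulBy hV (d j) φ) := by
  classical
  let b := Module.Basis.ofVectorSpace ℂ (UAlg E G)
  let K := (Finset.univ.biUnion fun i ↦ (b.repr (S i)).support) ∪
    (Finset.univ.biUnion fun j ↦ (b.repr (T j)).support)
  rw [sum_comp_mulBy_eq hV R b K c S fun i ↦ (Finset.subset_biUnion_of_mem
      (fun i ↦ (b.repr (S i)).support) (Finset.mem_univ i)).trans Finset.subset_union_left,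
    sum_comp_mulBy_eq hV R b K d T fun j ↦ (Finset.subset_biUnion_of_mem
      (fun j ↦ (b.repr (T j)).support) (Finset.mem_univ j)).trans Finset.subset_union_right]
  refine Finset.sum_congr rfl fun k _ ↦ congrArg _ (Subtype.ext <| funext fun x ↦ ?_)
  have e := congrArg (fun u ↦ b.repr u k * φ.1 x) (h x)
  simp only [map_sum, map_smul, Finsupp.coe_finsetSum, Finsupp.coe_smul, Finset.sum_apply,
    Pi.smul_apply, smul_eq_mul, Finset.sum_mul] at e
  simp only [sum_apply, Submodule.coe_smul, Pi.smul_apply, mulBy_coe, Pi.mul_apply, smul_eq_mul]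
  refine (Finset.sum_congr rfl fun i _ ↦ ?_).trans (e.trans (Finset.sum_congr rfl fun i _ ↦ ?_)) <;>
    ring

/-- The group is unimodular. The functional `X ↦ tr ad X` is `B(Z, ·)` for some `Z`, since the Killing form `B` is
nondegenerate; it vanishes on brackets, so `Z` is central and `B(Z, ·) = 0`. -/
theorem trace_ad_eq_zero (D : IwasawaData E G) (X : LieAlg E G) :
    LinearMap.trace ℝ _ (LieAlgebra.ad ℝ (LieAlg E G) X) = 0 := by
  have h0 : ∀ Z : LieAlg E G, (∀ Y, killingForm ℝ (LieAlg E G) Z Y = 0) → Z = 0 := by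
    intro Z hZ
    by_contra h
    have h1 := D.θ_pos Z h
    rw [hZ, neg_zero] at h1
    exact h1.false
  have hinj : Function.Injective (killingForm ℝ (LieAlg E G)) := by
    rw [← LinearMap.ker_eq_bot, LinearMap.ker_eq_bot']
    exact fun Z hZ ↦ h0 Z fun Y ↦ by rw [hZ]; rfl
  have hsurj : Function.Surjective (killingForm ℝ (LieAlg E G)) :=
    (LinearMap.injective_iff_surjective_of_finrank_eq_finrank
      (Subspace.dual_finrank_eq (K := ℝ) (V := LieAlg E G)).symm).1 hinj
  obtain ⟨Z, hZ⟩ := hsurj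
    (LinearMap.trace ℝ (LieAlg E G) ∘ₗ (LieAlgebra.ad ℝ (LieAlg E G)).toLinearMap)
  have hc : ∀ Y : LieAlg E G, (⁅Z, Y⁆ : LieAlg E G) = 0 := by
    refine fun Y ↦ h0 _ fun W ↦ ?_
    rw [show killingForm ℝ (LieAlg E G) ⁅Z, Y⁆ W = killingForm ℝ (LieAlg E G) Z ⁅Y, W⁆ from
      LieModule.traceForm_apply_lie_apply ℝ _ _ _ _ _, hZ]
    simp [LieRing.of_associative_ring_bracket, LinearMap.trace_mul_comm]
  have hZ0 : Z = 0 := by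
    refine h0 Z fun Y ↦ ?_
    have : LieAlgebra.ad ℝ (LieAlg E G) Z = 0 := LinearMap.ext hc
    rw [killingForm_apply_apply, this]
    simp
  have h := congrArg (fun f ↦ f X) hZ
  rw [hZ0] at h
  simpa using h.symm

theorem rightDeriv_leftDeriv {φ : G → ℂ} (hφ : ContMDiff 𝓘(ℝ, E) 𝓘(ℝ, ℂ) ∞ φ) (X Y : LieAlg E G) :
    rightDeriv X (leftDeriv Y φ) = leftDeriv Y (rightDeriv X φ) := by
  funext x
  have e : ∀ g : G, rightDeriv X φ (g⁻¹ * x) = dAt (fun h ↦ φ (g⁻¹ * (x * h))) 1 X := by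
    intro g
    simp only [rightDeriv, mul_assoc]
  have h1 : ContMDiff 𝓘(ℝ, E) 𝓘(ℝ, ℂ) ∞ fun g : G ↦ rightDeriv X φ (g⁻¹ * x) :=
    (rightDeriv_contMDiff (m := ∞) (by simp) X hφ).comp
      ((contMDiff_inv 𝓘(ℝ, E) ∞).mul contMDiff_const)
  have h2 : ContMDiff 𝓘(ℝ, E) 𝓘(ℝ, ℂ) ∞ fun h : G ↦ leftDeriv Y φ (x * h) :=
    (leftDeriv_contMDiff (m := ∞) (by simp) Y hφ).comp contMDiff_mul_left
  have h := dAt_dAt_comm (Ψ := fun p : G × G ↦ φ (p.1⁻¹ * (x * p.2)))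
    (hφ.comp (((contMDiff_inv 𝓘(ℝ, E) ∞).comp contMDiff_fst).mul
      (contMDiff_const.mul contMDiff_snd))) Y X
    (by simp only [← e]; exact h1.mdifferentiable (by simp) _)
    (h2.mdifferentiable (by simp) _)
  simp only [← e] at h
  exact h.symm

/-- The left and the right regular representation commute. -/
theorem rightRep_mul_rep (hV : V.IsBimodule) (S T : UAlg E G) :
    rightRep hV S * V.rep T = V.rep T * rightRep hV S := by
  have hc : ∀ c : ℂ, ∀ A : Module.End ℂ V.carrier,
      A * algebraMap ℂ _ c = algebraMap ℂ _ c * A := fun c A ↦ (Algebra.commutes c A).symm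
  induction S using uAlg_induction with
  | hc c => rw [AlgHom.commutes, ← hc]
  | hadd S S' h h' => rw [map_add, add_mul, mul_add, h, h']
  | hmul S S' h h' => rw [map_mul, mul_assoc, h', ← mul_assoc, h, mul_assoc]
  | hX X =>
    induction T using uAlg_induction with
    | hc c => rw [AlgHom.commutes, ← hc]
    | hadd S S' h h' => rw [map_add, add_mul, mul_add, h, h']
    | hmul S S' h h' => rw [map_mul, ← mul_assoc, h, mul_assoc, h', ← mul_assoc]
    | hX Y =>
      refine LinearMap.ext fun φ ↦ Subtype.ext ?_
      simp only [Module.End.mul_apply, rep_toU, rightRep_toU]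
      exact rightDeriv_leftDeriv (V.smooth _ φ.2) X Y

theorem uAlg_induction_mul {p : UAlg E G → Prop} (h1 : p 1) (hadd : ∀ S T, p S → p T → p (S + T))
    (hsmul : ∀ (c : ℂ) T, p T → p (c • T)) (hX : ∀ (X : LieAlg E G) T, p T → p (T * toU X))
    (T : UAlg E G) : p T := by
  have h : ∀ S T : UAlg E G, p T → p (T * S) := by
    intro S
    induction S using uAlg_induction with
    | hc c =>
      intro T hT
      rw [← Algebra.commutes, ← Algebra.smul_def]
      exact hsmul c T hT
    | hX X => exact hX X
    | hadd S S' hS hS' => intro T hT; rw [mul_add]; exact hadd _ _ (hS T hT) (hS' T hT)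
    | hmul S S' hS hS' => intro T hT; rw [← mul_assoc]; exact hS' _ (hS T hT)
  simpa using h T 1 h1

theorem antiAut_one : antiAut (1 : UAlg E G) = 1 := by
  simpa using antiAut_algebraMap (E := E) (G := G) 1

section Unimodular

variable (D : IwasawaData E G) (hV : V.IsBimodule)

/-- Moving the coefficients of `Ad(x) X` past the derivatives produces a divergence term, which is
the trace of `ad X` and vanishes because the group is unimodular. -/
theorem exists_rightRep_antiAut_toU (D : IwasawaData E G) (hV : V.IsBimodule) (X : LieAlg E G) :
    ∃ (ι : Type) (_ : Fintype ι) (c : ι → (analyticSpace E G).carrier) (S : ι → UAlg E G),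
      (∀ x : G, adU x (toU X) = ∑ i, (c i).1 x • S i) ∧
      ∀ φ, rightRep hV (antiAut (toU X)) φ = ∑ i, V.rep (S i) (mulBy hV (c i) φ) := by
  let b : Module.Basis _ ℝ (LieAlg E G) := Module.finBasis ℝ (LieAlg E G)
  let ℓ : Fin (Module.finrank ℝ (LieAlg E G)) → E →L[ℝ] ℂ := fun k ↦
    Complex.ofRealCLM ∘L LinearMap.toContinuousLinearMap (show E →ₗ[ℝ] ℝ from b.coord k)
  have hℓ : ∀ k (Y : LieAlg E G), ℓ k Y = b.repr Y k := fun k Y ↦ rfl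
  let c : Fin (Module.finrank ℝ (LieAlg E G)) → (analyticSpace E G).carrier :=
    fun k ↦ ⟨fun x ↦ ℓ k (adjointAction x X), contMDiff_adjointAction (ℓ k) X⟩
  have hc : ∀ k x, (c k).1 x = (b.repr (adjointAction x X) k : ℂ) := fun k x ↦ rfl
  refine ⟨_, inferInstance, c, fun k ↦ toU (b k), fun x ↦ ?_, fun φ ↦ Subtype.ext <|
    funext fun x ↦ ?_⟩
  · simp only [adU_toU, hc]
    conv_lhs => rw [← b.sum_repr (adjointAction x X)]
    simp only [toU_sum]
  · have htr : ∑ k, leftDeriv (b k) (c k).1 x = 0 := by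
      have h := trace_ad_eq_zero D (adjointAction x X)
      rw [LinearMap.trace_eq_matrix_trace ℝ b, Matrix.trace] at h
      have h' : ∀ k, leftDeriv (b k) (c k).1 x =
          ((LinearMap.toMatrix b b (LieAlgebra.ad ℝ (LieAlg E G) (adjointAction x X))).diag k : ℂ)
          := by
        intro k
        rw [leftDeriv_eq (ContMDiff.of_le (c k).2 le_top)]
        have h0 : rightDeriv (adjointAction x⁻¹ (b k)) (c k).1 x =
            ℓ k (adjointAction x ⁅adjointAction x⁻¹ (b k), X⁆ : LieAlg E G) :=
          rightDeriv_adjointAction (ℓ k) X _ x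
        refine (congrArg Neg.neg h0).trans ?_
        rw [adjointAction_lie, adjointAction_apply_inv, Matrix.diag_apply, LinearMap.toMatrix_apply,
          hℓ, LieAlgebra.ad_apply, ← lie_skew (adjointAction x X) (b k), map_neg]
        simp
      simp only [h']
      exact_mod_cast h
    have e : ∀ k, (V.rep (toU (b k)) (mulBy hV (c k) φ)).1 x =
        leftDeriv (b k) (c k).1 x * φ.1 x + (c k).1 x * leftDeriv (b k) φ.1 x := by
      intro k
      rw [rep_toU, mulBy_coe, leftDeriv_mul _ (ContMDiff.of_le (c k).2 le_top) (contMDiff_one φ)]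
      rfl
    rw [sum_apply]
    simp only [e, Finset.sum_add_distrib, ← Finset.sum_mul, htr, zero_mul, zero_add]
    rw [antiAut_toU, map_neg]
    refine (congrArg Neg.neg (congrFun (rightRep_toU hV X φ) x)).trans ?_
    rw [rightDeriv_eq_neg_leftDeriv (contMDiff_one φ), neg_neg, ← rep_toU]
    conv_lhs => rw [← b.sum_repr (adjointAction x X), toU_sum, map_sum, LinearMap.sum_apply,
      sum_apply]
    refine Finset.sum_congr rfl fun k _ ↦ ?_
    rw [map_smul, LinearMap.smul_apply, ← rep_toU]
    rfl

theorem exists_rightRep_antiAut (D : IwasawaData E G) (hV : V.IsBimodule) (T : UAlg E G) :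
    ∃ (ι : Type) (_ : Fintype ι) (c : ι → (analyticSpace E G).carrier) (S : ι → UAlg E G),
      (∀ x : G, adU x T = ∑ i, (c i).1 x • S i) ∧
      ∀ φ, rightRep hV (antiAut T) φ = ∑ i, V.rep (S i) (mulBy hV (c i) φ) := by
  induction T using uAlg_induction_mul with
  | h1 =>
    refine ⟨Unit, inferInstance, fun _ ↦ ⟨fun _ ↦ 1, contMDiff_const⟩, fun _ ↦ 1, fun x ↦ ?_,
      fun φ ↦ ?_⟩
    · simp
    · rw [antiAut_one]
      simp only [map_one, Finset.univ_unique, Finset.sum_singleton, Module.End.one_apply]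
      exact Subtype.ext (one_mul φ.1).symm
  | hadd S T hS hT =>
    obtain ⟨ι, _, c, S', h1, h2⟩ := hS
    obtain ⟨κ, _, d, T', h3, h4⟩ := hT
    refine ⟨ι ⊕ κ, inferInstance, Sum.elim c d, Sum.elim S' T', fun x ↦ ?_, fun φ ↦ ?_⟩
    · simp [map_add, h1, h3]
    · simp [antiAut_add, map_add, h2, h4]
  | hsmul a T hT =>
    obtain ⟨ι, _, c, S', h1, h2⟩ := hT
    refine ⟨ι, inferInstance, c, fun i ↦ a • S' i, fun x ↦ ?_, fun φ ↦ ?_⟩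
    · rw [map_smul, h1, Finset.smul_sum]
      exact Finset.sum_congr rfl fun i _ ↦ smul_comm _ _ _
    · rw [antiAut_smul, map_smul, LinearMap.smul_apply, h2, Finset.smul_sum]
      simp
  | hX X T hT =>
    obtain ⟨ι, _, c, S', h1, h2⟩ := hT
    obtain ⟨κ, _, d, T', h3, h4⟩ := exists_rightRep_antiAut_toU D hV X
    refine ⟨ι × κ, inferInstance, fun i ↦ ⟨(d i.2).1 * (c i.1).1, contMDiff_fun_mul (d i.2).2 (c i.1).2⟩,
      fun i ↦ S' i.1 * T' i.2, fun x ↦ ?_, fun φ ↦ ?_⟩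
    · rw [map_mul, h1, h3, Finset.sum_mul_sum, Fintype.sum_prod_type]
      refine Finset.sum_congr rfl fun i _ ↦ Finset.sum_congr rfl fun j _ ↦ ?_
      rw [smul_mul_smul_comm, mul_comm]
      rfl
    · rw [antiAut_mul, map_mul, Module.End.mul_apply, h2, map_sum, Fintype.sum_prod_type]
      refine Finset.sum_congr rfl fun i _ ↦ ?_
      rw [← Module.End.mul_apply, rightRep_mul_rep, Module.End.mul_apply, h4, map_sum]
      refine Finset.sum_congr rfl fun j _ ↦ ?_
      rw [map_mul, Module.End.mul_apply]
      exact congrArg _ (congrArg _ (Subtype.ext (mul_assoc (d j).1 (c i).1 φ.1).symm))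

/-- The right regular representation of `a(T)` is `∑ π(Sᵢ) cᵢ` if `Ad(x) T = ∑ cᵢ(x) Sᵢ`. -/
theorem rightRep_antiAut (D : IwasawaData E G) (hV : V.IsBimodule) {T : UAlg E G} {ι : Type*}
    [Fintype ι]
    {c : ι → (analyticSpace E G).carrier} {S : ι → UAlg E G}
    (h : ∀ x : G, adU x T = ∑ i, (c i).1 x • S i) (φ : V.carrier) :
    rightRep hV (antiAut T) φ = ∑ i, V.rep (S i) (mulBy hV (c i) φ) := by
  obtain ⟨κ, _, d, S', h1, h2⟩ := exists_rightRep_antiAut D hV T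
  rw [h2]
  exact sum_comp_mulBy_congr hV V.rep.toLinearMap (fun x ↦ (h1 x).symm.trans (h x)) φ

/-- The formula inverse to `rightRep_antiAut`. -/
theorem rep_eq_sum (D : IwasawaData E G) (hV : V.IsBimodule) {T : UAlg E G} {ι : Type*}
    [Fintype ι]
    {c : ι → (analyticSpace E G).carrier} {S : ι → UAlg E G}
    (h : ∀ x : G, adU x⁻¹ T = ∑ i, (c i).1 x • S i) (φ : V.carrier) :
    V.rep T φ = ∑ i, rightRep hV (antiAut (S i)) (mulBy hV (c i) φ) := by
  choose κ hκ d S' h1 h2 using fun i ↦ exists_rightRep_antiAut D hV (S i)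
  simp only [h2]
  have e := sum_comp_mulBy_congr hV V.rep.toLinearMap (ι := Unit) (κ := Σ i, κ i)
    (c := fun _ ↦ ⟨fun _ ↦ 1, contMDiff_const⟩) (S := fun _ ↦ T)
    (d := fun i ↦ ⟨(d i.1 i.2).1 * (c i.1).1, contMDiff_fun_mul (d i.1 i.2).2 (c i.1).2⟩)
    (T := fun i ↦ S' i.1 i.2) (fun x ↦ ?_) φ
  · rw [Fintype.sum_sigma] at e
    simp only [Finset.univ_unique, Finset.sum_singleton] at e
    have h0 : mulBy hV ⟨fun _ ↦ 1, contMDiff_const⟩ φ = φ := Subtype.ext (one_mul φ.1)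
    rw [h0] at e
    refine e.trans (Finset.sum_congr rfl fun i _ ↦ Finset.sum_congr rfl fun j _ ↦ ?_)
    exact congrArg _ (Subtype.ext (mul_assoc (d i j).1 (c i).1 φ.1))
  · have hT : T = adU x (adU x⁻¹ T) := (adU_apply_inv x T).symm
    rw [Fintype.sum_sigma]
    simp only [Finset.univ_unique, Finset.sum_singleton, one_smul]
    conv_lhs => rw [hT, h x, map_sum]
    refine Finset.sum_congr rfl fun i _ ↦ ?_
    rw [map_smul, h1, Finset.smul_sum]
    refine Finset.sum_congr rfl fun j _ ↦ ?_
    rw [smul_smul, mul_comm]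
    rfl

end Unimodular

theorem exists_adU_eq_sum_mem [ConnectedSpace G] {I : Ideal (UAlg E G)} (hI : I.IsTwoSided)
    {T : UAlg E G} (hT : T ∈ I) :
    ∃ (ι : Type) (_ : Fintype ι) (c : ι → (analyticSpace E G).carrier) (S : ι → UAlg E G),
      (∀ i, S i ∈ I) ∧ ∀ x : G, adU x T = ∑ i, (c i).1 x • S i := by
  obtain ⟨ι, _, c, S, hc, h1, -⟩ := exists_adU_eq_sum (G := G) T
  obtain ⟨p, hp⟩ := (I.restrictScalars ℂ).exists_isCompl
  let q := (I.restrictScalars ℂ).projectionOnto p hp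
  refine ⟨ι, inferInstance, fun i ↦ ⟨c i, hc i⟩, fun i ↦ (q (S i)).1, fun i ↦ (q (S i)).2, fun x ↦ ?_⟩
  have h2 : adU x T ∈ I := adU_mem_of_isTwoSided hI hT x
  have h3 : (q (adU x T)).1 = adU x T :=
    congrArg Subtype.val (Submodule.projectionOnto_apply_left hp ⟨adU x T, h2⟩)
  rw [← h3, h1, map_sum, AddSubmonoidClass.coe_finsetSum]
  exact Finset.sum_congr rfl fun i _ ↦ by rw [map_smul]; rfl

/-- A two-sided ideal kills a functional for the left regular representation if and only if it does
for the right regular representation. `N` is a space of functionals that count as zero. -/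
theorem forall_comp_rep_mem_iff [ConnectedSpace G] (D : IwasawaData E G) (hV : V.IsBimodule)
    {I : Ideal (UAlg E G)} (hI : I.IsTwoSided) {N : Submodule ℂ (V.carrier →ₗ[ℂ] ℂ)}
    (hN : ∀ u ∈ N, ∀ c, u ∘ₗ mulBy hV c ∈ N) (u : V.carrier →ₗ[ℂ] ℂ) :
    (∀ T ∈ I, u ∘ₗ V.rep T ∈ N) ↔ ∀ T ∈ I, u ∘ₗ rightRep hV (antiAut T) ∈ N := by
  constructor
  · intro h T hT
    obtain ⟨ι, _, c, S, hS, h1⟩ := exists_adU_eq_sum_mem (G := G) hI hT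
    have e : u ∘ₗ rightRep hV (antiAut T) = ∑ i, (u ∘ₗ V.rep (S i)) ∘ₗ mulBy hV (c i) := by
      refine LinearMap.ext fun φ ↦ ?_
      rw [LinearMap.comp_apply, rightRep_antiAut D hV h1, map_sum, LinearMap.sum_apply]
      rfl
    rw [e]
    exact sum_mem fun i _ ↦ hN _ (h _ (hS i)) _
  · intro h T hT
    obtain ⟨ι, _, c, S, hS, h1⟩ := exists_adU_eq_sum_mem (G := G) hI hT
    have e : u ∘ₗ V.rep T = ∑ i, (u ∘ₗ rightRep hV (antiAut (S i))) ∘ₗ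
        mulBy hV ⟨fun x ↦ (c i).1 x⁻¹, ContMDiff.comp (g := (c i).1) (c i).2
          (contMDiff_inv 𝓘(ℝ, E) ω)⟩ := by
      refine LinearMap.ext fun φ ↦ ?_
      rw [LinearMap.comp_apply, rep_eq_sum D hV (c := fun i ↦ ⟨fun x ↦ (c i).1 x⁻¹,
        ContMDiff.comp (g := (c i).1) (c i).2 (contMDiff_inv 𝓘(ℝ, E) ω)⟩) fun x ↦ h1 x⁻¹,
        map_sum, LinearMap.sum_apply]
      rfl
    rw [e]
    exact sum_mem fun i _ ↦ hN _ (h _ (hS i)) _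

/-- For functions: a two-sided ideal kills a function for the left regular representation if and
only if it does for the right regular representation. -/
theorem forall_rep_antiAut_eq_zero_iff [ConnectedSpace G] (hV : V.IsBimodule)
    {I : Ideal (UAlg E G)} (hI : I.IsTwoSided) (φ : V.carrier) :
    (∀ T ∈ I, V.rep (antiAut T) φ = 0) ↔ ∀ T ∈ I, rightRep hV T φ = 0 := by
  constructor
  · intro h T hT
    refine Subtype.ext <| funext fun x ↦ ?_
    rw [rightRep_apply, h _ (adU_mem_of_isTwoSided hI hT x)]
  · intro h T hT
    refine Subtype.ext <| funext fun x ↦ ?_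
    rw [← adU_apply_inv x T, ← rightRep_apply hV, h _ (adU_mem_of_isTwoSided hI hT x⁻¹)]

end RegularSpace

end RightRegular

/-! ### Cauchy estimates for real analytic functions -/

section Cauchy

/-- Cauchy estimates, uniform near a point: the power series of `f` at `x` is expanded again at the
points nearby. -/
theorem exists_norm_iteratedFDeriv_le {E F : Type*} [NormedAddCommGroup E] [NormedSpace ℝ E]
    [NormedAddCommGroup F] [NormedSpace ℝ F] [CompleteSpace F] {f : E → F} {x : E}
    (hf : AnalyticAt ℝ f x) : ∃ M R : ℝ, 0 ≤ M ∧ 0 < R ∧ ∀ᶠ y in 𝓝 x, ∀ n : ℕ,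
      ‖iteratedFDeriv ℝ n f y‖ ≤ M * R ^ n * n.factorial := by
  obtain ⟨p, r, hp⟩ := hf
  obtain ⟨t, ht0, ht⟩ := ENNReal.lt_iff_exists_nnreal_btwn.1 hp.r_pos
  have ht0' : 0 < t := by exact_mod_cast ht0
  set q : NNReal := t / 2 with hq
  have hq0 : 0 < q := by positivity
  have hqt : q + q = t := add_halves t
  have hrad : ((q : ENNReal) + q) < p.radius := by
    refine lt_of_lt_of_le ?_ hp.r_le
    rw [← ENNReal.coe_add, hqt]
    exact ht
  have hS := p.changeOriginSeries_summable_aux₁ hrad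
  set S := ∑' s : Σ k l : ℕ, { s : Finset (Fin (k + l)) // s.card = l },
    ‖p (s.1 + s.2.1)‖₊ * q ^ s.2.1 * q ^ s.1 with hSdef
  refine ⟨S, (q : ℝ)⁻¹, S.2, by positivity, ?_⟩
  filter_upwards [Metric.ball_mem_nhds x (show (0 : ℝ) < q from hq0)] with y hy n
  have hz : ‖y - x‖₊ < q := by
    rw [mem_ball_iff_norm] at hy
    exact_mod_cast hy
  have hzr : (‖y - x‖₊ : ENNReal) < r := by
    refine lt_of_le_of_lt ?_ ht
    exact_mod_cast hz.le.trans (hqt ▸ le_self_add)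
  have h1 := hp.changeOrigin hzr
  rw [add_sub_cancel] at h1
  have h2 : ‖iteratedFDeriv ℝ n f y‖ ≤ n.factorial * ‖p.changeOrigin (y - x) n‖ := by
    refine ContinuousMultilinearMap.opNorm_le_bound (by positivity) fun v ↦ ?_
    rw [h1.iteratedFDeriv_eq_sum_of_completeSpace]
    refine (norm_sum_le _ _).trans ?_
    have : ∀ σ ∈ (Finset.univ : Finset (Equiv.Perm (Fin n))),
        ‖p.changeOrigin (y - x) n (fun i ↦ v (σ i))‖ ≤ ‖p.changeOrigin (y - x) n‖ * ∏ i, ‖v i‖ := by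
      intro σ _
      refine (ContinuousMultilinearMap.le_opNorm _ _).trans_eq ?_
      rw [Equiv.prod_comp σ fun i ↦ ‖v i‖]
    refine (Finset.sum_le_sum this).trans_eq ?_
    rw [Finset.sum_const, Finset.card_univ, Fintype.card_perm, Fintype.card_fin, nsmul_eq_mul,
      mul_assoc]
  have h3 : ‖p.changeOrigin (y - x) n‖₊ * q ^ n ≤ S := by
    have hlt : (‖y - x‖₊ : ENNReal) < p.radius := hzr.trans_le hp.r_le
    have hs := NNReal.summable_sigma.1 hS
    have h4 := (NNReal.summable_sigma.1 hS).2.le_tsum n (fun _ _ ↦ zero_le)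
    have h5 : S = ∑' k, ∑' s : Σ l : ℕ, { s : Finset (Fin (k + l)) // s.card = l },
        ‖p (k + s.1)‖₊ * q ^ s.1 * q ^ k := by
      rw [hSdef, hS.tsum_sigma' hs.1]
    rw [h5]
    refine le_trans ?_ h4
    refine le_trans ?_ (NNReal.tsum_mul_right (fun s : Σ l : ℕ, { s : Finset (Fin (n + l)) // s.card = l } ↦
      ‖p (n + s.1)‖₊ * q ^ s.1) (q ^ n)).ge
    gcongr
    refine (p.nnnorm_changeOrigin_le n hlt).trans ?_
    have hs2 : Summable fun s : Σ l : ℕ, { s : Finset (Fin (n + l)) // s.card = l } ↦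
        ‖p (n + s.1)‖₊ * q ^ s.1 := by
      have := (hs.1 n).mul_right (q ^ n)⁻¹
      refine this.congr fun s ↦ ?_
      rw [mul_inv_cancel_right₀ (pow_ne_zero _ hq0.ne')]
    refine Summable.tsum_le_tsum (fun s ↦ ?_) ?_ hs2
    · gcongr
    · refine NNReal.summable_of_le (fun s ↦ ?_) hs2
      gcongr
  have h3' : ‖p.changeOrigin (y - x) n‖ ≤ S * (q : ℝ)⁻¹ ^ n := by
    rw [inv_pow, ← div_eq_mul_inv, le_div_iff₀ (by positivity)]
    exact_mod_cast h3
  calc _ ≤ n.factorial * ‖p.changeOrigin (y - x) n‖ := h2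
    _ ≤ n.factorial * (S * (q : ℝ)⁻¹ ^ n) := by gcongr
    _ = _ := by ring

theorem factorial_mul_factorial_le {i n : ℕ} (h : i ≤ n) (k : ℕ) :
    n.factorial * (i + 1 + k).factorial ≤ i.factorial * (n + 1 + k).factorial := by
  induction n, h using Nat.le_induction with
  | base => exact le_rfl
  | succ n _ ih =>
    rw [Nat.factorial_succ, show n + 1 + 1 + k = (n + 1 + k) + 1 by ring, Nat.factorial_succ (n + 1 + k)]
    calc _ = (n + 1) * (n.factorial * (i + 1 + k).factorial) := by ring
      _ ≤ (n + 1 + k + 1) * (i.factorial * (n + 1 + k).factorial) := by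
        gcongr
        omega
      _ = _ := by ring

/-- The step in the proof of the Cauchy estimates: one derivative along an analytic vector field
`g` costs a constant factor and raises the order of the factorial by one. -/
theorem norm_iteratedFDerivWithin_apply_le {E : Type*} [NormedAddCommGroup E] [NormedSpace ℝ E]
    {s : Set E} (hs : IsOpen s) {f : E → ℂ} {g : E → E}
    (hf : ContDiffOn ℝ ∞ f s) (hg : ContDiffOn ℝ ∞ g s) {M R a : ℝ} (hM : 0 ≤ M) (hR : 0 < R)
    (ha : 0 ≤ a) {k : ℕ}
    (h1 : ∀ j, ∀ y ∈ s, ‖iteratedFDerivWithin ℝ j f s y‖ ≤ M * R ^ j * (j + k).factorial)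
    (h2 : ∀ j, ∀ y ∈ s, ‖iteratedFDerivWithin ℝ j g s y‖ ≤ a * (R / 2) ^ j * j.factorial)
    (j : ℕ) {y : E} (hy : y ∈ s) :
    ‖iteratedFDerivWithin ℝ j (fun z ↦ fderivWithin ℝ f s z (g z)) s y‖ ≤
      M * (2 * a * R) * R ^ j * (j + (k + 1)).factorial := by
  have hu := hs.uniqueDiffOn (𝕜 := ℝ)
  refine (norm_iteratedFDerivWithin_clm_apply (N := ∞) (n := j)
    (hf.fderivWithin hu (m := ∞) (by simp)) hg hu hy (by exact_mod_cast le_top)).trans ?_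
  have hterm : ∀ i ∈ Finset.range (j + 1), (j.choose i : ℝ) *
      ‖iteratedFDerivWithin ℝ i (fderivWithin ℝ f s) s y‖ * ‖iteratedFDerivWithin ℝ (j - i) g s y‖ ≤
      M * a * R * R ^ j * (j + (k + 1)).factorial * (1 / 2) ^ (j - i) := by
    intro i hi
    have hij : i ≤ j := Nat.lt_succ_iff.1 (Finset.mem_range.1 hi)
    rw [norm_iteratedFDerivWithin_fderivWithin hu hy]
    have hfac : (j.choose i : ℝ) * (i + 1 + k).factorial * (j - i).factorial ≤
        (j + 1 + k).factorial := by
      have h3 := factorial_mul_factorial_le hij k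
      rw [← Nat.choose_mul_factorial_mul_factorial hij] at h3
      have h4 : j.choose i * (i + 1 + k).factorial * (j - i).factorial ≤ (j + 1 + k).factorial := by
        refine Nat.le_of_mul_le_mul_left ?_ (Nat.factorial_pos i)
        calc _ = j.choose i * i.factorial * (j - i).factorial * (i + 1 + k).factorial := by ring
          _ ≤ _ := h3
      exact_mod_cast h4
    calc _ ≤ (j.choose i : ℝ) * (M * R ^ (i + 1) * (i + 1 + k).factorial) *
          (a * (R / 2) ^ (j - i) * (j - i).factorial) := by
          gcongr
          · exact h1 _ _ hy
          · exact h2 _ _ hy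
      _ = M * a * R * (R ^ i * R ^ (j - i)) * (1 / 2) ^ (j - i) *
          ((j.choose i : ℝ) * (i + 1 + k).factorial * (j - i).factorial) := by
          rw [div_pow, one_div, inv_pow]
          ring
      _ ≤ M * a * R * (R ^ i * R ^ (j - i)) * (1 / 2) ^ (j - i) * (j + 1 + k).factorial := by
          gcongr
      _ = _ := by
          rw [← pow_add, Nat.add_sub_cancel' hij, show j + 1 + k = j + (k + 1) by ring]
          ring
  refine (Finset.sum_le_sum hterm).trans ?_
  rw [← Finset.mul_sum]
  have hgeo : ∑ i ∈ Finset.range (j + 1), (1 / 2 : ℝ) ^ (j - i) ≤ 2 := by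
    have := Finset.sum_range_reflect (fun i ↦ (1 / 2 : ℝ) ^ i) (j + 1)
    simp only [add_tsub_cancel_right] at this
    rw [this]
    refine (Summable.sum_le_tsum _ (fun _ _ ↦ by positivity) summable_geometric_two).trans_eq ?_
    exact tsum_geometric_two
  calc _ ≤ M * a * R * R ^ j * (j + (k + 1)).factorial * 2 := by gcongr
    _ = _ := by ring

variable {E : Type*} [NormedAddCommGroup E] [NormedSpace ℝ E] [FiniteDimensional ℝ E]
  {G : Type*} [TopologicalSpace G] [ChartedSpace E G] [Group G] [LieGroup 𝓘(ℝ, E) ω G]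

/-- Multiplication in charts near `x₀` and near the identity. -/
noncomputable def chartMul (x₀ : G) (p : E × E) : E :=
  extChartAt 𝓘(ℝ, E) x₀
    ((extChartAt 𝓘(ℝ, E) x₀).symm p.1 * (extChartAt 𝓘(ℝ, E) (1 : G)).symm p.2)

theorem contDiffAt_chartMul {x₀ : G} {y : E} (hy : y ∈ (extChartAt 𝓘(ℝ, E) x₀).target) :
    ContDiffAt ℝ ω (chartMul x₀) (y, extChartAt 𝓘(ℝ, E) (1 : G) 1) := by
  have hs := contMDiffAt_extChartAt_symm (G := G) ω hy
  have hs' := contMDiffAt_extChartAt_symm (G := G) ω (mem_extChartAt_target (I := 𝓘(ℝ, E)) (1 : G))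
  have h1 : ContMDiffAt 𝓘(ℝ, E × E) 𝓘(ℝ, E) ω (fun p : E × E ↦
      (extChartAt 𝓘(ℝ, E) x₀).symm p.1 * (extChartAt 𝓘(ℝ, E) (1 : G)).symm p.2)
      (y, extChartAt 𝓘(ℝ, E) (1 : G) 1) :=
    (hs.comp (y, extChartAt 𝓘(ℝ, E) (1 : G) 1) (contDiff_fst.contMDiff (n := ω)).contMDiffAt).mul
      (hs'.comp (y, extChartAt 𝓘(ℝ, E) (1 : G) 1) (contDiff_snd.contMDiff (n := ω)).contMDiffAt)
  have h2 : ContMDiffAt 𝓘(ℝ, E) 𝓘(ℝ, E) ω (extChartAt 𝓘(ℝ, E) x₀)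
      ((extChartAt 𝓘(ℝ, E) x₀).symm y) :=
    contMDiffAt_extChartAt' (by simpa using (extChartAt 𝓘(ℝ, E) x₀).map_target hy)
  exact (ContMDiffAt.comp_of_eq h2 h1 (by simp)).contDiffAt

/-- The left invariant vector field `X` in a chart. -/
noncomputable def chartField (x₀ : G) (X : E) (y : E) : E :=
  fderiv ℝ (chartMul x₀) (y, extChartAt 𝓘(ℝ, E) (1 : G) 1) ((0 : E), X)

theorem rightDeriv_extChartAt_symm {φ : G → ℂ} (hφ : ContMDiff 𝓘(ℝ, E) 𝓘(ℝ, ℂ) 1 φ) {x₀ : G}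
    {y : E} (hy : y ∈ (extChartAt 𝓘(ℝ, E) x₀).target) (X : LieAlg E G) :
    rightDeriv X φ ((extChartAt 𝓘(ℝ, E) x₀).symm y) =
      fderiv ℝ (φ ∘ (extChartAt 𝓘(ℝ, E) x₀).symm) y (chartField x₀ X y) := by
  set c := extChartAt 𝓘(ℝ, E) x₀
  set x := c.symm y with hx
  set e := extChartAt 𝓘(ℝ, E) (1 : G) 1
  have he : (extChartAt 𝓘(ℝ, E) (1 : G)).symm e = 1 :=
    (extChartAt 𝓘(ℝ, E) (1 : G)).left_inv (mem_extChartAt_source 1)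
  have h1 : ContMDiff 𝓘(ℝ, E) 𝓘(ℝ, ℂ) 1 (fun g ↦ φ (x * g)) := contMDiff_translate_left hφ x
  refine (dAt_one_eq_fderiv (h1.mdifferentiable one_ne_zero 1) _).trans ?_
  have h2 : HasFDerivAt (fun g ↦ chartMul x₀ (y, g))
      ((fderiv ℝ (chartMul x₀) (y, e)).comp (ContinuousLinearMap.inr ℝ E E)) e :=
    HasFDerivAt.comp (g := chartMul x₀) e
      ((contDiffAt_chartMul hy).differentiableAt (by simp)).hasFDerivAt
      (hasFDerivAt_prodMk_right y e)
  have h0 : chartMul x₀ (y, e) = y := by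
    simp only [chartMul, he, mul_one]
    exact c.right_inv hy
  have h3 : DifferentiableAt ℝ (φ ∘ c.symm) y :=
    (hφ.contMDiffAt.comp y (contMDiffAt_extChartAt_symm (G := G) 1 hy)).contDiffAt.differentiableAt
      one_ne_zero
  have h4 : HasFDerivAt ((φ ∘ c.symm) ∘ fun g ↦ chartMul x₀ (y, g)) _ e :=
    HasFDerivAt.comp (g := φ ∘ c.symm) e (h0.symm ▸ h3.hasFDerivAt) h2
  have e1 : (fun g ↦ φ (x * g)) ∘ (extChartAt 𝓘(ℝ, E) (1 : G)).symm =ᶠ[𝓝 e]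
      (φ ∘ c.symm) ∘ fun g ↦ chartMul x₀ (y, g) := by
    have hcont : ContinuousAt (fun g ↦ x * (extChartAt 𝓘(ℝ, E) (1 : G)).symm g) e :=
      (((contMDiffAt_const (c := x)).mul
        (contMDiffAt_extChartAt_symm (G := G) 1 (mem_extChartAt_target (1 : G)))).continuousAt)
    have hn : c.source ∈ 𝓝 (x * (extChartAt 𝓘(ℝ, E) (1 : G)).symm e) := by
      rw [he, mul_one]
      exact (isOpen_extChartAt_source x₀).mem_nhds (c.map_target hy)
    filter_upwards [hcont.preimage_mem_nhds hn] with g hg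
    simp only [Function.comp_apply, chartMul]
    rw [c.left_inv hg]
  rw [e1.fderiv_eq, h4.fderiv, h0]
  rfl

variable (E) in
/-- The Cauchy estimates `|L_{X₁} ⋯ L_{X_k} φ| ≤ M h^k k!` on `U`. -/
def CauchyBound (φ : G → ℂ) (U : Set G) (h M : ℝ) : Prop :=
  ∀ w : List (LieAlg E G), (∀ X ∈ w, @norm E _ X ≤ 1) → ∀ x ∈ U,
    ‖wordDeriv w φ x‖ ≤ M * h ^ w.length * w.length.factorial

theorem CauchyBound.mono {φ : G → ℂ} {U U' : Set G} {h h' M M' : ℝ} (H : CauchyBound E φ U h M)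
    (hU : U' ⊆ U) (h0 : 0 ≤ h) (hh : h ≤ h') (hM : M ≤ M') (hM0 : 0 ≤ M') : CauchyBound E φ U' h' M' :=
  fun w hw x hx ↦ (H w hw x (hU hx)).trans (by gcongr)

theorem contMDiff_wordDeriv {φ : G → ℂ} {n : ℕ∞ω} (hn : n + 1 ≤ n)
    (hφ : ContMDiff 𝓘(ℝ, E) 𝓘(ℝ, ℂ) n φ)
    (w : List (LieAlg E G)) : ContMDiff 𝓘(ℝ, E) 𝓘(ℝ, ℂ) n (wordDeriv w φ) := by
  induction w with
  | nil => exact hφ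
  | cons X w ih => exact rightDeriv_contMDiff hn X ih

theorem exists_cauchyBound_nhds {φ : G → ℂ} (hφ : ContMDiff 𝓘(ℝ, E) 𝓘(ℝ, ℂ) ω φ) (x₀ : G) :
    ∃ U : Set G, IsOpen U ∧ x₀ ∈ U ∧ ∃ h M : ℝ, 0 < h ∧ 0 ≤ M ∧ CauchyBound E φ U h M := by
  set c := extChartAt 𝓘(ℝ, E) x₀ with hc
  set e := extChartAt 𝓘(ℝ, E) (1 : G) 1
  set y₀ := c x₀ with hy0
  have hy0t : y₀ ∈ c.target := mem_extChartAt_target x₀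
  have hs : ∀ {ψ : G → ℂ} {n : ℕ∞ω}, ContMDiff 𝓘(ℝ, E) 𝓘(ℝ, ℂ) n ψ → ∀ y ∈ c.target,
      ContDiffAt ℝ n (ψ ∘ c.symm) y := fun hψ y hy ↦
    (hψ.contMDiffAt.comp y (contMDiffAt_extChartAt_symm (G := G) _ hy)).contDiffAt
  let A : E → E →L[ℝ] E := fun y ↦
    (fderiv ℝ (chartMul x₀) (y, e)).comp (ContinuousLinearMap.inr ℝ E E)
  have hA : ∀ y ∈ c.target, ContDiffAt ℝ ω A y := by
    intro y hy
    have h1 : ContDiffAt ℝ ω (fderiv ℝ (chartMul x₀)) (y, e) :=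
      (contDiffAt_chartMul hy).fderiv_right (m := ω) le_rfl
    have h2 : ContDiffAt ℝ ω (fun y : E ↦ fderiv ℝ (chartMul x₀) (y, e)) y :=
      h1.comp (f := fun y : E ↦ (y, e)) y (by fun_prop)
    exact h2.clm_comp contDiffAt_const
  obtain ⟨M, R₁, hM, hR₁, h1⟩ := exists_norm_iteratedFDeriv_le (hs hφ y₀ hy0t).analyticAt
  obtain ⟨a, R₂, ha, hR₂, h2⟩ := exists_norm_iteratedFDeriv_le (hA y₀ hy0t).analyticAt
  obtain ⟨s, hsub, hso, hys⟩ := eventually_nhds_iff.1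
    ((h1.and h2).and ((isOpen_extChartAt_target x₀).mem_nhds hy0t))
  set R := max R₁ (2 * R₂) with hR
  have hR0 : 0 < R := hR₁.trans_le (le_max_left _ _)
  have hst : s ⊆ c.target := fun y hy ↦ (hsub y hy).2
  have hAX : ∀ X : E, ‖X‖ ≤ 1 → ∀ j, ∀ y ∈ s,
      ‖iteratedFDerivWithin ℝ j (chartField x₀ X) s y‖ ≤ a * (R / 2) ^ j * j.factorial := by
    intro X hX j y hy
    have h3 : ContDiffWithinAt ℝ ω A s y := (hA y (hst hy)).contDiffWithinAt
    refine (norm_iteratedFDerivWithin_clm_apply_const (c := X) (n := j) h3 hso.uniqueDiffOn hy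
      le_top).trans ?_
    have h4 : ‖iteratedFDerivWithin ℝ j A s y‖ ≤ a * R₂ ^ j * j.factorial := by
      rw [iteratedFDerivWithin_of_isOpen j hso hy]
      exact (hsub y hy).1.2 j
    calc _ ≤ 1 * (a * R₂ ^ j * j.factorial) := by gcongr
      _ ≤ _ := by
        rw [one_mul]
        have : R₂ ≤ R / 2 := by linarith [le_max_right R₁ (2 * R₂)]
        gcongr
  have hw : ∀ w : List (LieAlg E G), (∀ X ∈ w, @norm E _ X ≤ 1) → ∀ j, ∀ y ∈ s,
      ‖iteratedFDerivWithin ℝ j (wordDeriv w φ ∘ c.symm) s y‖ ≤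
        M * (2 * a * R) ^ w.length * R ^ j * (j + w.length).factorial := by
    intro w
    induction w with
    | nil =>
      intro _ j y hy
      rw [iteratedFDerivWithin_of_isOpen j hso hy]
      refine ((hsub y hy).1.1 j).trans ?_
      simp only [List.length_nil, pow_zero, mul_one, add_zero]
      gcongr
      exact le_max_left _ _
    | cons X w ih =>
      intro hXw j y hy
      have hwc := contMDiff_wordDeriv (n := ω) le_rfl hφ w
      have e1 : EqOn (wordDeriv (X :: w) φ ∘ c.symm)
          (fun z ↦ fderivWithin ℝ (wordDeriv w φ ∘ c.symm) s z (chartField x₀ X z)) s := by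
        intro z hz
        simp only
        rw [fderivWithin_of_isOpen hso hz]
        exact rightDeriv_extChartAt_symm (hwc.of_le le_top) (hst hz) X
      rw [iteratedFDerivWithin_congr e1 hy]
      refine (norm_iteratedFDerivWithin_apply_le hso (M := M * (2 * a * R) ^ w.length) ?_ ?_
        (by positivity) hR0 ha
        (ih fun Y hY ↦ hXw Y (List.mem_cons_of_mem X hY)) (hAX X (hXw X List.mem_cons_self)) j
        hy).trans_eq ?_
      · exact fun z hz ↦ ((hs hwc z (hst hz)).of_le le_top).contDiffWithinAt
      · exact fun z hz ↦ (((hA z (hst hz)).clm_apply contDiffAt_const).of_le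
          le_top).contDiffWithinAt
      · rw [List.length_cons, pow_succ, mul_assoc M]
  refine ⟨c.source ∩ c ⁻¹' s, (continuousOn_extChartAt x₀).isOpen_inter_preimage
    (isOpen_extChartAt_source x₀) hso, ⟨mem_extChartAt_source x₀, hys⟩, 2 * a * R + 1, M,
    by positivity, hM, fun w hXw x hx ↦ ?_⟩
  have h := hw w hXw 0 (c x) hx.2
  rw [norm_iteratedFDerivWithin_zero, Function.comp_apply, c.left_inv hx.1, pow_zero, mul_one,
    zero_add] at h
  refine h.trans ?_
  gcongr
  linarith

theorem exists_cauchyBound {φ : G → ℂ} (hφ : ContMDiff 𝓘(ℝ, E) 𝓘(ℝ, ℂ) ω φ) {C : Set G}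
    (hC : IsCompact C) : ∃ U : Set G, IsOpen U ∧ C ⊆ U ∧ ∃ h M : ℝ, 0 < h ∧ 0 ≤ M ∧
      CauchyBound E φ U h M := by
  refine hC.induction_on (p := fun C ↦ ∃ U : Set G, IsOpen U ∧ C ⊆ U ∧ ∃ h M : ℝ, 0 < h ∧ 0 ≤ M ∧
      CauchyBound E φ U h M) ⟨∅, isOpen_empty, Subset.rfl, 1, 0, one_pos, le_rfl, ?_⟩ ?_ ?_ ?_
  · exact fun w _ x hx ↦ hx.elim
  · rintro s t hst ⟨U, hU, htU, h⟩
    exact ⟨U, hU, hst.trans htU, h⟩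
  · rintro s t ⟨U, hU, hsU, h, M, hh, hM, H⟩ ⟨U', hU', htU, h', M', hh', hM', H'⟩
    refine ⟨U ∪ U', hU.union hU', union_subset_union hsU htU, max h h', max M M',
      hh.trans_le (le_max_left _ _), hM.trans (le_max_left _ _), fun w hw x hx ↦ ?_⟩
    rcases hx with hx | hx
    · exact (H.mono Subset.rfl hh.le (le_max_left _ _) (le_max_left _ _)
        (hM.trans (le_max_left _ _))) w hw x hx
    · exact (H'.mono Subset.rfl hh'.le (le_max_right _ _) (le_max_right _ _)
        (hM.trans (le_max_left _ _))) w hw x hx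
  · intro x _
    obtain ⟨U, hU, hx, h⟩ := exists_cauchyBound_nhds hφ x
    exact ⟨U, mem_nhdsWithin_of_mem_nhds (hU.mem_nhds hx), U, hU, Subset.rfl, h⟩

end Cauchy

/-! ### Iterated derivatives of translates and products -/

section Words

attribute [local instance 100] LieRing.ofAssociativeRing

variable {E : Type*} [NormedAddCommGroup E] [NormedSpace ℝ E] [FiniteDimensional ℝ E]
  {G : Type*} [TopologicalSpace G] [ChartedSpace E G] [Group G] [LieGroup 𝓘(ℝ, E) ω G]
  [T2Space G]

theorem wordDeriv_append (w w' : List (LieAlg E G)) (φ : G → ℂ) :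
    wordDeriv (w ++ w') φ = wordDeriv w (wordDeriv w' φ) := List.foldr_append ..

theorem wordDeriv_smul_word (c : ℝ) {φ : G → ℂ} (hφ : ContMDiff 𝓘(ℝ, E) 𝓘(ℝ, ℂ) ∞ φ)
    (w : List (LieAlg E G)) :
    wordDeriv (w.map (c • ·)) φ = (c : ℂ) ^ w.length • wordDeriv w φ := by
  induction w with
  | nil => simp [wordDeriv]
  | cons X w ih =>
    change rightDeriv (c • X) (wordDeriv (w.map (c • ·)) φ) = _ • rightDeriv X (wordDeriv w φ)
    rw [ih, rightDeriv_smul_left, rightDeriv_smul _ _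
      ((contMDiff_wordDeriv (n := ∞) (by simp) hφ w).of_le (WithTop.coe_le_coe.2 le_top)), smul_smul,
      List.length_cons, pow_succ']

/-- Bounds for words in the unit ball extend to words in a larger ball by homogeneity. -/
theorem norm_wordDeriv_le_of_norm_le {φ : G → ℂ} (hφ : ContMDiff 𝓘(ℝ, E) 𝓘(ℝ, ℂ) ∞ φ) {k : ℕ}
    {x : G} {M A : ℝ} (hA : 0 < A)
    (hM : ∀ w : List (LieAlg E G), w.length = k → (∀ X ∈ w, @norm E _ X ≤ 1) →
      ‖wordDeriv w φ x‖ ≤ M) (w : List (LieAlg E G)) (hk : w.length = k)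
    (hw : ∀ X ∈ w, @norm E _ X ≤ A) : ‖wordDeriv w φ x‖ ≤ A ^ k * M := by
  have h1 := hM (w.map (A⁻¹ • ·)) (by simpa using hk) (by
    intro X hX
    obtain ⟨Y, hY, rfl⟩ := List.mem_map.1 hX
    refine (norm_smul_le A⁻¹ (show E from Y)).trans ?_
    rw [Real.norm_of_nonneg (by positivity), inv_mul_le_iff₀ hA, mul_one]
    exact hw Y hY)
  rw [wordDeriv_smul_word _ hφ, hk, Pi.smul_apply, norm_smul, norm_pow, Complex.norm_real, norm_inv,
    Real.norm_of_nonneg hA.le, inv_pow, inv_mul_le_iff₀ (by positivity)] at h1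
  exact h1

theorem wordDeriv_translate {φ : G → ℂ} (hφ : ContMDiff 𝓘(ℝ, E) 𝓘(ℝ, ℂ) ∞ φ) (p : G)
    (w : List (LieAlg E G)) :
    wordDeriv w (fun x ↦ φ (x * p)) =
      fun x ↦ wordDeriv (w.map (adjointAction p⁻¹)) φ (x * p) := by
  induction w with
  | nil => rfl
  | cons X w ih =>
    funext x
    change rightDeriv X (wordDeriv w _) x = rightDeriv (adjointAction p⁻¹ X) _ (x * p)
    rw [ih, rightDeriv_translate ((contMDiff_wordDeriv (n := ∞) (by simp) hφ _).of_le
      (WithTop.coe_le_coe.2 le_top))]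
    rfl

theorem wordDeriv_add {φ ψ : G → ℂ} (hφ : ContMDiff 𝓘(ℝ, E) 𝓘(ℝ, ℂ) ∞ φ)
    (hψ : ContMDiff 𝓘(ℝ, E) 𝓘(ℝ, ℂ) ∞ ψ) (w : List (LieAlg E G)) :
    wordDeriv w (φ + ψ) = wordDeriv w φ + wordDeriv w ψ := by
  induction w with
  | nil => rfl
  | cons X w ih =>
    change rightDeriv X (wordDeriv w _) = rightDeriv X (wordDeriv w _) + rightDeriv X (wordDeriv w _)
    rw [ih, rightDeriv_add X ((contMDiff_wordDeriv (n := ∞) (by simp) hφ _).of_le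
      (WithTop.coe_le_coe.2 le_top)) ((contMDiff_wordDeriv (n := ∞) (by simp) hψ _).of_le
      (WithTop.coe_le_coe.2 le_top))]

theorem CauchyBound.norm_le {φ : G → ℂ} (hφ : ContMDiff 𝓘(ℝ, E) 𝓘(ℝ, ℂ) ∞ φ) {U : Set G}
    {h M A : ℝ} (H : CauchyBound E φ U h M) (hA : 0 < A) (w : List (LieAlg E G))
    (hw : ∀ X ∈ w, @norm E _ X ≤ A) {x : G} (hx : x ∈ U) :
    ‖wordDeriv w φ x‖ ≤ M * (A * h) ^ w.length * w.length.factorial := by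
  refine (norm_wordDeriv_le_of_norm_le hφ hA (M := M * h ^ w.length * w.length.factorial)
    (fun w' h1 h2 ↦ h1 ▸ H w' h2 x hx) w rfl hw).trans_eq ?_
  rw [mul_pow]
  ring

theorem norm_wordDeriv_mul_le {c φ : G → ℂ} (hc : ContMDiff 𝓘(ℝ, E) 𝓘(ℝ, ℂ) ∞ c)
    (hφ : ContMDiff 𝓘(ℝ, E) 𝓘(ℝ, ℂ) ∞ φ) {U : Set G} {h M M' : ℝ} (hh : 0 ≤ h) (hM : 0 ≤ M)
    (hM' : 0 ≤ M') (H : CauchyBound E c U h M) (H' : CauchyBound E φ U h M') {x : G} (hx : x ∈ U)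
    (w : List (LieAlg E G)) (hw : ∀ X ∈ w, @norm E _ X ≤ 1) (a b : List (LieAlg E G))
    (ha : ∀ X ∈ a, @norm E _ X ≤ 1) (hb : ∀ X ∈ b, @norm E _ X ≤ 1) :
    ‖wordDeriv w (wordDeriv a c * wordDeriv b φ) x‖ ≤ M * M' * 2 ^ w.length *
      h ^ (a.length + b.length + w.length) * (a.length + b.length + w.length).factorial := by
  induction w using List.reverseRecOn generalizing a b with
  | nil =>
    change ‖wordDeriv a c x * wordDeriv b φ x‖ ≤ _
    rw [norm_mul]
    calc _ ≤ (M * h ^ a.length * a.length.factorial) * (M' * h ^ b.length * b.length.factorial) :=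
          mul_le_mul (H a ha x hx) (H' b hb x hx) (norm_nonneg _) (by positivity)
      _ = M * M' * h ^ (a.length + b.length) * (a.length.factorial * b.length.factorial : ℕ) := by
          push_cast
          ring
      _ ≤ M * M' * h ^ (a.length + b.length) * (a.length + b.length).factorial := by
          gcongr
          exact Nat.le_of_dvd (Nat.factorial_pos _) (Nat.factorial_mul_factorial_dvd_factorial_add _ _)
      _ = _ := by simp
  | append_singleton w X ih =>
    have hca := contMDiff_wordDeriv (E := E) (n := ∞) (by simp) hc a
    have hφb := contMDiff_wordDeriv (E := E) (n := ∞) (by simp) hφ b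
    have hcX := contMDiff_wordDeriv (E := E) (n := ∞) (by simp) hc (X :: a)
    have hφX := contMDiff_wordDeriv (E := E) (n := ∞) (by simp) hφ (X :: b)
    have hX : @norm E _ X ≤ 1 := hw X (by simp)
    have e : wordDeriv [X] (wordDeriv a c * wordDeriv b φ) =
        wordDeriv (X :: a) c * wordDeriv b φ + wordDeriv a c * wordDeriv (X :: b) φ :=
      rightDeriv_mul X (hca.of_le (WithTop.coe_le_coe.2 le_top))
        (hφb.of_le (WithTop.coe_le_coe.2 le_top))
    rw [wordDeriv_append, e, wordDeriv_add (contMDiff_fun_mul hcX hφb) (contMDiff_fun_mul hca hφX)]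
    have hw' : ∀ Y ∈ w, @norm E _ Y ≤ 1 := fun Y hY ↦ hw Y (by simp [hY])
    have h1 := ih hw' (X :: a) b (by simpa using ⟨hX, ha⟩) hb
    have h2 := ih hw' a (X :: b) ha (by simpa using ⟨hX, hb⟩)
    rw [List.length_cons, show a.length + 1 + b.length + w.length =
      a.length + b.length + (w.length + 1) by ring] at h1
    rw [List.length_cons, show a.length + (b.length + 1) + w.length =
      a.length + b.length + (w.length + 1) by ring] at h2
    rw [List.length_append, List.length_singleton, pow_succ 2]
    refine (norm_add_le _ _).trans ((add_le_add h1 h2).trans_eq ?_)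
    ring

theorem CauchyBound.mul {c φ : G → ℂ} (hc : ContMDiff 𝓘(ℝ, E) 𝓘(ℝ, ℂ) ∞ c)
    (hφ : ContMDiff 𝓘(ℝ, E) 𝓘(ℝ, ℂ) ∞ φ) {U : Set G} {h M M' : ℝ} (hh : 0 ≤ h) (hM : 0 ≤ M)
    (hM' : 0 ≤ M') (H : CauchyBound E c U h M) (H' : CauchyBound E φ U h M') :
    CauchyBound E (c * φ) U (2 * h) (M * M') := by
  intro w hw x hx
  refine (norm_wordDeriv_mul_le hc hφ hh hM hM' H H' hx w hw [] [] (by simp) (by simp)).trans_eq ?_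
  simp only [List.length_nil, zero_add]
  rw [mul_pow]
  ring

theorem CauchyBound.rightDeriv {φ : G → ℂ} (hφ : ContMDiff 𝓘(ℝ, E) 𝓘(ℝ, ℂ) ∞ φ) {U : Set G}
    {h M A : ℝ} (hh : 0 ≤ h) (hM : 0 ≤ M) (H : CauchyBound E φ U h M) (hA : 1 ≤ A) (X : LieAlg E G)
    (hX : @norm E _ X ≤ A) : CauchyBound E (rightDeriv X φ) U (2 * (A * h)) (A * h * M) := by
  intro w hw x hx
  have h1 := H.norm_le hφ (zero_lt_one.trans_le hA) (w ++ [X]) (by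
    intro Y hY
    rcases List.mem_append.1 hY with hY | hY
    · exact (hw Y hY).trans hA
    · rw [List.mem_singleton.1 hY]
      exact hX) hx
  rw [wordDeriv_append, List.length_append, List.length_singleton] at h1
  refine h1.trans ?_
  have h2 : ((w.length + 1 : ℕ) : ℝ) ≤ 2 ^ w.length := by
    exact_mod_cast Nat.lt_two_pow_self
  rw [Nat.factorial_succ, mul_pow 2, pow_succ (A * h)]
  push_cast at h2 ⊢
  calc _ = A * h * M * ((w.length + 1) * (A * h) ^ w.length) * w.length.factorial := by ring
    _ ≤ _ := by gcongr

theorem CauchyBound.translate {φ : G → ℂ} (hφ : ContMDiff 𝓘(ℝ, E) 𝓘(ℝ, ℂ) ∞ φ) {U U' : Set G}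
    {h M A : ℝ} (H : CauchyBound E φ U h M) (hA : 0 < A) {p : G}
    (hp : ∀ X : LieAlg E G, @norm E _ (adjointAction p⁻¹ X) ≤ A * @norm E _ X)
    (hU : ∀ x ∈ U', x * p ∈ U) : CauchyBound E (fun x ↦ φ (x * p)) U' (A * h) M := by
  intro w hw x hx
  rw [wordDeriv_translate hφ]
  refine (H.norm_le hφ hA _ ?_ (hU x hx)).trans_eq (by simp)
  intro X hX
  obtain ⟨Y, hY, rfl⟩ := List.mem_map.1 hX
  exact (hp Y).trans (mul_le_of_le_one_right hA.le (hw Y hY))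

theorem continuous_adjointAction (X : LieAlg E G) :
    Continuous (fun x : G ↦ (show E from adjointAction x X)) := by
  let b := Module.finBasis ℝ E
  have e : (fun x : G ↦ (show E from adjointAction x X)) =
      fun x ↦ ∑ k, ((Complex.ofRealCLM ∘L LinearMap.toContinuousLinearMap (b.coord k))
        (show E from adjointAction x X)).re • b k := by
    funext x
    exact (b.sum_repr (show E from adjointAction x X)).symm
  rw [e]
  refine continuous_finsetSum _ fun k _ ↦ Continuous.smul ?_ continuous_const
  exact Complex.continuous_re.comp (contMDiff_adjointAction _ X).continuous

theorem exists_norm_adjointAction_le {C : Set G} (hC : IsCompact C) :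
    ∃ A : ℝ, 1 ≤ A ∧ ∀ p ∈ C, ∀ X : LieAlg E G, @norm E _ (adjointAction p X) ≤ A * @norm E _ X := by
  let b := Module.finBasis ℝ E
  have h1 : ∀ k, ∃ B : ℝ, ∀ p ∈ C, ‖(show E from adjointAction p (show LieAlg E G from b k))‖ ≤ B := fun k ↦
    hC.exists_bound_of_continuousOn (continuous_adjointAction (G := G) (b k)).continuousOn
  choose B hB using h1
  let c := fun k ↦ ‖LinearMap.toContinuousLinearMap (b.coord k)‖
  refine ⟨max 1 (∑ k, c k * B k), le_max_left _ _, fun p hp X ↦ ?_⟩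
  let ad : LieAlg E G →ₗ[ℝ] LieAlg E G :=
    { toFun := adjointAction p
      map_add' := fun X Y ↦ adjointAction_add p X Y
      map_smul' := fun r X ↦ adjointAction_smul p r X }
  have e : adjointAction p X = ∑ k, b.coord k X • adjointAction p (b k) := by
    have h2 : X = ∑ k, b.coord k X • (show LieAlg E G from b k) := (b.sum_repr (show E from X)).symm
    change ad X = ∑ k, b.coord k X • ad (b k)
    conv_lhs => rw [h2]
    rw [map_sum]
    exact Finset.sum_congr rfl fun k _ ↦ map_smul ad _ _
  have h3 : @norm E _ (adjointAction p X) ≤ ∑ k, c k * B k * @norm E _ X := by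
    rw [e]
    refine (norm_sum_le (E := E) _ _).trans (Finset.sum_le_sum fun k _ ↦ ?_)
    refine (norm_smul_le (b.coord k X) (show E from adjointAction p (show LieAlg E G from b k))).trans ?_
    have h4 : ‖b.coord k X‖ ≤ c k * @norm E _ X :=
      (LinearMap.toContinuousLinearMap (b.coord k)).le_opNorm X
    calc _ ≤ c k * @norm E _ X * B k := mul_le_mul h4 (hB k p hp) (norm_nonneg _)
          (mul_nonneg (norm_nonneg _) (norm_nonneg (show E from X)))
      _ = _ := by ring
  rw [← Finset.sum_mul] at h3
  exact h3.trans (mul_le_mul_of_nonneg_right (le_max_right _ _) (norm_nonneg (show E from X)))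

end Words

/-! ### Functionals along one-parameter subgroups -/

section Along

attribute [local instance 100] LieRing.ofAssociativeRing

variable {E : Type*} [NormedAddCommGroup E] [NormedSpace ℝ E] [FiniteDimensional ℝ E]
  {G : Type*} [TopologicalSpace G] [ChartedSpace E G] [Group G] [LieGroup 𝓘(ℝ, E) ω G]
  [T2Space G]

namespace RegularSpace

variable {V : RegularSpace E G}

theorem translate_apply (p : G) (φ : V.carrier) (x : G) : (V.translate p φ).1 x = φ.1 (x * p) := rfl

theorem translate_mul (p q : G) (φ : V.carrier) :
    V.translate (p * q) φ = V.translate p (V.translate q φ) :=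
  Subtype.ext <| funext fun x ↦ by simp only [translate_apply, mul_assoc]

theorem translate_one (φ : V.carrier) : V.translate 1 φ = φ :=
  Subtype.ext <| funext fun x ↦ by simp only [translate_apply, mul_one]

theorem rep_translate (T : UAlg E G) (p : G) (φ : V.carrier) :
    V.rep T (V.translate p φ) = V.translate p (V.rep T φ) := by
  induction T using uAlg_induction generalizing φ with
  | hc c => rw [AlgHom.commutes, Module.algebraMap_end_apply, Module.algebraMap_end_apply, map_smul]
  | hX X =>
    refine Subtype.ext ?_
    rw [rep_toU]
    funext x
    rw [translate_apply, rep_toU]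
    simp only [leftDeriv, translate_apply, mul_assoc]
  | hadd S T hS hT => simp only [map_add, LinearMap.add_apply, hS, hT]
  | hmul S T hS hT => simp only [map_mul, Module.End.mul_apply, hS, hT]

theorem wordDeriv_eq_rightRep (hV : V.IsBimodule) (w : List (LieAlg E G)) (φ : V.carrier) :
    wordDeriv w φ.1 = (rightRep hV (w.map toU).prod φ).1 := by
  induction w with
  | nil => simp [wordDeriv]
  | cons X w ih =>
    rw [List.map_cons, List.prod_cons, map_mul, Module.End.mul_apply, rightRep_toU, ← ih]
    rfl

theorem hasDerivAt_rightRep_translate (hV : V.IsBimodule) (T : UAlg E G) (X : LieAlg E G)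
    (φ : V.carrier) (x : G) (t : ℝ) :
    HasDerivAt (fun t : ℝ ↦ (rightRep hV T (V.translate (lieExp (t • X)) φ)).1 x)
      ((rightRep hV T (V.translate (lieExp (t • X)) (rightRep hV (toU X) φ))).1 x) t := by
  simp only [rightRep_apply, rep_translate]
  have h := hasDerivAt_mul_lieExp (contMDiff_one (V.rep (antiAut (adU x T)) φ)) X x t
  rw [← Module.End.mul_apply (V.rep _) (rightRep hV _), ← rightRep_mul_rep, Module.End.mul_apply]
  simp only [translate_apply]
  rw [rightRep_toU]
  exact h

theorem rightRep_toU_translate (hV : V.IsBimodule) (X : LieAlg E G) (t : ℝ) (φ : V.carrier) :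
    rightRep hV (toU X) (V.translate (lieExp (t • X)) φ) =
      V.translate (lieExp (t • X)) (rightRep hV (toU X) φ) := by
  refine Subtype.ext <| funext fun x ↦ ?_
  rw [rightRep_toU, translate_apply, rightRep_toU]
  refine rightDeriv_eq_of_hasDerivAt (contMDiff_one _) ?_
  have h1 := hasDerivAt_mul_lieExp (contMDiff_one φ) X x t
  have e : (fun s : ℝ ↦ (V.translate (lieExp (t • X)) φ).1 (x * lieExp (s • X))) =
      fun s ↦ φ.1 (x * lieExp ((s + t) • X)) := by
    funext s
    rw [translate_apply, lieExp_add_smul, mul_assoc]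
  rw [e]
  exact HasDerivAt.comp_add_const (f := fun t : ℝ ↦ φ.1 (x * lieExp (t • X))) 0 t (by rwa [zero_add])

end RegularSpace
end Along

section Along

attribute [local instance 100] LieRing.ofAssociativeRing

variable {E : Type*} [NormedAddCommGroup E] [NormedSpace ℝ E] [FiniteDimensional ℝ E]
  {G : Type*} [TopologicalSpace G] [ChartedSpace E G] [Group G] [LieGroup 𝓘(ℝ, E) ω G]
  [T2Space G]

theorem norm_sub_sub_smul_le {g g' g'' : ℝ → ℂ} {t B : ℝ}
    (h1 : ∀ s, HasDerivAt g (g' s) s) (h2 : ∀ s, HasDerivAt g' (g'' s) s)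
    (hB : ∀ s, |s| ≤ |t| → ‖g'' s‖ ≤ B) : ‖g t - g 0 - t * g' 0‖ ≤ B * t ^ 2 := by
  have hc : Convex ℝ (Metric.closedBall (0 : ℝ) |t|) := convex_closedBall _ _
  have hm : ∀ s, s ∈ Metric.closedBall (0 : ℝ) |t| ↔ |s| ≤ |t| := fun s ↦ by simp
  have h0 : (0 : ℝ) ∈ Metric.closedBall (0 : ℝ) |t| := by simp
  have ht : t ∈ Metric.closedBall (0 : ℝ) |t| := by simp
  have hB0 : 0 ≤ B := (norm_nonneg _).trans (hB t le_rfl)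
  have h3 : ∀ s, |s| ≤ |t| → ‖g' s - g' 0‖ ≤ B * |t| := by
    intro s hs
    have h := hc.norm_image_sub_le_of_norm_hasDerivWithin_le (f := g') (f' := g'') (C := B)
      (fun x _ ↦ (h2 x).hasDerivWithinAt) (fun x hx ↦ hB x ((hm x).1 hx)) h0 ((hm s).2 hs)
    rw [sub_zero, Real.norm_eq_abs] at h
    exact h.trans (by gcongr)
  have h4 : ∀ s : ℝ, HasDerivAt (fun s : ℝ ↦ g s - s * g' 0) (g' s - g' 0) s := by
    intro s
    have h5 : HasDerivAt (fun s : ℝ ↦ (s : ℂ) * g' 0) (1 * g' 0) s :=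
      HasDerivAt.mul_const (Complex.ofRealCLM.hasDerivAt) _
    rw [one_mul] at h5
    exact (h1 s).sub h5
  have h := hc.norm_image_sub_le_of_norm_hasDerivWithin_le (C := B * |t|)
    (fun x _ ↦ (h4 x).hasDerivWithinAt) (fun x hx ↦ h3 x ((hm x).1 hx)) h0 ht
  rw [sub_zero, Real.norm_eq_abs, mul_assoc, ← sq, sq_abs] at h
  refine le_trans (le_of_eq ?_) h
  congr 1
  push_cast
  ring

theorem hasDerivAt_zero_of_norm_le {q : ℝ → ℂ} {c : ℂ} {δ B : ℝ} (hδ : 0 < δ)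
    (h : ∀ t, |t| ≤ δ → ‖q t - q 0 - t * c‖ ≤ B * t ^ 2) : HasDerivAt q c 0 := by
  rw [hasDerivAt_iff_isLittleO]
  have h1 : (fun t : ℝ ↦ q t - q 0 - (t - 0) • c) =O[𝓝 0] fun t : ℝ ↦ t ^ 2 := by
    refine Asymptotics.IsBigO.of_bound B ?_
    filter_upwards [Metric.closedBall_mem_nhds (0 : ℝ) hδ] with t ht
    rw [sub_zero, Complex.real_smul, Real.norm_of_nonneg (sq_nonneg t)]
    exact h t (by simpa using ht)
  refine h1.trans_isLittleO ?_
  simpa using Asymptotics.isLittleO_pow_id (𝕜 := ℝ) one_lt_two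

namespace RegularSpace

variable {V : RegularSpace E G} (hV : V.IsBimodule)

theorem norm_wordDeriv_taylor_le (X : LieAlg E G) (φ : V.carrier) (w : List (LieAlg E G)) (x : G)
    {t B : ℝ} (hB : ∀ s, |s| ≤ |t| → ‖wordDeriv w (V.translate (lieExp (s • X))
      (rightRep hV (toU X) (rightRep hV (toU X) φ))).1 x‖ ≤ B) :
    ‖wordDeriv w (V.translate (lieExp (t • X)) φ - φ - (t : ℂ) • rightRep hV (toU X) φ).1 x‖ ≤
      B * t ^ 2 := by
  simp only [wordDeriv_eq_rightRep hV] at hB ⊢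
  have h := norm_sub_sub_smul_le (fun s ↦ hasDerivAt_rightRep_translate hV (w.map toU).prod X φ x s)
    (fun s ↦ hasDerivAt_rightRep_translate hV (w.map toU).prod X (rightRep hV (toU X) φ) x s) hB
  simp only [zero_smul, lieExp_zero, translate_one] at h
  rw [map_sub, map_sub, map_smul]
  exact h

/-- The functional `u` is differentiable along one-parameter groups of right translations. -/
def IsDifferentiable (u : V.carrier →ₗ[ℂ] ℂ) : Prop :=
  ∀ (X : LieAlg E G) (φ : V.carrier) (t : ℝ),
    HasDerivAt (fun t : ℝ ↦ u (V.translate (lieExp (t • X)) φ))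
      (u (V.translate (lieExp (t • X)) (rightRep hV (toU X) φ))) t

theorem isDifferentiable_of_norm_le {u : V.carrier →ₗ[ℂ] ℂ}
    (h : ∀ (X : LieAlg E G) (φ : V.carrier), ∃ δ B : ℝ, 0 < δ ∧ ∀ t : ℝ, |t| ≤ δ →
      ‖u (V.translate (lieExp (t • X)) φ - φ - (t : ℂ) • rightRep hV (toU X) φ)‖ ≤ B * t ^ 2) :
    IsDifferentiable hV u := by
  intro X φ t
  obtain ⟨δ, B, hδ, hb⟩ := h X (V.translate (lieExp (t • X)) φ)
  have h1 : HasDerivAt (fun s : ℝ ↦ u (V.translate (lieExp (s • X))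
      (V.translate (lieExp (t • X)) φ))) (u (rightRep hV (toU X) (V.translate (lieExp (t • X)) φ)))
      0 := by
    refine hasDerivAt_zero_of_norm_le (B := B) hδ fun s hs ↦ ?_
    simpa only [map_sub, map_smul, zero_smul, lieExp_zero, translate_one, smul_eq_mul] using hb s hs
  rw [rightRep_toU_translate] at h1
  simp only [← translate_mul, ← lieExp_add_smul] at h1
  have h2 := HasDerivAt.comp_sub_const (f := fun s : ℝ ↦ u (V.translate (lieExp ((s + t) • X)) φ))
    t t (by rwa [sub_self])
  simpa using h2

end RegularSpace

open DegSeries.RegularSpace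

theorem continuous_mul_lieExp (X : LieAlg E G) :
    Continuous fun p : G × ℝ ↦ p.1 * lieExp (p.2 • X) := by
  have : ContinuousMul G := (topologicalGroup_of_lieGroup 𝓘(ℝ, E) ω (G := G)).toContinuousMul
  exact continuous_fst.mul ((continuous_lieExp_smul (G := G) X).comp continuous_snd)

theorem exists_norm_adjointAction_lieExp_le (X : LieAlg E G) (r : ℝ) :
    ∃ A : ℝ, 1 ≤ A ∧ @norm E _ X ≤ A ∧ ∀ t : ℝ, |t| ≤ r → ∀ Y : LieAlg E G,
      @norm E _ (adjointAction (lieExp (t • X) : G)⁻¹ Y) ≤ A * @norm E _ Y := by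
  have hc : IsCompact ((fun t : ℝ ↦ (lieExp (t • X) : G)) '' Icc (-r) r) :=
    isCompact_Icc.image (continuous_lieExp_smul (G := G) X)
  obtain ⟨A, hA, h⟩ := exists_norm_adjointAction_le (E := E) hc
  refine ⟨max A (@norm E _ X), hA.trans (le_max_left _ _), le_max_right _ _, fun t ht Y ↦ ?_⟩
  have h1 := abs_le.1 ht
  refine (h _ ⟨-t, ⟨by linarith, by linarith⟩, ?_⟩ Y).trans
    (mul_le_mul_of_nonneg_right (le_max_left _ _) (norm_nonneg (show E from Y)))
  exact lieExp_neg_smul X t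

theorem exists_norm_wordDeriv_le (φ : (testSpace E G).carrier) (k : ℕ) :
    ∃ M : ℝ, 0 ≤ M ∧ ∀ w : List (LieAlg E G), w.length = k → (∀ X ∈ w, @norm E _ X ≤ 1) → ∀ x,
      ‖wordDeriv w φ.1 x‖ ≤ M := by
  have hV := testSpace_isBimodule (E := E) (G := G)
  induction k generalizing φ with
  | zero =>
    obtain ⟨M, hM⟩ := φ.2.2.exists_bound_of_continuous φ.2.1.continuous
    refine ⟨M, (norm_nonneg _).trans (hM 1), fun w hw _ x ↦ ?_⟩
    rw [List.length_eq_zero_iff.1 hw]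
    exact hM x
  | succ k ih =>
    let b := Module.finBasis ℝ (LieAlg E G)
    choose M hM h using fun i ↦ ih (rightRep hV (toU (b i)) φ)
    let c := fun i ↦ ‖LinearMap.toContinuousLinearMap (show E →ₗ[ℝ] ℝ from b.coord i)‖
    refine ⟨∑ i, c i * M i, Finset.sum_nonneg fun i _ ↦ mul_nonneg (norm_nonneg _) (hM i),
      fun w hw hX x ↦ ?_⟩
    rcases List.eq_nil_or_concat w with rfl | ⟨w, Y, rfl⟩
    · simp at hw
    · have hY : @norm E _ Y ≤ 1 := hX Y (by simp)
      have hc : ∀ i, ‖b.coord i Y‖ ≤ c i := fun i ↦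
        ((LinearMap.toContinuousLinearMap (show E →ₗ[ℝ] ℝ from b.coord i)).le_opNorm Y).trans
          (mul_le_of_le_one_right (norm_nonneg _) hY)
      have hYe : toU Y = ∑ i, (b.coord i Y : ℂ) • toU (b i) := by
        conv_lhs => rw [← b.sum_repr Y]
        rw [toU_sum]
        rfl
      have e : wordDeriv (w ++ [Y]) φ.1 x =
          ∑ i, (b.coord i Y : ℂ) * wordDeriv w (rightRep hV (toU (b i)) φ).1 x := by
        rw [wordDeriv_append, show wordDeriv [Y] φ.1 = (rightRep hV (toU Y) φ).1 from
          (rightRep_toU hV Y φ).symm, wordDeriv_eq_rightRep hV, hYe]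
        simp only [map_sum, map_smul, LinearMap.sum_apply, LinearMap.smul_apply, RegularSpace.sum_apply,
          Submodule.coe_smul, Pi.smul_apply, smul_eq_mul, wordDeriv_eq_rightRep hV]
      rw [List.concat_eq_append, e]
      refine (norm_sum_le _ _).trans (Finset.sum_le_sum fun i _ ↦ ?_)
      rw [norm_mul, Complex.norm_real]
      refine mul_le_mul (hc i) (h i w (by simpa using hw) (fun Z hZ ↦ hX Z (by simp [hZ])) x)
        (norm_nonneg _) (norm_nonneg _)

/-- A distribution may be differentiated under the pairing: by Taylor's formula the difference
quotients of a test function converge together with all derivatives, in a fixed compact support. -/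
theorem IsDistribution.isDifferentiable {T : (testSpace E G).carrier →ₗ[ℂ] ℂ}
    (hT : IsDistribution T) : IsDifferentiable testSpace_isBimodule T := by
  have hV := testSpace_isBimodule (E := E) (G := G)
  refine isDifferentiable_of_norm_le _ fun X φ ↦ ?_
  have hcm : ContinuousMul G := (topologicalGroup_of_lieGroup 𝓘(ℝ, E) ω (G := G)).toContinuousMul
  set C : Set G := (fun p : G × ℝ ↦ p.1 * lieExp (p.2 • X)) '' (tsupport φ.1 ×ˢ Icc (-1) 1) with hCdef
  have hφc : IsCompact (tsupport φ.1) := φ.2.2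
  have hC : IsCompact C := (hφc.prod isCompact_Icc).image (continuous_mul_lieExp X)
  obtain ⟨S, c, hS⟩ := hT C hC
  set ψ := rightRep hV (toU X) (rightRep hV (toU X) φ) with hψ
  obtain ⟨A, hA, -, hAd⟩ := exists_norm_adjointAction_lieExp_le (G := G) X 1
  choose M hM0 hM using exists_norm_wordDeriv_le ψ
  let N : List (LieAlg E G) → ℝ := fun w ↦ (w.map fun Y ↦ max 1 (A * @norm E _ Y)).sum + 1
  have hN : ∀ w : List (LieAlg E G), 0 < N w := fun w ↦ by
    have : 0 ≤ (w.map fun Y ↦ max 1 (A * @norm E _ Y)).sum := List.sum_nonneg (by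
      intro r hr
      obtain ⟨Y, _, rfl⟩ := List.mem_map.1 hr
      exact zero_le_one.trans (le_max_left _ _))
    linarith
  have hNle : ∀ w : List (LieAlg E G), ∀ Y ∈ w, A * @norm E _ Y ≤ N w := fun w Y hY ↦ by
    have : max 1 (A * @norm E _ Y) ≤ (w.map fun Y ↦ max 1 (A * @norm E _ Y)).sum :=
      List.single_le_sum (by
        intro r hr
        obtain ⟨Y, _, rfl⟩ := List.mem_map.1 hr
        exact zero_le_one.trans (le_max_left _ _)) _ (List.mem_map.2 ⟨Y, hY, rfl⟩)
    linarith [le_max_right 1 (A * @norm E _ Y)]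
  let B : List (LieAlg E G) → ℝ := fun w ↦ N w ^ w.length * M w.length
  have hB0 : ∀ w, 0 ≤ B w := fun w ↦ mul_nonneg (pow_nonneg (hN w).le _) (hM0 _)
  have hψs : ContMDiff 𝓘(ℝ, E) 𝓘(ℝ, ℂ) ∞ ψ.1 := ψ.2.1
  have hsec : ∀ (w : List (LieAlg E G)) (x : G) (s : ℝ), |s| ≤ 1 →
      ‖wordDeriv w ((testSpace E G).translate (lieExp (s • X)) ψ).1 x‖ ≤ B w := by
    intro w x s hs
    have h := congrFun (wordDeriv_translate hψs (lieExp (s • X)) w) x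
    refine (congrArg norm h).trans_le ?_
    refine norm_wordDeriv_le_of_norm_le hψs (hN w) (fun w' h1 h2 ↦ hM w.length w' h1 h2 _) _
      (by simp) fun Y hY ↦ ?_
    obtain ⟨Z, hZ, rfl⟩ := List.mem_map.1 hY
    exact (hAd s hs Z).trans (hNle w Z hZ)
  refine ⟨1, c * ∑ w ∈ S, B w, one_pos, fun t ht ↦ ?_⟩
  refine (hS _ ?_ ((∑ w ∈ S, B w) * t ^ 2)
    (mul_nonneg (Finset.sum_nonneg fun w _ ↦ hB0 w) (sq_nonneg t)) fun w hw x ↦ ?_).trans_eq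
    (mul_assoc _ _ _).symm
  · have hφC : ∀ s : ℝ, |s| ≤ 1 → tsupport (fun x ↦ φ.1 (x * lieExp (s • X))) ⊆ C := by
      intro s hs
      refine closure_minimal (fun x hx ↦ ?_) hC.isClosed
      refine ⟨(x * lieExp (s • X), -s), ⟨subset_tsupport _ hx, abs_le.1 (by rwa [abs_neg])⟩, ?_⟩
      simp only
      rw [lieExp_neg_smul, mul_inv_cancel_right]
    have hφC' : tsupport φ.1 ⊆ C := by simpa [lieExp_zero] using hφC 0 (by simp)
    have h3 : tsupport (rightRep hV (toU X) φ).1 ⊆ C := by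
      refine closure_minimal (fun x hx ↦ ?_) hC.isClosed
      apply hφC'
      by_contra hn
      apply hx
      have h1 : φ.1 =ᶠ[𝓝 x] 0 := notMem_tsupport_iff_eventuallyEq.1 hn
      rw [rightRep_toU, rightDeriv_eq X (contMDiff_one φ)]
      have h2 : (dAt φ.1 x : TangentSpace 𝓘(ℝ, E) x →L[ℝ] ℂ) = 0 := (dAt_congr h1).trans mfderiv_const
      rw [h2]
      rfl
    refine closure_minimal (fun x hx ↦ ?_) hC.isClosed
    by_contra hn
    apply hx
    have z1 : φ.1 (x * lieExp (t • X)) = 0 := by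
      by_contra h
      exact hn (hφC t ht (subset_tsupport _ h))
    have z2 : φ.1 x = 0 := by
      by_contra h
      exact hn (hφC' (subset_tsupport _ h))
    have z3 : (rightRep hV (toU X) φ).1 x = 0 := by
      by_contra h
      exact hn (h3 (subset_tsupport _ h))
    change φ.1 (x * lieExp (t • X)) - φ.1 x - (t : ℂ) * (rightRep hV (toU X) φ).1 x = 0
    rw [z1, z2, z3]
    simp
  · refine (norm_wordDeriv_taylor_le hV X φ w x (B := B w) fun s hs ↦
      hsec w x s (hs.trans ht)).trans ?_
    gcongr
    exact Finset.single_le_sum (fun w _ ↦ hB0 w) hw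

theorem factorial_add_two_le (k : ℕ) : ((k + 2).factorial : ℝ) ≤ 2 * 4 ^ k * k.factorial := by
  have h : (k + 2) * (k + 1) ≤ 2 * 4 ^ k := by
    induction k with
    | zero => norm_num
    | succ k ih =>
      rw [pow_succ]
      nlinarith
  rw [Nat.factorial_succ, Nat.factorial_succ, ← mul_assoc]
  have h' : (((k + 2) * (k + 1) : ℕ) : ℝ) ≤ 2 * 4 ^ k := by exact_mod_cast h
  push_cast at h' ⊢
  have h'' : ((k : ℝ) + 1 + 1) * (k + 1) ≤ 2 * 4 ^ k := by linarith
  gcongr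

/-- A neighbourhood of a compact set that is moved inside a given neighbourhood by all elements of
a compact piece of a one-parameter group. -/
theorem exists_isOpen_mul_lieExp_subset {C U : Set G} (hC : IsCompact C) (hU : IsOpen U)
    {K : Set ℝ} (hK : IsCompact K) (X : LieAlg E G) (h : ∀ x ∈ C, ∀ s ∈ K, x * lieExp (s • X) ∈ U) :
    ∃ U' : Set G, IsOpen U' ∧ C ⊆ U' ∧ ∃ W, IsOpen W ∧ K ⊆ W ∧
      ∀ x ∈ U', ∀ s ∈ W, x * lieExp (s • X) ∈ U := by
  obtain ⟨u, v, hu, hv, hCu, hKv, huv⟩ := generalized_tube_lemma hC hK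
    (hU.preimage (continuous_mul_lieExp X)) (fun p hp ↦ h p.1 hp.1 p.2 hp.2)
  exact ⟨u, hu, hCu, v, hv, hKv, fun x hx s hs ↦ huv (Set.mk_mem_prod hx hs)⟩

/-- The same for an analytic functional, whose bound involves the derivatives on a neighbourhood of
its carrier only. -/
theorem IsCarriedBy.isDifferentiable {u : (analyticSpace E G).carrier →ₗ[ℂ] ℂ} {C : Set G}
    (hC : IsCompact C) (hu : IsCarriedBy u C) : IsDifferentiable analyticSpace_isBimodule u := by
  have hV := analyticSpace_isBimodule (E := E) (G := G)
  refine isDifferentiable_of_norm_le _ fun X φ ↦ ?_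
  obtain ⟨U, hU, hCU, h, M, hh, hM, H⟩ := exists_cauchyBound φ.2 hC
  obtain ⟨U', hU', hCU', W, hW, h0W, hmul⟩ := exists_isOpen_mul_lieExp_subset hC hU
    (K := {0}) isCompact_singleton X (by
      rintro x hx s rfl
      rw [zero_smul, lieExp_zero, mul_one]
      exact hCU hx)
  obtain ⟨A, hA, hXA, hAd⟩ := exists_norm_adjointAction_lieExp_le (G := G) X 1
  obtain ⟨δ, hδ, hδW⟩ := Metric.isOpen_iff.1 hW 0 (h0W rfl)
  have hφs : ContMDiff 𝓘(ℝ, E) 𝓘(ℝ, ℂ) ∞ φ.1 := φ.2.of_le le_top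
  have hA0 : 0 < A := zero_lt_one.trans_le hA
  obtain ⟨c, hc⟩ := hu U' hU' hCU' (4 * (A * h)) (by positivity)
  refine ⟨min 1 (δ / 2), c * (2 * M * (A * h) ^ 2), by positivity, fun t ht ↦ ?_⟩
  have ht1 : |t| ≤ 1 := ht.trans (min_le_left _ _)
  have htδ : |t| ≤ δ / 2 := ht.trans (min_le_right _ _)
  refine (hc _ (2 * M * (A * h) ^ 2 * t ^ 2) (by positivity) fun w hw x hx ↦ ?_).trans_eq
    (mul_assoc _ _ _).symm
  refine (norm_wordDeriv_taylor_le hV X φ w x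
    (B := 2 * M * (A * h) ^ 2 * (4 * (A * h)) ^ w.length * w.length.factorial)
    fun s hs ↦ ?_).trans_eq (by ring)
  have e : wordDeriv w ((analyticSpace E G).translate (lieExp (s • X))
      (rightRep hV (toU X) (rightRep hV (toU X) φ))).1 x =
      wordDeriv (w.map (adjointAction (lieExp (s • X) : G)⁻¹) ++ [X, X]) φ.1 (x * lieExp (s • X)) := by
    rw [wordDeriv_append]
    refine (congrFun (wordDeriv_translate ?_ (lieExp (s • X)) w) x).trans ?_
    · exact (rightRep hV (toU X) (rightRep hV (toU X) φ)).2.of_le le_top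
    · simp only [rightRep_toU]
      rfl
  rw [e]
  refine (H.norm_le hφs hA0 _ ?_ (hmul x hx s (hδW ?_))).trans ?_
  · intro Y hY
    rcases List.mem_append.1 hY with hY | hY
    · obtain ⟨Z, hZ, rfl⟩ := List.mem_map.1 hY
      exact (hAd s (hs.trans ht1) Z).trans (mul_le_of_le_one_right hA0.le (hw Z hZ))
    · have : Y = X := by simpa using hY
      rw [this]
      exact hXA
  · rw [mem_ball_zero_iff, Real.norm_eq_abs]
    linarith
  · have hf := factorial_add_two_le w.length
    simp only [List.length_append, List.length_map, List.length_cons, List.length_nil, zero_add]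
    rw [pow_add, mul_pow 4]
    calc M * ((A * h) ^ w.length * (A * h) ^ 2) * ((w.length + 2).factorial : ℝ) ≤
          M * ((A * h) ^ w.length * (A * h) ^ 2) * (2 * 4 ^ w.length * w.length.factorial) := by
          gcongr
      _ = _ := by ring

end Along

/-! ### Carriers of analytic functionals -/

section Carriers

attribute [local instance 100] LieRing.ofAssociativeRing

variable {E : Type*} [NormedAddCommGroup E] [NormedSpace ℝ E] [FiniteDimensional ℝ E]
  {G : Type*} [TopologicalSpace G] [ChartedSpace E G] [Group G] [LieGroup 𝓘(ℝ, E) ω G]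
  [T2Space G]

open DegSeries.RegularSpace

theorem IsCarriedBy.comp_rightRep {u : (analyticSpace E G).carrier →ₗ[ℂ] ℂ} {C : Set G}
    (hu : IsCarriedBy u C) (T : UAlg E G) :
    IsCarriedBy (u ∘ₗ rightRep analyticSpace_isBimodule T) C := by
  induction T using uAlg_induction generalizing u with
  | hc c =>
    rw [AlgHom.commutes]
    convert hu.smul c using 1
    refine LinearMap.ext fun φ ↦ ?_
    simp [Module.algebraMap_end_apply]
  | hX X =>
    intro U hU hCU h hh
    set A := max 1 (@norm E _ X)
    have hA : 1 ≤ A := le_max_left _ _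
    obtain ⟨c, hc⟩ := hu U hU hCU (2 * (A * h)) (by positivity)
    refine ⟨c * (A * h), fun φ M hM hφ ↦ ?_⟩
    refine (hc _ (A * h * M) (by positivity) ?_).trans_eq (mul_assoc _ _ _).symm
    rw [rightRep_toU]
    exact CauchyBound.rightDeriv (φ.2.of_le le_top) hh.le hM hφ hA X (le_max_right _ _)
  | hadd S T hS hT =>
    rw [map_add, LinearMap.comp_add]
    exact (hS hu).add (hT hu)
  | hmul S T hS hT =>
    rw [map_mul, Module.End.mul_eq_comp, ← LinearMap.comp_assoc]
    exact hT (hS hu)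

theorem IsCarriedBy.comp_mulBy {u : (analyticSpace E G).carrier →ₗ[ℂ] ℂ} {C : Set G}
    (hC : IsCompact C) (hu : IsCarriedBy u C) (c : (analyticSpace E G).carrier) :
    IsCarriedBy (u ∘ₗ mulBy analyticSpace_isBimodule c) C := by
  intro U hU hCU h hh
  obtain ⟨U', hU', hCU', h', M', hh', hM', H⟩ := exists_cauchyBound c.2 hC
  obtain ⟨B, hB⟩ := hu (U ∩ U') (hU.inter hU') (subset_inter hCU hCU') (2 * max h h')
    (mul_pos two_pos (hh.trans_le (le_max_left _ _)))
  refine ⟨B * M', fun φ M hM hφ ↦ ?_⟩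
  refine (hB _ (M' * M) (by positivity) ?_).trans_eq (mul_assoc _ _ _).symm
  exact CauchyBound.mul (c.2.of_le le_top) (φ.2.of_le le_top) (hh.le.trans (le_max_left _ _)) hM' hM
    (H.mono inter_subset_right hh'.le (le_max_right _ _) le_rfl hM')
    (CauchyBound.mono hφ inter_subset_left hh.le (le_max_left _ _) le_rfl hM)

theorem IsCarriedBy.comp_translate {u : (analyticSpace E G).carrier →ₗ[ℂ] ℂ} {C : Set G}
    (hu : IsCarriedBy u C) (p : G) :
    IsCarriedBy (u ∘ₗ (analyticSpace E G).translate p) ((fun x ↦ x * p) '' C) := by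
  intro U hU hCU h hh
  have : ContinuousMul G := (topologicalGroup_of_lieGroup 𝓘(ℝ, E) ω (G := G)).toContinuousMul
  obtain ⟨A, hA, hAd⟩ := exists_norm_adjointAction_le (E := E) (isCompact_singleton (x := p⁻¹))
  obtain ⟨B, hB⟩ := hu ((fun x ↦ x * p) ⁻¹' U) (hU.preimage (continuous_mul_const p))
    (image_subset_iff.1 hCU) (A * h) (by positivity)
  exact ⟨B, fun φ M hM hφ ↦ hB _ M hM (CauchyBound.translate (φ.2.of_le le_top) hφ
    (zero_lt_one.trans_le hA) (hAd _ rfl) fun x hx ↦ hx)⟩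

/-- A family of functionals is uniformly carried by `C` if the constants in the definition of
`IsCarriedBy` can be chosen to be the same for all members. -/
def UniformlyCarriedBy {ι : Type*} (u : ι → (analyticSpace E G).carrier →ₗ[ℂ] ℂ) (C : Set G) : Prop :=
  ∀ U : Set G, IsOpen U → C ⊆ U → ∀ h : ℝ, 0 < h → ∃ c : ℝ, ∀ i, ∀ φ : (analyticSpace E G).carrier,
    ∀ M : ℝ, 0 ≤ M → CauchyBound E φ.1 U h M → ‖u i φ‖ ≤ c * M

theorem IsCarriedBy.uniformly_translate {u : (analyticSpace E G).carrier →ₗ[ℂ] ℂ} {C : Set G}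
    (hC : IsCompact C) (hu : IsCarriedBy u C) (X : LieAlg E G) {K : Set ℝ} (hK : IsCompact K) :
    UniformlyCarriedBy (fun s : K ↦ u ∘ₗ (analyticSpace E G).translate (lieExp (s.1 • X)))
      ((fun p : G × ℝ ↦ p.1 * lieExp (p.2 • X)) '' (C ×ˢ K)) := by
  intro U hU hCU h hh
  obtain ⟨r, hr⟩ := hK.isBounded.exists_norm_le
  obtain ⟨A, hA, -, hAd⟩ := exists_norm_adjointAction_lieExp_le (G := G) X r
  obtain ⟨U', hU', hCU', W, hW, hKW, hmul⟩ := exists_isOpen_mul_lieExp_subset hC hU hK X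
    fun x hx s hs ↦ hCU ⟨(x, s), ⟨hx, hs⟩, rfl⟩
  obtain ⟨B, hB⟩ := hu U' hU' hCU' (A * h) (by positivity)
  exact ⟨B, fun s φ M hM hφ ↦ hB _ M hM (CauchyBound.translate (φ.2.of_le le_top) hφ
    (zero_lt_one.trans_le hA) (hAd _ (hr _ s.2)) fun x hx ↦ hmul x hx _ (hKW s.2))⟩

theorem isCompact_image_mul_lieExp {C : Set G} (hC : IsCompact C) (X : LieAlg E G) {K : Set ℝ}
    (hK : IsCompact K) : IsCompact ((fun p : G × ℝ ↦ p.1 * lieExp (p.2 • X)) '' (C ×ˢ K)) :=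
  (hC.prod hK).image (continuous_mul_lieExp X)

theorem comp_rightRep_mem_vanishing {u : (analyticSpace E G).carrier →ₗ[ℂ] ℂ} {U : Set G}
    (hu : u ∈ vanishing U) (T : UAlg E G) :
    u ∘ₗ rightRep analyticSpace_isBimodule T ∈ vanishing U := by
  obtain ⟨C, hC, hCU, h⟩ := hu
  exact ⟨C, hC, hCU, h.comp_rightRep T⟩

theorem comp_mulBy_mem_vanishing {u : (analyticSpace E G).carrier →ₗ[ℂ] ℂ} {U : Set G}
    (hu : u ∈ vanishing U) (c : (analyticSpace E G).carrier) :
    u ∘ₗ mulBy analyticSpace_isBimodule c ∈ vanishing U := by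
  obtain ⟨C, hC, hCU, h⟩ := hu
  exact ⟨C, hC, hCU, h.comp_mulBy hC c⟩

theorem comp_translate_mem_vanishing {u : (analyticSpace E G).carrier →ₗ[ℂ] ℂ} {U : Set G}
    (hu : u ∈ vanishing U) (p : G) :
    u ∘ₗ (analyticSpace E G).translate p ∈ vanishing ((fun x ↦ x * p⁻¹) ⁻¹' U) := by
  have : ContinuousMul G := (topologicalGroup_of_lieGroup 𝓘(ℝ, E) ω (G := G)).toContinuousMul
  obtain ⟨C, hC, hCU, h⟩ := hu
  refine ⟨_, hC.image (continuous_mul_const p), ?_, h.comp_translate p⟩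
  rw [Set.disjoint_left]
  rintro _ ⟨x, hx, rfl⟩ hx'
  rw [mem_preimage, mul_inv_cancel_right] at hx'
  exact Set.disjoint_left.1 hCU hx hx'

end Carriers

section Exponential

attribute [local instance 100] LieRing.ofAssociativeRing

variable {E : Type*} [NormedAddCommGroup E] [NormedSpace ℝ E] [FiniteDimensional ℝ E]
  {G : Type*} [TopologicalSpace G] [ChartedSpace E G] [Group G] [LieGroup 𝓘(ℝ, E) ω G]
  [T2Space G]

open DegSeries.RegularSpace

variable {V : RegularSpace E G} {hV : V.IsBimodule}

theorem comp_rightRep_antiAut_sub (u : V.carrier →ₗ[ℂ] ℂ) (X : LieAlg E G) (c : ℂ) (φ : V.carrier) :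
    (u ∘ₗ rightRep hV (antiAut (toU X - algebraMap ℂ _ c))) φ =
      -u (rightRep hV (toU X) φ) - c * u φ := by
  rw [antiAut_sub, antiAut_toU, antiAut_algebraMap, map_sub, map_neg, AlgHom.commutes]
  simp [Module.algebraMap_end_apply]

/-- The derivative of `e^{-ct} (u(x exp(tX)))` measures the failure of `L_X u = c u`. -/
theorem RegularSpace.IsDifferentiable.hasDerivAt_exp_mul {u : V.carrier →ₗ[ℂ] ℂ}
    (hu : IsDifferentiable hV u) (X : LieAlg E G) (c : ℂ) (φ : V.carrier) (t : ℝ) :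
    HasDerivAt (fun t : ℝ ↦ Complex.exp (-(t * c)) * u (V.translate (lieExp ((-t) • X)) φ))
      (Complex.exp (-(t * c)) * (u ∘ₗ rightRep hV (antiAut (toU X - algebraMap ℂ _ c)))
        (V.translate (lieExp ((-t) • X)) φ)) t := by
  have h1 : HasDerivAt (fun t : ℝ ↦ u (V.translate (lieExp ((-t) • X)) φ))
      (-u (V.translate (lieExp ((-t) • X)) (rightRep hV (toU X) φ))) t := by
    have := (hu X φ (-t)).scomp t (hasDerivAt_neg t)
    simpa [Function.comp_def] using this
  have h2 : HasDerivAt (fun t : ℝ ↦ Complex.exp (-(t * c))) (Complex.exp (-(t * c)) * -(1 * c)) t :=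
    HasDerivAt.cexp (HasDerivAt.neg (Complex.ofRealCLM.hasDerivAt.mul_const c))
  have h3 := h2.mul h1
  rw [comp_rightRep_antiAut_sub, rightRep_toU_translate]
  refine h3.congr_deriv ?_
  ring

theorem comp_translate_lieExp_of_comp_rightRep_eq_zero {u : V.carrier →ₗ[ℂ] ℂ}
    (hu : IsDifferentiable hV u) {X : LieAlg E G} {c : ℂ}
    (h : u ∘ₗ rightRep hV (antiAut (toU X - algebraMap ℂ _ c)) = 0) :
    V.dualTranslate (lieExp X) u = Complex.exp c • u := by
  refine LinearMap.ext fun φ ↦ ?_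
  have h1 := is_const_of_deriv_eq_zero (fun t ↦ (hu.hasDerivAt_exp_mul X c φ t).differentiableAt)
    (fun t ↦ by rw [(hu.hasDerivAt_exp_mul X c φ t).deriv, h, LinearMap.zero_apply, mul_zero]) 1 0
  simp only [Complex.ofReal_one, one_mul, Complex.ofReal_zero, zero_mul, neg_zero, Complex.exp_zero,
    zero_smul, lieExp_zero, translate_one, neg_smul, one_smul, lieExp_neg, Complex.exp_neg] at h1
  change u (V.translate _ φ) = Complex.exp c * u φ
  rw [← h1, mul_inv_cancel_left₀ (Complex.exp_ne_zero c)]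

theorem comp_rightRep_eq_zero_of_comp_translate_lieExp {u : V.carrier →ₗ[ℂ] ℂ}
    (hu : IsDifferentiable hV u) {X : LieAlg E G} {c : ℂ}
    (h : ∀ t : ℝ, V.dualTranslate (lieExp (t • X)) u = Complex.exp (t * c) • u) :
    u ∘ₗ rightRep hV (antiAut (toU X - algebraMap ℂ _ c)) = 0 := by
  refine LinearMap.ext fun φ ↦ ?_
  have h1 := hu.hasDerivAt_exp_mul X c φ 0
  have h2 : (fun t : ℝ ↦ Complex.exp (-(t * c)) * u (V.translate (lieExp ((-t) • X)) φ)) =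
      fun _ ↦ u φ := by
    funext t
    have h3 := congrArg (fun v ↦ v φ) (h t)
    change u (V.translate _ φ) = Complex.exp _ * u φ at h3
    rw [lieExp_neg_smul, h3, ← mul_assoc, ← Complex.exp_add, neg_add_cancel, Complex.exp_zero, one_mul]
  rw [h2] at h1
  have h4 := h1.unique (hasDerivAt_const _ _)
  simpa [lieExp_zero, translate_one] using h4

/-- If `L_X u = c u` up to a functional carried by `C`, then `u(x exp X) = e^c u(x)` up to a
functional carried by `C exp([-1, 0] X)`. -/
theorem isCarriedBy_dualTranslate_sub {u : (analyticSpace E G).carrier →ₗ[ℂ] ℂ}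
    (hu : IsDifferentiable analyticSpace_isBimodule u) {X : LieAlg E G} {c : ℂ} {C : Set G}
    (hC : IsCompact C)
    (h : IsCarriedBy (u ∘ₗ rightRep analyticSpace_isBimodule
      (antiAut (toU X - algebraMap ℂ _ c))) C) :
    IsCarriedBy ((analyticSpace E G).dualTranslate (lieExp X) u - Complex.exp c • u)
      ((fun p : G × ℝ ↦ p.1 * lieExp (p.2 • X)) '' (C ×ˢ Icc (-1) 0)) := by
  intro U hU hCU a ha
  obtain ⟨B, hB⟩ := h.uniformly_translate hC X isCompact_Icc U hU hCU a ha
  refine ⟨‖Complex.exp c‖ * (Real.exp ‖c‖ * B), fun φ M hM hφ ↦ ?_⟩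
  have h1 := (convex_Icc (0 : ℝ) 1).norm_image_sub_le_of_norm_hasDerivWithin_le
    (C := Real.exp ‖c‖ * (B * M)) (fun t _ ↦ (hu.hasDerivAt_exp_mul X c φ t).hasDerivWithinAt)
    (fun t ht ↦ by
      rw [norm_mul]
      refine mul_le_mul ?_ (hB ⟨-t, by linarith [ht.2], by linarith [ht.1]⟩ φ M hM hφ)
        (norm_nonneg _) (Real.exp_pos _).le
      rw [Complex.norm_exp]
      refine Real.exp_le_exp.2 ((Complex.re_le_norm _).trans ?_)
      rw [norm_neg, norm_mul, Complex.norm_real, Real.norm_of_nonneg ht.1]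
      exact mul_le_of_le_one_left (norm_nonneg c) ht.2)
    (left_mem_Icc.2 zero_le_one) (right_mem_Icc.2 zero_le_one)
  simp only [Complex.ofReal_one, one_mul, Complex.ofReal_zero, zero_mul, neg_zero, Complex.exp_zero,
    zero_smul, lieExp_zero, translate_one, neg_smul, one_smul, lieExp_neg, Complex.exp_neg, sub_zero,
    norm_one, mul_one] at h1
  have e : ((analyticSpace E G).dualTranslate (lieExp X) u - Complex.exp c • u) φ =
      Complex.exp c * ((Complex.exp c)⁻¹ * u ((analyticSpace E G).translate (lieExp X)⁻¹ φ) - u φ) := by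
    rw [mul_sub, mul_inv_cancel_left₀ (Complex.exp_ne_zero c)]
    rfl
  rw [e, norm_mul, mul_assoc, mul_assoc]
  gcongr

end Exponential

/-! ### Uniform carriers from pointwise ones -/

section Measure

open MeasureTheory

/-- From bounds that depend on the point one gets uniform bounds on a set of positive measure. -/
theorem exists_measure_pos_iInter {α : Type*} [MeasurableSpace α] {μ : Measure α} {S : Set α}
    (hS : MeasurableSet S) (h0 : μ S ≠ 0) (hfin : μ S ≠ ⊤) {B : ℕ → ℕ → Set α}
    (hB : ∀ m n, MeasurableSet (B m n)) (hmono : ∀ m, Monotone (B m))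
    (h : ∀ s ∈ S, ∀ m, ∃ n, s ∈ B m n) : ∃ f : ℕ → ℕ, μ (S ∩ ⋂ m, B m (f m)) ≠ 0 := by
  obtain ⟨ε, hε, hsum⟩ := ENNReal.exists_pos_sum_of_countable h0 ℕ
  have hex : ∀ m, ∃ n, μ (S \ B m n) < ε m := by
    intro m
    have ht := tendsto_measure_iInter_atTop (μ := μ) (s := fun n ↦ S \ B m n)
      (fun n ↦ (hS.diff (hB m n)).nullMeasurableSet) (fun a b hab ↦ sdiff_le_sdiff_left (hmono m hab))
      ⟨0, ne_top_of_le_ne_top hfin (measure_mono sdiff_subset)⟩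
    have he : ⋂ n, S \ B m n = ∅ := by
      refine eq_empty_of_forall_notMem fun s hs ↦ ?_
      have hs' := mem_iInter.1 hs
      obtain ⟨n, hn⟩ := h s (hs' 0).1 m
      exact (hs' n).2 hn
    rw [he, measure_empty] at ht
    exact (ht.eventually (gt_mem_nhds (by exact_mod_cast hε m))).exists
  choose f hf using hex
  refine ⟨f, fun hz ↦ ?_⟩
  have h1 : μ S ≤ μ (S ∩ ⋂ m, B m (f m)) + ∑' m, μ (S \ B m (f m)) := by
    refine (measure_mono ?_).trans ((measure_union_le _ _).trans
      (add_le_add_right (measure_iUnion_le fun m ↦ S \ B m (f m)) _))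
    intro s hs
    by_cases hs' : ∀ m, s ∈ B m (f m)
    · exact Or.inl ⟨hs, mem_iInter.2 hs'⟩
    · push Not at hs'
      obtain ⟨m, hm⟩ := hs'
      exact Or.inr (mem_iUnion.2 ⟨m, hs, hm⟩)
  rw [hz, zero_add] at h1
  exact (h1.trans (ENNReal.tsum_le_tsum fun m ↦ (hf m).le)).not_gt hsum

theorem locallyCompactSpace_of_lieGroup (E : Type*) [NormedAddCommGroup E] [NormedSpace ℝ E]
    [FiniteDimensional ℝ E] (G : Type*) [TopologicalSpace G] [ChartedSpace E G] [Group G]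
    [LieGroup 𝓘(ℝ, E) ω G] : LocallyCompactSpace G :=
  Manifold.locallyCompact_of_finiteDimensional 𝓘(ℝ, E)

/-- A connected Lie group is the union of the powers of a compact neighbourhood of the identity. -/
theorem sigmaCompactSpace_of_connected (E : Type*) [NormedAddCommGroup E] [NormedSpace ℝ E]
    [FiniteDimensional ℝ E] (G : Type*) [TopologicalSpace G] [ChartedSpace E G] [Group G]
    [LieGroup 𝓘(ℝ, E) ω G] [ConnectedSpace G] : SigmaCompactSpace G := by
  have hg : IsTopologicalGroup G := topologicalGroup_of_lieGroup 𝓘(ℝ, E) ω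
  have hl : LocallyCompactSpace G := locallyCompactSpace_of_lieGroup E G
  obtain ⟨V, hV, h1⟩ := exists_compact_mem_nhds (1 : G)
  let C : ℕ → Set G := fun n ↦ Nat.rec {1} (fun _ S ↦ (fun p : G × G ↦ p.1 * p.2) '' (S ×ˢ V)) n
  have hC : ∀ n, IsCompact (C n) := by
    intro n
    induction n with
    | zero => exact isCompact_singleton
    | succ n ih => exact (ih.prod hV).image continuous_mul
  have hmul : ∀ x ∈ ⋃ n, C n, ∀ v ∈ V, x * v ∈ ⋃ n, C n := by
    intro x hx v hv
    obtain ⟨n, hn⟩ := mem_iUnion.1 hx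
    exact mem_iUnion.2 ⟨n + 1, (x, v), ⟨hn, hv⟩, rfl⟩
  have hopen : IsOpen (⋃ n, C n) := by
    rw [isOpen_iff_mem_nhds]
    intro x hx
    have ht : Tendsto (fun y ↦ x⁻¹ * y) (𝓝 x) (𝓝 1) := by
      have := (continuous_const_mul x⁻¹).tendsto x
      rwa [inv_mul_cancel] at this
    filter_upwards [ht h1] with y hy
    have := hmul x hx _ hy
    rwa [mul_inv_cancel_left] at this
  have hclosed : IsClosed (⋃ n, C n) := by
    rw [← isOpen_compl_iff, isOpen_iff_mem_nhds]
    intro x hx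
    have ht : Tendsto (fun y ↦ y⁻¹ * x) (𝓝 x) (𝓝 1) := by
      have h : Continuous fun y : G ↦ y⁻¹ * x := by fun_prop
      have := h.tendsto x
      rwa [inv_mul_cancel] at this
    filter_upwards [ht h1] with y hy hy'
    apply hx
    have := hmul y hy' _ hy
    rwa [mul_inv_cancel_left] at this
  have huniv : ⋃ n, C n = univ := IsClopen.eq_univ ⟨hclosed, hopen⟩ ⟨1, mem_iUnion.2 ⟨0, rfl⟩⟩
  exact ⟨⟨C, hC, huniv⟩⟩

theorem metrizableSpace_of_connected (E : Type*) [NormedAddCommGroup E] [NormedSpace ℝ E]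
    [FiniteDimensional ℝ E] (G : Type*) [TopologicalSpace G] [ChartedSpace E G] [Group G]
    [LieGroup 𝓘(ℝ, E) ω G] [T2Space G] [ConnectedSpace G] : TopologicalSpace.MetrizableSpace G := by
  have hs := sigmaCompactSpace_of_connected E G
  have hl : LocallyCompactSpace G := locallyCompactSpace_of_lieGroup E G
  have h2 := ChartedSpace.secondCountable_of_sigmaCompact E G
  infer_instance

theorem exists_countable_nhds_basis (E : Type*) [NormedAddCommGroup E] [NormedSpace ℝ E]
    [FiniteDimensional ℝ E] {G : Type*} [TopologicalSpace G] [ChartedSpace E G] [Group G]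
    [LieGroup 𝓘(ℝ, E) ω G] [T2Space G] [ConnectedSpace G] {C : Set G} (hC : IsCompact C) :
    ∃ O : ℕ → Set G, (∀ m, IsOpen (O m) ∧ C ⊆ O m) ∧ Antitone O ∧
      ∀ U, IsOpen U → C ⊆ U → ∃ m, O m ⊆ U := by
  have := metrizableSpace_of_connected E G
  let _ := TopologicalSpace.metrizableSpaceMetric G
  refine ⟨fun m ↦ Metric.thickening (1 / ((m : ℝ) + 1)) C, fun m ↦ ⟨Metric.isOpen_thickening,
    Metric.self_subset_thickening (by positivity) C⟩, fun m n hmn ↦ Metric.thickening_mono ?_ C,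
    fun U hU hCU ↦ ?_⟩
  · have : (m : ℝ) ≤ n := by exact_mod_cast hmn
    gcongr
  · obtain ⟨δ, hδ, h⟩ := hC.exists_thickening_subset_open hU hCU
    obtain ⟨m, hm⟩ := exists_nat_one_div_lt hδ
    exact ⟨m, (Metric.thickening_mono hm.le C).trans h⟩

variable {E : Type*} [NormedAddCommGroup E] [NormedSpace ℝ E] [FiniteDimensional ℝ E]
  {G : Type*} [TopologicalSpace G] [ChartedSpace E G] [Group G] [LieGroup 𝓘(ℝ, E) ω G]
  [T2Space G]

open DegSeries.RegularSpace

/-- If for each `s` in a set of positive measure the functional `w s` is carried by a compact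
subset of the closed set `F`, then it is carried, uniformly for `s` in a set of positive measure,
by one compact subset of `F`. -/
theorem exists_uniformlyCarriedBy_of_forall [ConnectedSpace G]
    {w : ℝ → (analyticSpace E G).carrier →ₗ[ℂ] ℂ}
    (hw : ∀ φ, Continuous fun s ↦ w s φ) {F : Set G} (hF : IsClosed F)
    (h : ∀ s ∈ Icc (0 : ℝ) 1, ∃ C, IsCompact C ∧ C ⊆ F ∧ IsCarriedBy (w s) C) :
    ∃ C, IsCompact C ∧ C ⊆ F ∧ ∃ S : Set ℝ, MeasurableSet S ∧ volume S ≠ 0 ∧ volume S ≠ ⊤ ∧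
      S ⊆ Icc 0 1 ∧ UniformlyCarriedBy (fun s : S ↦ w s) C := by
  have hl : LocallyCompactSpace G := locallyCompactSpace_of_lieGroup E G
  have hs := sigmaCompactSpace_of_connected E G
  let K := CompactExhaustion.choice G
  have hKF : ∀ n, IsCompact (K n ∩ F) := fun n ↦ (K.isCompact n).inter_right hF
  choose O hO hanti hbasis using fun n ↦ exists_countable_nhds_basis E (hKF n)
  let B : ℕ → ℕ → ℕ → Set ℝ := fun n m N ↦ ⋂ (φ : (analyticSpace E G).carrier) (M : ℝ)
    (_ : 0 ≤ M) (_ : CauchyBound E φ.1 (O n m) (m + 1) M), {s | ‖w s φ‖ ≤ N * M}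
  have hBmem : ∀ {n m N s}, s ∈ B n m N ↔ ∀ (φ : (analyticSpace E G).carrier) (M : ℝ), 0 ≤ M →
      CauchyBound E φ.1 (O n m) (m + 1) M → ‖w s φ‖ ≤ N * M := by
    intro n m N s
    simp only [B, mem_iInter, mem_ofPred_eq]
  have hBc : ∀ n m N, IsClosed (B n m N) := by
    intro n m N
    refine isClosed_iInter fun φ ↦ isClosed_iInter fun M ↦ isClosed_iInter fun _ ↦
      isClosed_iInter fun _ ↦ isClosed_le (hw φ).norm continuous_const
  have hBmono : ∀ n m, Monotone (B n m) := by
    intro n m N N' hNN s hs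
    rw [hBmem] at hs ⊢
    intro φ M hM hφ
    have : (N : ℝ) ≤ N' := by exact_mod_cast hNN
    exact (hs φ M hM hφ).trans (by gcongr)
  let A : ℕ → Set ℝ := fun n ↦ Icc 0 1 ∩ ⋂ m, ⋃ N, B n m N
  have hAm : ∀ n, MeasurableSet (A n) := fun n ↦ measurableSet_Icc.inter
    (MeasurableSet.iInter fun m ↦ MeasurableSet.iUnion fun N ↦ (hBc n m N).measurableSet)
  have hcov : Icc (0 : ℝ) 1 ⊆ ⋃ n, A n := by
    intro s hs
    obtain ⟨C, hC, hCF, hcar⟩ := h s hs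
    obtain ⟨n, hn⟩ := K.exists_superset_of_isCompact hC
    refine mem_iUnion.2 ⟨n, hs, mem_iInter.2 fun m ↦ ?_⟩
    obtain ⟨c, hc⟩ := hcar (O n m) (hO n m).1 ((subset_inter hn hCF).trans (hO n m).2) (m + 1)
      (by positivity)
    obtain ⟨N, hN⟩ := exists_nat_ge c
    refine mem_iUnion.2 ⟨N, hBmem.2 fun φ M hM hφ ↦ (hc φ M hM hφ).trans (by gcongr)⟩
  obtain ⟨n, hn⟩ : ∃ n, volume (A n) ≠ 0 := by
    by_contra! h0
    have h1 := (measure_mono (μ := volume) hcov).trans (measure_iUnion_le A)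
    simp [h0] at h1
  have hfin : ∀ S ⊆ Icc (0 : ℝ) 1, volume S ≠ ⊤ := fun S hS ↦
    ne_top_of_le_ne_top (by simp) (measure_mono hS)
  obtain ⟨f, hf⟩ := exists_measure_pos_iInter (hAm n) hn (hfin _ inter_subset_left)
    (fun m N ↦ (hBc n m N).measurableSet) (hBmono n)
    (fun s hs m ↦ mem_iUnion.1 (mem_iInter.1 hs.2 m))
  have hsub : A n ∩ ⋂ m, B n m (f m) ⊆ Icc 0 1 := inter_subset_left.trans inter_subset_left
  refine ⟨K n ∩ F, hKF n, inter_subset_right, A n ∩ ⋂ m, B n m (f m),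
    (hAm n).inter (MeasurableSet.iInter fun m ↦ (hBc n m (f m)).measurableSet), hf, hfin _ hsub,
    hsub, fun U hU hCU a ha ↦ ?_⟩
  obtain ⟨m, hm⟩ := hbasis n U hU hCU
  obtain ⟨k, hk⟩ := exists_nat_ge a
  refine ⟨f (max m k), fun s φ M hM hφ ↦ ?_⟩
  refine hBmem.1 (mem_iInter.1 s.2.2 (max m k)) φ M hM (CauchyBound.mono hφ
    ((hanti n (le_max_left m k)).trans hm) ha.le ?_ le_rfl hM)
  have : (k : ℝ) ≤ (max m k : ℕ) := by exact_mod_cast le_max_right m k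
  linarith

/-- If `u(x exp(sX)) - e^{cs} u(x)` is carried by compact subsets of `F`, for all `s` in `[0, 1]`,
then it is so uniformly for small `s`. This comes from Steinhaus's theorem and the cocycle property
of the expression in `s`. -/
theorem exists_uniformlyCarriedBy_translate_sub [ConnectedSpace G]
    {u : (analyticSpace E G).carrier →ₗ[ℂ] ℂ} (hu : IsDifferentiable analyticSpace_isBimodule u)
    {X : LieAlg E G} {c : ℂ} {F : Set G} (hF : IsClosed F)
    (h : ∀ s ∈ Icc (0 : ℝ) 1, ∃ C, IsCompact C ∧ C ⊆ F ∧ IsCarriedBy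
      (u ∘ₗ (analyticSpace E G).translate (lieExp ((-s) • X)) - Complex.exp (s * c) • u) C) :
    ∃ C, IsCompact C ∧ C ⊆ F ∧ ∃ η : ℝ, 0 < η ∧ η ≤ 1 ∧ UniformlyCarriedBy
      (fun t : Icc 0 η ↦ u ∘ₗ (analyticSpace E G).translate (lieExp ((-t.1) • X)) -
        Complex.exp (t.1 * c) • u)
      ((fun p : G × ℝ ↦ p.1 * lieExp (p.2 • X)) '' (C ×ˢ Icc (-1) 0)) := by
  set w : ℝ → (analyticSpace E G).carrier →ₗ[ℂ] ℂ := fun s ↦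
    u ∘ₗ (analyticSpace E G).translate (lieExp ((-s) • X)) - Complex.exp (s * c) • u with hw
  have hwapp : ∀ s φ, w s φ = u ((analyticSpace E G).translate (lieExp ((-s) • X)) φ) -
      Complex.exp (s * c) * u φ := fun s φ ↦ rfl
  have hcont : ∀ φ, Continuous fun s ↦ w s φ := by
    intro φ
    simp only [hwapp]
    have h1 : Continuous fun t : ℝ ↦ u ((analyticSpace E G).translate (lieExp (t • X)) φ) :=
      continuous_iff_continuousAt.2 fun t ↦ (hu X φ t).continuousAt
    exact (h1.comp continuous_neg).sub (by fun_prop)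
  obtain ⟨C, hC, hCF, S, hSm, hS0, hSfin, hS1, hunif⟩ :=
    exists_uniformlyCarriedBy_of_forall hcont hF h
  have hst := Measure.sub_mem_nhds_zero_of_addHaar_pos_ne_top volume S hSm
    (pos_iff_ne_zero.2 hS0) hSfin
  obtain ⟨η, hη, hball⟩ := Metric.mem_nhds_iff.1 hst
  refine ⟨C, hC, hCF, min 1 (η / 2), by positivity, min_le_left _ _, fun U hU hCU a ha ↦ ?_⟩
  obtain ⟨A, hA, -, hAd⟩ := exists_norm_adjointAction_lieExp_le (G := G) X 1
  obtain ⟨U', hU', hCU', W, hW, hKW, hmul⟩ := exists_isOpen_mul_lieExp_subset hC hU isCompact_Icc X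
    fun x hx s hs ↦ hCU ⟨(x, s), ⟨hx, hs⟩, rfl⟩
  obtain ⟨B, hB⟩ := hunif U' hU' hCU' (A * a) (by positivity)
  refine ⟨Real.exp ‖c‖ * (2 * B), fun t φ M hM hφ ↦ ?_⟩
  have ht1 : t.1 ≤ 1 := t.2.2.trans (min_le_left _ _)
  have htη : t.1 < η := (t.2.2.trans (min_le_right _ _)).trans_lt (half_lt_self hη)
  obtain ⟨s', hs', s, hs, hts⟩ := hball (show t.1 ∈ Metric.ball 0 η by
    rw [mem_ball_zero_iff, Real.norm_of_nonneg t.2.1]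
    exact htη)
  simp only at hts
  have hφ0 : CauchyBound E φ.1 U' (A * a) M := CauchyBound.mono hφ (fun x hx ↦ by
      have := hmul x hx 0 (hKW (by simp))
      rwa [zero_smul, lieExp_zero, mul_one] at this) ha.le (le_mul_of_one_le_left ha.le hA) le_rfl hM
  have hφt : CauchyBound E ((analyticSpace E G).translate (lieExp ((-t.1) • X)) φ).1 U' (A * a) M :=
    CauchyBound.translate (φ.2.of_le le_top) hφ (zero_lt_one.trans_le hA)
      (hAd _ (by rw [abs_neg, abs_of_nonneg t.2.1]; exact ht1))
      fun x hx ↦ hmul x hx _ (hKW ⟨by linarith, by linarith [t.2.1]⟩)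
  have e : w t φ = Complex.exp (-(s * c)) *
      (w s' φ - w s ((analyticSpace E G).translate (lieExp ((-t.1) • X)) φ)) := by
    have hss : s' = s + t := by rw [← hts]; ring
    simp only [hwapp]
    rw [← translate_mul, ← lieExp_add_smul, hss, ← neg_add]
    push_cast
    have h1 : Complex.exp ((s + t.1) * c) = Complex.exp (s * c) * Complex.exp (t.1 * c) := by
      rw [← Complex.exp_add]
      ring_nf
    have h2 : Complex.exp (-(s * c)) * Complex.exp (s * c) = 1 := by
      rw [← Complex.exp_add, neg_add_cancel, Complex.exp_zero]
    rw [h1]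
    linear_combination (-(u ((analyticSpace E G).translate (lieExp ((-t.1) • X)) φ)) +
      Complex.exp (t.1 * c) * u φ) * h2
  have hs0 := hS1 hs
  change ‖w t φ‖ ≤ _
  rw [e, norm_mul, mul_assoc]
  refine mul_le_mul ?_ ?_ (norm_nonneg _) (Real.exp_pos _).le
  · rw [Complex.norm_exp]
    refine Real.exp_le_exp.2 ((Complex.re_le_norm _).trans ?_)
    rw [norm_neg, norm_mul, Complex.norm_real, Real.norm_of_nonneg hs0.1]
    exact mul_le_of_le_one_left (norm_nonneg c) hs0.2
  · refine (norm_sub_le _ _).trans ((add_le_add (hB ⟨s', hs'⟩ φ M hM hφ0)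
      (hB ⟨s, hs⟩ _ M hM hφt)).trans_eq (by ring))

/-- If `u(x exp(sX)) = e^{cs} u(x)` up to functionals carried by compact subsets of `F`, then
`L_X u = c u` up to a functional carried by a compact subset of `F exp([-1, 0] X)`. The functional
`u` is the sum of its average over small `s`, for which `L_X - c` gives a boundary term, and an
average of the errors. -/
theorem exists_isCarriedBy_comp_rightRep [ConnectedSpace G]
    {u : (analyticSpace E G).carrier →ₗ[ℂ] ℂ} (hu : IsDifferentiable analyticSpace_isBimodule u)
    {X : LieAlg E G} {c : ℂ} {F : Set G} (hF : IsClosed F)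
    (h : ∀ s ∈ Icc (0 : ℝ) 1, ∃ C, IsCompact C ∧ C ⊆ F ∧ IsCarriedBy
      (u ∘ₗ (analyticSpace E G).translate (lieExp ((-s) • X)) - Complex.exp (s * c) • u) C) :
    ∃ C, IsCompact C ∧ C ⊆ F ∧ IsCarriedBy
      (u ∘ₗ rightRep analyticSpace_isBimodule (antiAut (toU X - algebraMap ℂ _ c)))
      ((fun p : G × ℝ ↦ p.1 * lieExp (p.2 • X)) '' (C ×ˢ Icc (-1) 0)) := by
  obtain ⟨C, hC, hCF, η, hη, hη1, hunif⟩ := exists_uniformlyCarriedBy_translate_sub hu hF h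
  refine ⟨C, hC, hCF, ?_⟩
  set D := (fun p : G × ℝ ↦ p.1 * lieExp (p.2 • X)) '' (C ×ˢ Icc (-1) 0)
  set r := rightRep (analyticSpace_isBimodule (E := E) (G := G))
    (antiAut (toU X - algebraMap ℂ _ c)) with hr
  let g : (analyticSpace E G).carrier → ℝ → ℂ := fun φ t ↦ Complex.exp (-(t * c)) *
    u ((analyticSpace E G).translate (lieExp ((-t) • X)) φ)
  have hg : ∀ φ t, HasDerivAt (g φ) (g (r φ) t) t := by
    intro φ t
    have h1 := hu.hasDerivAt_exp_mul X c φ t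
    refine h1.congr_deriv ?_
    simp only [g, hr, comp_rightRep_antiAut_sub, rightRep_toU_translate]
    rw [antiAut_sub, antiAut_toU, antiAut_algebraMap, map_sub, map_neg, AlgHom.commutes]
    simp only [LinearMap.sub_apply, LinearMap.neg_apply, Module.algebraMap_end_apply, map_sub,
      map_neg, map_smul, smul_eq_mul]
  have hgc : ∀ φ, Continuous (g φ) := fun φ ↦
    continuous_iff_continuousAt.2 fun t ↦ (hg φ t).continuousAt
  have hgi : ∀ φ, IntervalIntegrable (g φ) volume 0 η := fun φ ↦ (hgc φ).intervalIntegrable _ _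
  have hgw : ∀ φ, ∀ t, g φ t - u φ = Complex.exp (-(t * c)) *
      (u ∘ₗ (analyticSpace E G).translate (lieExp ((-t) • X)) - Complex.exp (t * c) • u) φ := by
    intro φ t
    have h2 : Complex.exp (-(t * c)) * Complex.exp (t * c) = 1 := by
      rw [← Complex.exp_add, neg_add_cancel, Complex.exp_zero]
    simp only [g, LinearMap.sub_apply, LinearMap.comp_apply, LinearMap.smul_apply, smul_eq_mul]
    linear_combination (u φ) * h2
  let A : (analyticSpace E G).carrier →ₗ[ℂ] ℂ :=
    { toFun := fun φ ↦ (η : ℂ)⁻¹ * ∫ t in (0 : ℝ)..η, g φ t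
      map_add' := fun φ ψ ↦ by
        rw [← mul_add, ← intervalIntegral.integral_add (hgi φ) (hgi ψ)]
        simp only [g, map_add, mul_add]
      map_smul' := fun a φ ↦ by
        simp only [g, map_smul, smul_eq_mul, mul_left_comm _ a, intervalIntegral.integral_const_mul,
          RingHom.id_apply] }
  have hηc : (η : ℂ) ≠ 0 := by exact_mod_cast hη.ne'
  have hexp : ∀ t ∈ Icc 0 η, ‖Complex.exp (-(t * c))‖ ≤ Real.exp ‖c‖ := by
    intro t ht
    rw [Complex.norm_exp]
    refine Real.exp_le_exp.2 ((Complex.re_le_norm _).trans ?_)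
    rw [norm_neg, norm_mul, Complex.norm_real, Real.norm_of_nonneg ht.1]
    exact mul_le_of_le_one_left (norm_nonneg c) (ht.2.trans hη1)
  have hAu : IsCarriedBy (A - u) D := by
    intro U hU hDU a ha
    obtain ⟨B, hB⟩ := hunif U hU hDU a ha
    refine ⟨Real.exp ‖c‖ * B, fun φ M hM hφ ↦ ?_⟩
    have e : (A - u) φ = (η : ℂ)⁻¹ * ∫ t in (0 : ℝ)..η, (g φ t - u φ) := by
      rw [intervalIntegral.integral_sub (hgi φ) intervalIntegrable_const,
        intervalIntegral.integral_const, sub_zero, mul_sub, Complex.real_smul, inv_mul_cancel_left₀ hηc]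
      rfl
    have h1 : ‖∫ t in (0 : ℝ)..η, (g φ t - u φ)‖ ≤ Real.exp ‖c‖ * (B * M) * |η - 0| := by
      refine intervalIntegral.norm_integral_le_of_norm_le_const fun t ht ↦ ?_
      rw [uIoc_of_le hη.le] at ht
      rw [hgw, norm_mul]
      exact mul_le_mul (hexp t ⟨ht.1.le, ht.2⟩) (hB ⟨t, ht.1.le, ht.2⟩ φ M hM hφ) (norm_nonneg _)
        (Real.exp_pos _).le
    rw [sub_zero, abs_of_pos hη] at h1
    rw [e, norm_mul, norm_inv, Complex.norm_real, Real.norm_of_nonneg hη.le, inv_mul_le_iff₀ hη]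
    exact h1.trans_eq (by ring)
  have hAr : IsCarriedBy (A ∘ₗ r) D := by
    have e : A ∘ₗ r = ((η : ℂ)⁻¹ * Complex.exp (-(η * c))) •
        (u ∘ₗ (analyticSpace E G).translate (lieExp ((-η) • X)) - Complex.exp (η * c) • u) := by
      refine LinearMap.ext fun φ ↦ ?_
      have h1 : ∫ t in (0 : ℝ)..η, g (r φ) t = g φ η - g φ 0 :=
        intervalIntegral.integral_eq_sub_of_hasDerivAt (fun t _ ↦ hg φ t) (hgi (r φ))
      have h2 : g φ 0 = u φ := by
        simp [g, lieExp_zero, translate_one]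
      change (η : ℂ)⁻¹ * ∫ t in (0 : ℝ)..η, g (r φ) t = _
      rw [h1, h2, hgw, LinearMap.smul_apply, smul_eq_mul, mul_assoc]
    rw [e]
    refine IsCarriedBy.smul (fun U hU hDU a ha ↦ ?_) _
    obtain ⟨B, hB⟩ := hunif U hU hDU a ha
    exact ⟨B, hB ⟨η, hη.le, le_rfl⟩⟩
  have e : u ∘ₗ r = A ∘ₗ r + (-1 : ℂ) • ((A - u) ∘ₗ r) := by
    refine LinearMap.ext fun φ ↦ ?_
    simp
  rw [e]
  exact hAr.add ((hAu.comp_rightRep _).smul _)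

end Measure

/-! ### The infinitesimal right action on the four spaces of generalized functions -/

section Models

attribute [local instance 100] LieRing.ofAssociativeRing

universe u v

variable {E : Type u} [NormedAddCommGroup E] [NormedSpace ℝ E] [FiniteDimensional ℝ E]
  {G : Type v} [TopologicalSpace G] [ChartedSpace E G] [Group G] [LieGroup 𝓘(ℝ, E) ω G]

/-- The right regular action of the enveloping algebra on a space of generalized functions, given by
the left ideals `ann f = {T | L_T f = 0}`, together with its relation to right translations and to
the left regular representation. -/
structure RightModel (F : FunctionSpace E G) where
  /-- The annihilator of `f` for the right regular action. -/
  ann : F.Obj → Ideal (UAlg E G)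
  translateEq_one : ∀ f, F.IsTranslateEq f 1 1
  translateEq_mul : ∀ f p q c d, F.IsTranslateEq f p c → F.IsTranslateEq f q d →
    F.IsTranslateEq f (p * q) (c * d)
  translateEq_inv : ∀ f p c, c ≠ 0 → F.IsTranslateEq f p c → F.IsTranslateEq f p⁻¹ c⁻¹
  translateEq_lieExp : ∀ f (X : LieAlg E G) c, toU X - algebraMap ℂ _ c ∈ ann f →
    F.IsTranslateEq f (lieExp X) (Complex.exp c)
  sub_mem_ann : ∀ f (X : LieAlg E G) c,
    (∀ t : ℝ, F.IsTranslateEq f (lieExp (t • X)) (Complex.exp (t * c))) →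
    toU X - algebraMap ℂ _ c ∈ ann f
  isKilledBy_iff : ∀ f, ∀ I : Ideal (UAlg E G), I.IsTwoSided →
    ((∀ T ∈ I, F.IsKilledBy f (antiAut T)) ↔ I ≤ ann f)

variable [T2Space G]

open DegSeries.RegularSpace

/-- The annihilator of a function for the right regular representation. -/
noncomputable def RegularSpace.IsBimodule.annihilator {V : RegularSpace E G} (hV : V.IsBimodule)
    (φ : V.carrier) : Ideal (UAlg E G) where
  carrier := {T | rightRep hV T φ = 0}
  add_mem' {S T} hS hT := by
    change rightRep hV (S + T) φ = 0
    rw [map_add, LinearMap.add_apply, show rightRep hV S φ = 0 from hS,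
      show rightRep hV T φ = 0 from hT, add_zero]
  zero_mem' := by
    change rightRep hV 0 φ = 0
    rw [map_zero, LinearMap.zero_apply]
  smul_mem' S T hT := by
    change rightRep hV (S * T) φ = 0
    rw [map_mul, Module.End.mul_apply, show rightRep hV T φ = 0 from hT, map_zero]

theorem RegularSpace.IsBimodule.sub_mem_annihilator_iff {V : RegularSpace E G} (hV : V.IsBimodule)
    (φ : V.carrier) (X : LieAlg E G) (c : ℂ) :
    toU X - algebraMap ℂ _ c ∈ hV.annihilator φ ↔ rightDeriv X φ.1 = c • φ.1 := by
  change rightRep hV (toU X - algebraMap ℂ _ c) φ = 0 ↔ _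
  rw [map_sub, AlgHom.commutes, LinearMap.sub_apply, Module.algebraMap_end_apply, sub_eq_zero,
    ← rightRep_toU hV, ← SetLike.coe_eq_coe, Submodule.coe_smul]

/-- Along `t ↦ x exp(tX)` a function with `L_X φ = c φ` satisfies the differential equation of
`t ↦ e^{tc}`. -/
theorem RegularSpace.apply_mul_lieExp_of_rightDeriv_eq {V : RegularSpace E G}
    (φ : V.carrier) {X : LieAlg E G} {c : ℂ} (h : rightDeriv X φ.1 = c • φ.1) (x : G) :
    φ.1 (x * lieExp X) = Complex.exp c * φ.1 x := by
  have hd : ∀ t : ℝ, HasDerivAt (fun t : ℝ ↦ Complex.exp (-(t * c)) * φ.1 (x * lieExp (t • X))) 0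
      t := by
    intro t
    have h2 : HasDerivAt (fun t : ℝ ↦ Complex.exp (-(t * c)))
        (Complex.exp (-(t * c)) * -(1 * c)) t :=
      HasDerivAt.cexp (HasDerivAt.neg (Complex.ofRealCLM.hasDerivAt.mul_const c))
    refine (h2.mul (hasDerivAt_mul_lieExp (contMDiff_one φ) X x t)).congr_deriv ?_
    rw [h, Pi.smul_apply, smul_eq_mul]
    ring
  have h3 := is_const_of_deriv_eq_zero (fun t ↦ (hd t).differentiableAt) (fun t ↦ (hd t).deriv) 1 0
  simp only [Complex.ofReal_one, one_mul, one_smul, Complex.ofReal_zero, zero_mul, neg_zero,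
    Complex.exp_zero, zero_smul, lieExp_zero, mul_one, Complex.exp_neg] at h3
  rw [← h3, mul_inv_cancel_left₀ (Complex.exp_ne_zero c)]

theorem RegularSpace.rightDeriv_eq_of_apply_mul_lieExp {V : RegularSpace E G}
    (φ : V.carrier) {X : LieAlg E G} {c : ℂ}
    (h : ∀ (t : ℝ) (x : G), φ.1 (x * lieExp (t • X)) = Complex.exp (t * c) * φ.1 x) :
    rightDeriv X φ.1 = c • φ.1 := by
  funext x
  refine rightDeriv_eq_of_hasDerivAt (contMDiff_one φ) ?_
  rw [show (fun t : ℝ ↦ φ.1 (x * lieExp (t • X))) = fun t : ℝ ↦ Complex.exp (t * c) * φ.1 x from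
    funext fun t ↦ h t x]
  have h2 : HasDerivAt (fun t : ℝ ↦ Complex.exp (t * c)) (Complex.exp ((0 : ℝ) * c) * (1 * c)) 0 :=
    HasDerivAt.cexp (Complex.ofRealCLM.hasDerivAt.mul_const c)
  refine (h2.mul_const (φ.1 x)).congr_deriv ?_
  simp

/-- The right model of a space of functions: the annihilators for the right regular
representation. -/
noncomputable def RegularSpace.IsBimodule.rightModel [ConnectedSpace G] {V : RegularSpace E G}
    (hV : V.IsBimodule) : RightModel V.toFunctionSpace where
  ann f := hV.annihilator f
  translateEq_one f x := by rw [mul_one, one_mul]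
  translateEq_mul f p q c d h h' x := by rw [← mul_assoc, h' (x * p), h x]; ring
  translateEq_inv f p c hc h x := by
    have h1 := h (x * p⁻¹)
    rw [inv_mul_cancel_right] at h1
    rw [h1, inv_mul_cancel_left₀ hc]
  translateEq_lieExp f X c h :=
    apply_mul_lieExp_of_rightDeriv_eq _ ((hV.sub_mem_annihilator_iff _ X c).1 h)
  sub_mem_ann f X c h := (hV.sub_mem_annihilator_iff _ X c).2
    (rightDeriv_eq_of_apply_mul_lieExp _ h)
  isKilledBy_iff f I hI := forall_rep_antiAut_eq_zero_iff hV hI f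

/-- The annihilator, for the right regular representation, of a functional modulo a space of
functionals that count as zero. -/
noncomputable def RegularSpace.IsBimodule.annMod {V : RegularSpace E G} (hV : V.IsBimodule)
    (N : Submodule ℂ (V.carrier →ₗ[ℂ] ℂ)) (hN : ∀ u ∈ N, ∀ T, u ∘ₗ rightRep hV T ∈ N)
    (u : V.carrier →ₗ[ℂ] ℂ) : Ideal (UAlg E G) where
  carrier := {T | u ∘ₗ rightRep hV (antiAut T) ∈ N}
  add_mem' {S T} hS hT := by
    change u ∘ₗ rightRep hV (antiAut (S + T)) ∈ N
    rw [antiAut_add, map_add, LinearMap.comp_add]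
    exact add_mem hS hT
  zero_mem' := by
    change u ∘ₗ rightRep hV (antiAut 0) ∈ N
    rw [antiAut_zero, map_zero, LinearMap.comp_zero]
    exact zero_mem N
  smul_mem' S T hT := by
    change u ∘ₗ rightRep hV (antiAut (S * T)) ∈ N
    rw [antiAut_mul, map_mul, Module.End.mul_eq_comp, ← LinearMap.comp_assoc]
    exact hN _ hT _

/-- The right model of the distributions: the annihilators for the transpose of the right regular
representation on test functions. -/
noncomputable def distributionsRightModel [ConnectedSpace G] (D : IwasawaData E G) :
    RightModel (distributions E G) where
  ann f := testSpace_isBimodule.annMod ⊥ (fun u hu T ↦ by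
    rw [(Submodule.mem_bot ℂ).1 hu, LinearMap.zero_comp]
    exact zero_mem _) f.1
  translateEq_one f := LinearMap.ext fun φ ↦ by
    change f.1 ((testSpace E G).translate 1⁻¹ φ) = 1 * f.1 φ
    rw [inv_one, translate_one, one_mul]
  translateEq_mul f p q c d h h' := LinearMap.ext fun φ ↦ by
    have h1 := congrArg (fun u ↦ u φ) h
    have h2 := congrArg (fun u ↦ u ((testSpace E G).translate p⁻¹ φ)) h'
    change f.1 ((testSpace E G).translate (p * q)⁻¹ φ) = c * d * f.1 φ
    change f.1 ((testSpace E G).translate p⁻¹ φ) = c * f.1 φ at h1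
    change f.1 ((testSpace E G).translate q⁻¹ ((testSpace E G).translate p⁻¹ φ)) =
      d * f.1 ((testSpace E G).translate p⁻¹ φ) at h2
    rw [mul_inv_rev, translate_mul, h2, h1]
    ring
  translateEq_inv f p c hc h := LinearMap.ext fun φ ↦ by
    have h1 := congrArg (fun u ↦ u ((testSpace E G).translate p φ)) h
    change f.1 ((testSpace E G).translate p⁻¹ ((testSpace E G).translate p φ)) =
      c * f.1 ((testSpace E G).translate p φ) at h1
    rw [← translate_mul, inv_mul_cancel, translate_one] at h1
    change f.1 ((testSpace E G).translate p⁻¹⁻¹ φ) = c⁻¹ * f.1 φ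
    rw [inv_inv, h1, inv_mul_cancel_left₀ hc]
  translateEq_lieExp f X c h := comp_translate_lieExp_of_comp_rightRep_eq_zero
    f.2.isDifferentiable ((Submodule.mem_bot ℂ).1 h)
  sub_mem_ann f X c h := (Submodule.mem_bot ℂ).2 <|
    comp_rightRep_eq_zero_of_comp_translate_lieExp f.2.isDifferentiable h
  isKilledBy_iff f I hI := by
    have h := forall_comp_rep_mem_iff D testSpace_isBimodule hI (N := ⊥) (fun u hu c ↦ by
      rw [(Submodule.mem_bot ℂ).1 hu, LinearMap.zero_comp]
      exact zero_mem _) f.1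
    refine Iff.trans (forall₂_congr fun T _ ↦ ?_) h
    change f.1 ∘ₗ (testSpace E G).rep (antiAut (antiAut T)) = 0 ↔ _
    rw [antiAut_antiAut, Submodule.mem_bot]

section Hyperfunctions

theorem translate_mul_relCompactOpens (p q : G) (U : RelCompactOpens G) :
    U.translate (E := E) (p * q) = (U.translate (E := E) p).translate (E := E) q := by
  refine Subtype.ext <| Set.ext fun x ↦ ?_
  change x * (p * q)⁻¹ ∈ U.1 ↔ x * q⁻¹ * p⁻¹ ∈ U.1
  rw [mul_inv_rev, mul_assoc]

theorem translate_one_relCompactOpens (U : RelCompactOpens G) :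
    U.translate (E := E) 1 = U := by
  refine Subtype.ext <| Set.ext fun x ↦ ?_
  change x * 1⁻¹ ∈ U.1 ↔ x ∈ U.1
  rw [inv_one, mul_one]

theorem dualTranslate_mem_vanishing {u : (analyticSpace E G).carrier →ₗ[ℂ] ℂ} {p : G}
    {U : RelCompactOpens G} (hu : u ∈ vanishing (U.translate (E := E) p).1) :
    (analyticSpace E G).dualTranslate p u ∈ vanishing U.1 := by
  have h := comp_translate_mem_vanishing hu p⁻¹
  have e : (fun x ↦ x * p⁻¹⁻¹) ⁻¹' (U.translate (E := E) p).1 = U.1 := by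
    ext x
    change x * p⁻¹⁻¹ * p⁻¹ ∈ U.1 ↔ x ∈ U.1
    rw [inv_mul_cancel_right]
  rwa [e] at h

/-- Whether `f(x p) = c f(x)` on `U` can be tested with an analytic functional that represents `f`
on a set that contains `U` and `U p`. -/
theorem dualTranslate_sub_mem_vanishing_iff (u : compatibleFamilies E G) (p : G) (c : ℂ)
    {U W : RelCompactOpens G} (h1 : U.1 ⊆ W.1) (h2 : (U.translate (E := E) p).1 ⊆ W.1) :
    familyTranslate p u.1 U - c • u.1 U ∈ vanishing U.1 ↔
      (analyticSpace E G).dualTranslate p (u.1 W) - c • u.1 W ∈ vanishing U.1 := by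
  have h3 := dualTranslate_mem_vanishing (u.2.2 W _ h2)
  have h4 := Submodule.smul_mem _ c (u.2.2 W U h1)
  have e : (analyticSpace E G).dualTranslate p (u.1 W) - c • u.1 W =
      (familyTranslate p u.1 U - c • u.1 U) + ((analyticSpace E G).dualTranslate p
        (u.1 W - u.1 (U.translate (E := E) p)) - c • (u.1 W - u.1 U)) := by
    simp only [dualTranslate, familyTranslate, LinearMap.sub_comp, smul_sub]
    abel
  rw [e]
  exact (Submodule.add_mem_iff_left _ (sub_mem h3 h4)).symm

/-- A relatively compact open set that contains `U exp([0, 1] X)`. -/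
theorem exists_relCompactOpens_mul_lieExp (U : RelCompactOpens G) (X : LieAlg E G) :
    ∃ W : RelCompactOpens G, ∀ x ∈ U.1, ∀ s ∈ Icc (0 : ℝ) 1, x * lieExp (s • X) ∈ W.1 := by
  have hl : LocallyCompactSpace G := locallyCompactSpace_of_lieGroup E G
  obtain ⟨W, hW, hKW, hWc⟩ := exists_isOpen_superset_and_isCompact_closure
    (isCompact_image_mul_lieExp U.2.2 X (isCompact_Icc (a := (0 : ℝ)) (b := 1)))
  exact ⟨⟨W, hW, hWc⟩, fun x hx s hs ↦ hKW ⟨(x, s), ⟨subset_closure hx, hs⟩, rfl⟩⟩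

theorem translate_lieExp_subset {U W : RelCompactOpens G} {X : LieAlg E G}
    (hW : ∀ x ∈ U.1, ∀ s ∈ Icc (0 : ℝ) 1, x * lieExp (s • X) ∈ W.1) {s : ℝ} (hs : s ∈ Icc (0 : ℝ) 1) :
    (U.translate (E := E) (lieExp (s • X))).1 ⊆ W.1 := by
  intro x hx
  have h := hW (x * (lieExp (s • X))⁻¹) hx s hs
  rwa [inv_mul_cancel_right] at h

theorem subset_of_mul_lieExp {U W : RelCompactOpens G} {X : LieAlg E G}
    (hW : ∀ x ∈ U.1, ∀ s ∈ Icc (0 : ℝ) 1, x * lieExp (s • X) ∈ W.1) : U.1 ⊆ W.1 := by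
  intro x hx
  have h := hW x hx 0 (by simp)
  rwa [zero_smul, lieExp_zero, mul_one] at h

theorem disjoint_image_mul_lieExp {U W : Set G} {X : LieAlg E G} {C : Set G} (hC : Disjoint C W)
    (hW : ∀ x ∈ U, ∀ s ∈ Icc (0 : ℝ) 1, x * lieExp (s • X) ∈ W) :
    Disjoint ((fun p : G × ℝ ↦ p.1 * lieExp (p.2 • X)) '' (C ×ˢ Icc (-1) 0)) U := by
  rw [Set.disjoint_left]
  rintro _ ⟨⟨x, s⟩, ⟨hx, hs⟩, rfl⟩ hU
  simp only at hx hs hU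
  have h := hW _ hU (-s) ⟨by linarith [hs.2], by linarith [hs.1]⟩
  rw [lieExp_neg_smul, mul_inv_cancel_right] at h
  exact Set.disjoint_left.1 hC hx h

theorem familyTranslate_lieExp_sub_mem (u : compatibleFamilies E G) {X : LieAlg E G} {c : ℂ}
    (h : ∀ U : RelCompactOpens G, u.1 U ∘ₗ rightRep analyticSpace_isBimodule
      (antiAut (toU X - algebraMap ℂ _ c)) ∈ vanishing U.1) :
    familyTranslate (lieExp X) u.1 - Complex.exp c • u.1 ∈ nullFamilies E G := by
  intro U
  obtain ⟨W, hW⟩ := exists_relCompactOpens_mul_lieExp (E := E) U X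
  have h2 := translate_lieExp_subset hW (s := 1) (by simp)
  rw [one_smul] at h2
  refine (dualTranslate_sub_mem_vanishing_iff u _ _ (subset_of_mul_lieExp hW) h2).2 ?_
  obtain ⟨C₀, hC₀, hu⟩ := u.2.1 W
  obtain ⟨C, hC, hCW, hcar⟩ := h W
  exact ⟨_, isCompact_image_mul_lieExp hC X isCompact_Icc, disjoint_image_mul_lieExp hCW hW,
    isCarriedBy_dualTranslate_sub (hu.isDifferentiable hC₀) hC hcar⟩

theorem comp_rightRep_mem_vanishing_of_familyTranslate [ConnectedSpace G]
    (u : compatibleFamilies E G) {X : LieAlg E G} {c : ℂ}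
    (h : ∀ t : ℝ, familyTranslate (lieExp (t • X)) u.1 - Complex.exp (t * c) • u.1 ∈
      nullFamilies E G) (U : RelCompactOpens G) :
    u.1 U ∘ₗ rightRep analyticSpace_isBimodule (antiAut (toU X - algebraMap ℂ _ c)) ∈
      vanishing U.1 := by
  obtain ⟨U', hU'⟩ := exists_relCompactOpens_mul_lieExp (E := E) U X
  obtain ⟨W, hW⟩ := exists_relCompactOpens_mul_lieExp (E := E) U' X
  obtain ⟨C₀, hC₀, hu⟩ := u.2.1 W
  obtain ⟨C, hC, hCU, hcar⟩ := exists_isCarriedBy_comp_rightRep (hu.isDifferentiable hC₀) (X := X)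
    (c := c) (F := U'.1ᶜ) U'.2.1.isClosed_compl fun s hs ↦ by
      obtain ⟨C, hC, hCU, hcar⟩ := (dualTranslate_sub_mem_vanishing_iff u (lieExp (s • X))
        (Complex.exp (s * c)) (subset_of_mul_lieExp hW) (translate_lieExp_subset hW hs)).1 (h s U')
      refine ⟨C, hC, disjoint_left.1 hCU, ?_⟩
      rwa [lieExp_neg_smul]
  have h1 : u.1 W ∘ₗ rightRep analyticSpace_isBimodule (antiAut (toU X - algebraMap ℂ _ c)) ∈
      vanishing U.1 := ⟨_, isCompact_image_mul_lieExp hC X isCompact_Icc,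
    disjoint_image_mul_lieExp (disjoint_left.2 hCU) hU', hcar⟩
  have h2 := comp_rightRep_mem_vanishing
    (u.2.2 W U ((subset_of_mul_lieExp hU').trans (subset_of_mul_lieExp hW)))
    (antiAut (toU X - algebraMap ℂ _ c))
  have h3 := sub_mem h1 h2
  rwa [← LinearMap.sub_comp, sub_sub_cancel] at h3

/-- The right model of the hyperfunctions: an element of the enveloping algebra annihilates a
hyperfunction if it does so on every relatively compact open set, where a representing analytic
functional is used. -/
noncomputable def hyperfunctionsRightModel [ConnectedSpace G] (D : IwasawaData E G) :
    RightModel (hyperfunctions E G) where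
  ann f := ⨅ (u : compatibleFamilies E G) (_ : Submodule.Quotient.mk u = f) (U : RelCompactOpens G),
    analyticSpace_isBimodule.annMod (vanishing U.1) (fun _ ↦ comp_rightRep_mem_vanishing) (u.1 U)
  translateEq_one f u _ U := by
    have e : familyTranslate 1 u.1 U - (1 : ℂ) • u.1 U = 0 := by
      refine LinearMap.ext fun φ ↦ ?_
      change u.1 (U.translate (E := E) 1) ((analyticSpace E G).translate 1⁻¹ φ) - 1 * u.1 U φ = 0
      rw [translate_one_relCompactOpens, inv_one, translate_one, one_mul, sub_self]
    change familyTranslate 1 u.1 U - (1 : ℂ) • u.1 U ∈ _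
    rw [e]
    exact zero_mem _
  translateEq_mul f p q c d h h' u hu U := by
    have h1 := h u hu U
    have h2 := dualTranslate_mem_vanishing (h' u hu (U.translate (E := E) p))
    have e : (familyTranslate (p * q) u.1 - (c * d) • u.1) U =
        (analyticSpace E G).dualTranslate p
          ((familyTranslate q u.1 - d • u.1) (U.translate (E := E) p)) +
        d • (familyTranslate p u.1 - c • u.1) U := by
      refine LinearMap.ext fun φ ↦ ?_
      change u.1 (U.translate (E := E) (p * q)) ((analyticSpace E G).translate (p * q)⁻¹ φ) -
        c * d * u.1 U φ = (u.1 ((U.translate (E := E) p).translate (E := E) q)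
          ((analyticSpace E G).translate q⁻¹ ((analyticSpace E G).translate p⁻¹ φ)) -
          d * u.1 (U.translate (E := E) p) ((analyticSpace E G).translate p⁻¹ φ)) +
        d * (u.1 (U.translate (E := E) p) ((analyticSpace E G).translate p⁻¹ φ) - c * u.1 U φ)
      rw [← translate_mul_relCompactOpens, mul_inv_rev, translate_mul]
      ring
    rw [e]
    exact add_mem h2 (Submodule.smul_mem _ d h1)
  translateEq_inv f p c hc h u hu U := by
    have h1 := h u hu (U.translate (E := E) p⁻¹)
    have h2 := Submodule.smul_mem _ (-c⁻¹) (dualTranslate_mem_vanishing h1)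
    have e : (familyTranslate p⁻¹ u.1 - c⁻¹ • u.1) U =
        -c⁻¹ • (analyticSpace E G).dualTranslate p⁻¹
          ((familyTranslate p u.1 - c • u.1) (U.translate (E := E) p⁻¹)) := by
      refine LinearMap.ext fun φ ↦ ?_
      change u.1 (U.translate (E := E) p⁻¹) ((analyticSpace E G).translate p⁻¹⁻¹ φ) - c⁻¹ * u.1 U φ =
        -c⁻¹ * (u.1 ((U.translate (E := E) p⁻¹).translate (E := E) p)
          ((analyticSpace E G).translate p⁻¹ ((analyticSpace E G).translate p⁻¹⁻¹ φ)) -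
          c * u.1 (U.translate (E := E) p⁻¹) ((analyticSpace E G).translate p⁻¹⁻¹ φ))
      rw [← translate_mul_relCompactOpens, inv_mul_cancel, translate_one_relCompactOpens,
        ← translate_mul, mul_inv_cancel, translate_one]
      field_simp
      ring
    rw [e]
    exact h2
  translateEq_lieExp f X c h u hu := by
    refine familyTranslate_lieExp_sub_mem u fun U ↦ ?_
    simp only [Submodule.mem_iInf] at h
    exact h u hu U
  sub_mem_ann f X c h := by
    simp only [Submodule.mem_iInf]
    exact fun u hu U ↦ comp_rightRep_mem_vanishing_of_familyTranslate u (fun t ↦ h t u hu) U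
  isKilledBy_iff f I hI := by
    have h := fun (u : compatibleFamilies E G) (U : RelCompactOpens G) ↦
      forall_comp_rep_mem_iff D analyticSpace_isBimodule hI (N := vanishing U.1)
        (fun _ ↦ comp_mulBy_mem_vanishing) (u.1 U)
    have hk : ∀ T, (hyperfunctions E G).IsKilledBy f (antiAut T) ↔
        ∀ u : compatibleFamilies E G, Submodule.Quotient.mk u = f → ∀ U : RelCompactOpens G,
          u.1 U ∘ₗ (analyticSpace E G).rep T ∈ vanishing U.1 := by
      intro T
      have e : antiAut (antiAut T) = T := antiAut_antiAut T
      conv_rhs => rw [← e]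
      rfl
    simp only [hk]
    constructor
    · intro H T hT
      simp only [Submodule.mem_iInf]
      exact fun u hu U ↦ (h u U).1 (fun T hT ↦ H T hT u hu U) T hT
    · intro H T hT u hu U
      refine (h u U).2 (fun T hT ↦ ?_) T hT
      have := H hT
      simp only [Submodule.mem_iInf] at this
      exact this u hu U

end Hyperfunctions

theorem nonempty_rightModel [ConnectedSpace G] (D : IwasawaData E G) {F : FunctionSpace E G}
    (hF : F = analyticFunctions E G ∨ F = smoothFunctions E G ∨ F = distributions E G ∨
      F = hyperfunctions E G) : Nonempty (RightModel F) := by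
  rcases hF with rfl | rfl | rfl | rfl
  · exact ⟨analyticSpace_isBimodule.rightModel⟩
  · exact ⟨smoothSpace_isBimodule.rightModel⟩
  · exact ⟨distributionsRightModel D⟩
  · exact ⟨hyperfunctionsRightModel D⟩

end Models

/-! ### Structure of the parabolic subalgebras -/

section StructureTheory

variable {E : Type*} [NormedAddCommGroup E] [NormedSpace ℝ E] [FiniteDimensional ℝ E]
  {G : Type*} [TopologicalSpace G] [ChartedSpace E G] [Group G] [LieGroup 𝓘(ℝ, E) ω G]

namespace IwasawaData

variable (D : IwasawaData E G) (Ξ : Set (Module.Dual ℝ D.a))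

theorem lie_eq_smul_of_mem_rootSpace {D : IwasawaData E G} {α : Module.Dual ℝ D.a}
    {X : LieAlg E G} (hX : X ∈ D.rootSpace α) (H : D.a) : (⁅(H : LieAlg E G), X⁆ : LieAlg E G) = α H • X := by
  have h := (Submodule.mem_iInf _).1 hX H
  rw [LinearMap.mem_ker, LinearMap.sub_apply, LinearMap.smul_apply, LinearMap.id_apply,
    LieAlgebra.ad_apply, sub_eq_zero] at h
  exact h

theorem mem_aXi_iff {H : D.a} : H ∈ D.aXi Ξ ↔ ∀ α ∈ Ξ, α H = 0 := by
  simp only [aXi, Submodule.mem_iInf, LinearMap.mem_ker]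

theorem mem_mXi_iff {X : LieAlg E G} : X ∈ D.mXi Ξ ↔
    ∀ H ∈ D.aXi Ξ, (⁅(H : LieAlg E G), X⁆ : LieAlg E G) = 0 ∧
      killingForm ℝ (LieAlg E G) H X = 0 := by
  simp only [mXi, Submodule.mem_inf, Submodule.mem_iInf, LinearMap.mem_ker, LieAlgebra.ad_apply,
    Subtype.forall]
  exact ⟨fun h a b c ↦ ⟨h.1 a b c, h.2 a b c⟩, fun h ↦ ⟨fun a b c ↦ (h a b c).1,
    fun a b c ↦ (h a b c).2⟩⟩

theorem mem_m_iff {X : LieAlg E G} : X ∈ D.m ↔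
    D.θ X = X ∧ ∀ H ∈ D.a, (⁅(H : LieAlg E G), X⁆ : LieAlg E G) = 0 := by
  simp only [m, k, Submodule.mem_inf, Submodule.mem_iInf, LinearMap.mem_ker, LieAlgebra.ad_apply,
    Subtype.forall]
  rfl

theorem killingForm_lie_left (X Y Z : LieAlg E G) :
    killingForm ℝ (LieAlg E G) ⁅X, Y⁆ Z = killingForm ℝ (LieAlg E G) X ⁅Y, Z⁆ :=
  LieModule.traceForm_apply_lie_apply ℝ (LieAlg E G) (LieAlg E G) X Y Z

theorem derivedMXi_le_mXi : D.derivedMXi Ξ ≤ D.mXi Ξ := by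
  refine Submodule.span_le.2 ?_
  rintro _ ⟨X, hX, Y, hY, rfl⟩
  refine (D.mem_mXi_iff Ξ).2 fun H hH ↦ ?_
  have h1 := ((D.mem_mXi_iff Ξ).1 hX H hH).1
  have h2 := ((D.mem_mXi_iff Ξ).1 hY H hH).1
  refine ⟨by rw [leibniz_lie, h1, h2, zero_lie, lie_zero, add_zero], ?_⟩
  rw [← killingForm_lie_left, h1, map_zero, LinearMap.zero_apply]

theorem lie_mem_derivedMXi_of_mem_a (H : D.a) {X : LieAlg E G} (hX : X ∈ D.derivedMXi Ξ) :
    (⁅(H : LieAlg E G), X⁆ : LieAlg E G) ∈ D.derivedMXi Ξ := by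
  have hm : ∀ X ∈ D.mXi Ξ, (⁅(H : LieAlg E G), X⁆ : LieAlg E G) ∈ D.mXi Ξ := by
    intro X hX
    refine (D.mem_mXi_iff Ξ).2 fun H' hH' ↦ ?_
    have h1 := ((D.mem_mXi_iff Ξ).1 hX H' hH').1
    have h2 := D.a_comm H' H'.2 H H.2
    refine ⟨by rw [leibniz_lie, h1, h2, zero_lie, lie_zero, add_zero], ?_⟩
    rw [← killingForm_lie_left, h2, map_zero, LinearMap.zero_apply]
  induction hX using Submodule.span_induction with
  | mem Z hZ =>
    obtain ⟨X, hX, Y, hY, rfl⟩ := hZ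
    rw [leibniz_lie]
    exact add_mem (Submodule.subset_span ⟨_, hm X hX, Y, hY, rfl⟩)
      (Submodule.subset_span ⟨X, hX, _, hm Y hY, rfl⟩)
  | zero => rw [lie_zero]; exact zero_mem _
  | add X Y _ _ h h' => rw [lie_add]; exact add_mem h h'
  | smul c X _ h => rw [lie_smul]; exact Submodule.smul_mem _ c h

theorem θ_mem_mXi {X : LieAlg E G} (hX : X ∈ D.mXi Ξ) : D.θ X ∈ D.mXi Ξ := by
  refine (D.mem_mXi_iff Ξ).2 fun H hH ↦ ?_
  obtain ⟨h1, h2⟩ := (D.mem_mXi_iff Ξ).1 hX H hH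
  have hθ : D.θ (-H : LieAlg E G) = H := by rw [map_neg, D.a_le H H.2, neg_neg]
  constructor
  · rw [← hθ, ← LieEquiv.map_lie, neg_lie, h1, neg_zero, map_zero]
  · rw [← hθ, LieAlgebra.killingForm_of_equiv_apply, map_neg, LinearMap.neg_apply, h2, neg_zero]

theorem θ_mem_derivedMXi {X : LieAlg E G} (hX : X ∈ D.derivedMXi Ξ) :
    D.θ X ∈ D.derivedMXi Ξ := by
  induction hX using Submodule.span_induction with
  | mem Z hZ =>
    obtain ⟨X, hX, Y, hY, rfl⟩ := hZ
    rw [LieEquiv.map_lie]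
    exact Submodule.subset_span ⟨_, D.θ_mem_mXi Ξ hX, _, D.θ_mem_mXi Ξ hY, rfl⟩
  | zero => rw [map_zero]; exact zero_mem _
  | add X Y _ _ h h' => rw [map_add]; exact add_mem h h'
  | smul c X _ h => rw [map_smul]; exact Submodule.smul_mem _ c h

theorem projXi_of_mem {H : D.a} (hH : H ∈ D.aXi Ξ) : D.projXi Ξ H = ⟨H, hH⟩ :=
  Submodule.projectionOnto_apply_of_mem_left _ hH

theorem killingForm_sub_projXi (H : D.a) {H' : D.a} (hH' : H' ∈ D.aXi Ξ) :
    killingForm ℝ (LieAlg E G) H' ((H - (D.projXi Ξ H : D.a) : D.a) : LieAlg E G) = 0 := by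
  have h : D.projXi Ξ (H - (D.projXi Ξ H : D.a)) = 0 := by
    rw [map_sub, D.projXi_of_mem Ξ (D.projXi Ξ H).2, sub_self]
  exact (Submodule.projectionOnto_apply_eq_zero_iff (D.isCompl_aXi Ξ)).1 h H' hH'

theorem projXi_eq_zero_of_mem_mXi {H : D.a} (hH : (H : LieAlg E G) ∈ D.mXi Ξ) :
    D.projXi Ξ H = 0 :=
  (Submodule.projectionOnto_apply_eq_zero_iff (D.isCompl_aXi Ξ)).2 fun H' hH' ↦
    ((D.mem_mXi_iff Ξ).1 hH H' hH').2

theorem rootSpace_le_mXi {α : Module.Dual ℝ D.a} (hα : α ≠ 0) (h : ∀ H ∈ D.aXi Ξ, α H = 0) :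
    D.rootSpace α ≤ D.mXi Ξ := by
  intro X hX
  obtain ⟨H₁, h1⟩ : ∃ H₁, α H₁ ≠ 0 := by
    by_contra! hc
    exact hα (LinearMap.ext hc)
  refine (D.mem_mXi_iff Ξ).2 fun H hH ↦ ⟨by rw [lie_eq_smul_of_mem_rootSpace hX, h H hH, zero_smul], ?_⟩
  have h2 := killingForm_lie_left (H : LieAlg E G) H₁ X
  rw [D.a_comm H H.2 H₁ H₁.2, lie_eq_smul_of_mem_rootSpace hX, map_zero, LinearMap.zero_apply,
    map_smul, smul_eq_mul] at h2
  exact (mul_eq_zero.1 h2.symm).resolve_left h1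

theorem positive_subset : D.positive ⊆ restrictedRoots D.a := by
  obtain ⟨H₀, -, h⟩ := D.positive_spec
  rw [h]
  exact fun α hα ↦ hα.1

/-- The elements of `𝔞` orthogonal to `𝔞_Ξ` lie in `[𝔪_Ξ, 𝔪_Ξ]`: the coroots `[X, θX]`, for `X` in a
root space of a root in `Ξ`, have no common orthogonal vectors in `𝔞` outside of `𝔞_Ξ`. -/
theorem sub_projXi_mem_derivedMXi (hΞ : Ξ ⊆ restrictedRoots D.a) (H : D.a) :
    ((H - (D.projXi Ξ H : D.a) : D.a) : LieAlg E G) ∈ D.derivedMXi Ξ := by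
  let S : Submodule ℝ D.a := (D.derivedMXi Ξ).comap D.a.subtype
  let B := LinearMap.BilinForm.restrict (killingForm ℝ (LieAlg E G)) D.a
  have hs : B.IsSymm := ⟨fun x y ↦ LieModule.traceForm_comm ℝ _ _ _ _⟩
  have hpos : ∀ x : D.a, B x x = 0 → x = 0 := by
    intro x hx
    by_contra h0
    have h2 := D.θ_pos x (by simpa using h0)
    rw [D.a_le x x.2, map_neg, neg_neg] at h2
    exact h2.ne' hx
  have hle : B.orthogonal S ≤ D.aXi Ξ := by
    intro H' hH'
    refine (D.mem_aXi_iff Ξ).2 fun α hα ↦ ?_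
    obtain ⟨hα0, hαr⟩ := hΞ hα
    obtain ⟨X, hX, hX0⟩ := Submodule.exists_mem_ne_zero_of_ne_bot hαr
    change X ∈ D.rootSpace α at hX
    have hXm := D.rootSpace_le_mXi Ξ hα0 (fun H hH ↦ (D.mem_aXi_iff Ξ).1 hH α hα) hX
    have hθ : ∀ H₁ : D.a, (⁅(H₁ : LieAlg E G), D.θ X⁆ : LieAlg E G) = -(α H₁ • D.θ X) := by
      intro H₁
      have h : D.θ (-H₁ : LieAlg E G) = H₁ := by rw [map_neg, D.a_le H₁ H₁.2, neg_neg]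
      rw [← h, ← LieEquiv.map_lie, neg_lie, lie_eq_smul_of_mem_rootSpace hX, map_neg, map_smul]
    have hT : (⁅X, D.θ X⁆ : LieAlg E G) ∈ D.a := by
      refine D.a_maximal _ ?_ fun H₁ hH₁ ↦ ?_
      · rw [LieEquiv.map_lie, D.θ_involutive, lie_skew]
      · rw [leibniz_lie, hθ ⟨H₁, hH₁⟩, lie_eq_smul_of_mem_rootSpace hX ⟨H₁, hH₁⟩, smul_lie, lie_neg,
          lie_smul, add_neg_cancel]
    have h1 : killingForm ℝ (LieAlg E G) ⁅X, D.θ X⁆ H' = 0 :=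
      hH' ⟨_, hT⟩ (Submodule.subset_span ⟨X, hXm, _, D.θ_mem_mXi Ξ hXm, rfl⟩)
    rw [killingForm_lie_left, ← lie_skew, hθ, neg_neg, map_smul, smul_eq_mul] at h1
    exact (mul_eq_zero.1 h1).resolve_right fun h ↦ (D.θ_pos X hX0).ne' (by rw [h, neg_zero])
  have hc : IsCompl S (B.orthogonal S) := by
    rw [LinearMap.BilinForm.isCompl_orthogonal_iff_disjoint hs.isRefl, Submodule.disjoint_def]
    exact fun x hx hx' ↦ hpos x (hx' x hx)
  obtain ⟨s, hS, s', hS', e⟩ : ∃ s ∈ S, ∃ s' ∈ B.orthogonal S, s + s' = H - (D.projXi Ξ H : D.a) :=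
    Submodule.mem_sup.1 (hc.sup_eq_top ▸ Submodule.mem_top)
  have h0 : s' = 0 := by
    refine hpos s' ?_
    have h1 : B s' (s + s') = 0 := e ▸ D.killingForm_sub_projXi Ξ H (hle hS')
    rwa [map_add, show B s' s = B s s' from hs.eq s' s, show B s s' = 0 from hS' s hS,
      zero_add] at h1
  rw [h0, add_zero] at e
  rw [← e]
  exact hS

theorem rootSpace_le_derivedMXi (hΞ : Ξ ⊆ restrictedRoots D.a) {α : Module.Dual ℝ D.a} (hα : α ≠ 0)
    (h : ∀ H ∈ D.aXi Ξ, α H = 0) : D.rootSpace α ≤ D.derivedMXi Ξ := by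
  intro X hX
  obtain ⟨H, h1⟩ : ∃ H, α H ≠ 0 := by
    by_contra! hc
    exact hα (LinearMap.ext hc)
  have h2 : (⁅((H - (D.projXi Ξ H : D.a) : D.a) : LieAlg E G), X⁆ : LieAlg E G) ∈ D.derivedMXi Ξ :=
    Submodule.subset_span ⟨_, D.derivedMXi_le_mXi Ξ (D.sub_projXi_mem_derivedMXi Ξ hΞ H), X,
      D.rootSpace_le_mXi Ξ hα h hX, rfl⟩
  rw [lie_eq_smul_of_mem_rootSpace hX, map_sub, h _ (D.projXi Ξ H).2, sub_zero] at h2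
  have h3 := Submodule.smul_mem _ (α H)⁻¹ h2
  rwa [inv_smul_smul₀ h1] at h3

theorem n_le (hΞ : Ξ ⊆ restrictedRoots D.a) : D.n ≤ D.derivedMXi Ξ ⊔ D.nXi Ξ := by
  refine iSup₂_le fun α hα ↦ ?_
  by_cases h : ∃ H ∈ D.aXi Ξ, α H ≠ 0
  · exact le_sup_of_le_right (le_iSup₂_of_le α ⟨hα, h⟩ le_rfl)
  · push Not at h
    exact le_sup_of_le_left (D.rootSpace_le_derivedMXi Ξ hΞ (D.positive_subset hα).1 h)

theorem nXi_le_n : D.nXi Ξ ≤ D.n :=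
  iSup₂_le fun α hα ↦ le_iSup₂_of_le α hα.1 le_rfl

/-- A subspace stable under an element of the positive Weyl chamber contains the components in
`𝔪 + 𝔞` of its elements that lie in `𝔪 + 𝔞 + 𝔫`: some polynomial in that element with nonzero
constant term annihilates the component in `𝔫`. -/
theorem mem_of_add_mem_n {S : Submodule ℝ (LieAlg E G)}
    (hS : ∀ H : D.a, ∀ X ∈ S, (⁅(H : LieAlg E G), X⁆ : LieAlg E G) ∈ S) {V W : LieAlg E G}
    (hV : ∀ H ∈ D.a, (⁅(H : LieAlg E G), V⁆ : LieAlg E G) = 0) (hW : W ∈ D.n) (h : V + W ∈ S) :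
    V ∈ S := by
  obtain ⟨H₀, -, hp⟩ := D.positive_spec
  let T : Module.End ℝ (LieAlg E G) := LieAlgebra.ad ℝ (LieAlg E G) H₀
  have hpoly : ∃ q : Polynomial ℝ, q.eval 0 ≠ 0 ∧ Polynomial.aeval T q W = 0 := by
    refine Submodule.iSup_induction' (p := fun α : Module.Dual ℝ D.a ↦ ⨆ (_ : α ∈ D.positive),
      D.rootSpace α) (motive := fun W _ ↦ ∃ q : Polynomial ℝ, q.eval 0 ≠ 0 ∧
        Polynomial.aeval T q W = 0) (fun α X hX ↦ ?_) ⟨1, by simp⟩ ?_ hW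
    · by_cases hα : α ∈ D.positive
      · rw [iSup_pos hα] at hX
        have hα' := hα
        rw [hp] at hα'
        refine ⟨Polynomial.X - Polynomial.C (α H₀), by simpa using hα'.2.ne', ?_⟩
        rw [map_sub, Polynomial.aeval_X, Polynomial.aeval_C, LinearMap.sub_apply,
          Module.algebraMap_end_apply, LieAlgebra.ad_apply, lie_eq_smul_of_mem_rootSpace hX, sub_self]
      · rw [iSup_neg hα, Submodule.mem_bot] at hX
        exact ⟨1, by simp, by rw [hX, map_zero]⟩
    · rintro X Y _ _ ⟨q, hq, hX⟩ ⟨r, hr, hY⟩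
      refine ⟨q * r, by simpa using ⟨hq, hr⟩, ?_⟩
      rw [map_add, map_mul, Module.End.mul_apply, Module.End.mul_apply, hY, map_zero, add_zero,
        ← Module.End.mul_apply, ← map_mul, mul_comm, map_mul, Module.End.mul_apply, hX, map_zero]
  obtain ⟨q, hq, hqW⟩ := hpoly
  have h1 : Polynomial.aeval T q V = q.eval 0 • V := by
    have hTV : T V = (0 : ℝ) • V := by
      rw [zero_smul]
      exact hV H₀ H₀.2
    exact Module.End.aeval_apply_of_mem_apply_eq_smul hTV
  have h2 : Polynomial.aeval T q (V + W) ∈ S :=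
    q.aeval_apply_smul_mem_of_le_comap h T (hS H₀)
  rw [map_add, hqW, add_zero, h1] at h2
  have h3 := Submodule.smul_mem _ (q.eval 0)⁻¹ h2
  rwa [inv_smul_smul₀ hq] at h3

/-- The components in `𝔪`, `𝔞` and `𝔫` of an element of `[𝔪_Ξ, 𝔪_Ξ] ∩ (𝔪 + 𝔞 + 𝔫)`. -/
theorem exists_add_eq_of_mem_derivedMXi {Y : LieAlg E G} (hY : Y ∈ D.derivedMXi Ξ)
    (hp : Y ∈ D.p₀) : ∃ Z ∈ D.m, ∃ H : D.a, ∃ W ∈ D.n, Y = Z + (H : LieAlg E G) + W ∧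
      Z ∈ D.derivedMXi Ξ ∧ (H : LieAlg E G) ∈ D.derivedMXi Ξ := by
  obtain ⟨V, hV, W, hW, rfl⟩ := Submodule.mem_sup.1 hp
  obtain ⟨Z, hZ, H, hH, rfl⟩ := Submodule.mem_sup.1 hV
  obtain ⟨hZ1, hZ2⟩ := D.mem_m_iff.1 hZ
  have h1 : Z + H ∈ D.derivedMXi Ξ :=
    D.mem_of_add_mem_n (fun H X ↦ D.lie_mem_derivedMXi_of_mem_a Ξ H) (fun H' hH' ↦ by
      rw [lie_add, hZ2 H' hH', D.a_comm H' hH' H hH, add_zero]) hW hY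
  have h2 := D.θ_mem_derivedMXi Ξ h1
  rw [map_add, hZ1, D.a_le H hH] at h2
  have h3 : Z ∈ D.derivedMXi Ξ := by
    have h := Submodule.smul_mem _ (2⁻¹ : ℝ) (add_mem h1 h2)
    rwa [show Z + H + (Z + -H) = (2 : ℝ) • Z by rw [two_smul]; abel,
      inv_smul_smul₀ two_ne_zero] at h
  have h4 := sub_mem h1 h3
  rw [add_sub_cancel_left] at h4
  exact ⟨Z, hZ, ⟨H, hH⟩, W, hW, rfl, h3, h4⟩

variable {Ξ} in
theorem shift_sub_rho (μ : D.aXi Ξ →ₗ[ℝ] ℂ) (H : D.a) :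
    D.shift Ξ μ H - (D.rho H : ℂ) = μ (D.projXi Ξ H) - (D.rho (D.projXi Ξ H : D.a) : ℂ) := by
  simp only [shift, rhoXi, LinearMap.add_apply, LinearMap.comp_apply, LinearMap.sub_apply,
    ContinuousLinearMap.coe_coe, Complex.ofRealCLM_apply, Submodule.subtype_apply,
    Complex.ofReal_sub]
  ring

end IwasawaData

end StructureTheory

/-! ### Characters and equivariance -/

/-- A continuous homomorphism from the reals to the multiplicative group of the complex numbers is
smooth, hence the exponential of a linear map. -/
theorem eq_exp_deriv_of_map_add {φ : ℝ → ℂ} (hφ : Continuous φ) (h0 : φ 0 = 1)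
    (hadd : ∀ s t, φ (s + t) = φ s * φ t) (t : ℝ) : φ t = Complex.exp (t * deriv φ 0) := by
  -- An integral over a short interval is nonzero, and its translates are both differentiable and
  -- multiples of `φ`.
  obtain ⟨ε, hε⟩ : ∃ ε, ∫ s in (0 : ℝ)..ε, φ s ≠ 0 := by
    by_contra! hc
    have h1 := (hφ.integral_hasStrictDerivAt 0 0).hasDerivAt
    rw [show (fun u ↦ ∫ s in (0 : ℝ)..u, φ s) = fun _ ↦ 0 from funext hc, h0] at h1
    exact one_ne_zero (h1.unique (hasDerivAt_const _ _))
  have hint : ∀ u v : ℝ, IntervalIntegrable φ MeasureTheory.volume u v := fun u v ↦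
    hφ.intervalIntegrable u v
  have hd : Differentiable ℝ φ := by
    have e : φ = fun t ↦ ((∫ s in (0 : ℝ)..(t + ε), φ s) - ∫ s in (0 : ℝ)..t, φ s) /
        ∫ s in (0 : ℝ)..ε, φ s := by
      funext t
      rw [eq_div_iff hε, intervalIntegral.integral_interval_sub_left (hint _ _) (hint _ _),
        ← intervalIntegral.integral_const_mul]
      simp_rw [← hadd]
      rw [intervalIntegral.integral_comp_add_left, add_zero]
    rw [e]
    have h1 : Differentiable ℝ fun t : ℝ ↦ ∫ s in (0 : ℝ)..t, φ s := fun t ↦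
      (hφ.integral_hasStrictDerivAt 0 t).hasDerivAt.differentiableAt
    exact ((h1.comp (differentiable_id.add_const ε)).sub h1).div_const _
  have hderiv : ∀ t, HasDerivAt φ (φ t * deriv φ 0) t := by
    intro t
    have h1 : HasDerivAt (fun s ↦ φ (t + s)) (φ t * deriv φ 0) 0 := by
      simp_rw [hadd]
      exact (hd 0).hasDerivAt.const_mul _
    have h2 := HasDerivAt.comp_sub_const (f := fun s ↦ φ (t + s)) t t (by rwa [sub_self])
    simpa using h2
  have h1 : ∀ t : ℝ, HasDerivAt (fun t : ℝ ↦ φ t * Complex.exp (-(t * deriv φ 0))) 0 t := by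
    intro t
    have h2 : HasDerivAt (fun t : ℝ ↦ Complex.exp (-(t * deriv φ 0)))
        (Complex.exp (-(t * deriv φ 0)) * -(1 * deriv φ 0)) t :=
      HasDerivAt.cexp (HasDerivAt.neg (Complex.ofRealCLM.hasDerivAt.mul_const _))
    refine ((hderiv t).mul h2).congr_deriv ?_
    ring
  have h3 := is_const_of_deriv_eq_zero (fun t ↦ (h1 t).differentiableAt) (fun t ↦ (h1 t).deriv) t 0
  simp only [Complex.ofReal_zero, zero_mul, neg_zero, Complex.exp_zero, mul_one, h0,
    Complex.exp_neg] at h3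
  rwa [mul_inv_eq_one₀ (Complex.exp_ne_zero _)] at h3

section MainTheorem

attribute [local instance 100] LieRing.ofAssociativeRing

variable {E : Type*} [NormedAddCommGroup E] [NormedSpace ℝ E] [FiniteDimensional ℝ E]
  {G : Type*} [TopologicalSpace G] [ChartedSpace E G] [Group G] [LieGroup 𝓘(ℝ, E) ω G]

variable [T2Space G]

theorem adjointAction_lieExp_of_lie_eq_zero {Z H : LieAlg E G} (h : (⁅Z, H⁆ : LieAlg E G) = 0) :
    adjointAction (lieExp Z) H = H := by
  have h1 : ∀ ℓ : E →L[ℝ] ℝ, ℓ (adjointAction (lieExp Z : G) H) = ℓ H := by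
    intro ℓ
    let L : E →L[ℝ] ℂ := Complex.ofRealCLM.comp ℓ
    have hφ : ContMDiff 𝓘(ℝ, E) 𝓘(ℝ, ℂ) 1 (fun x : G ↦ L (adjointAction x H)) :=
      (contMDiff_adjointAction L H).of_le le_top
    have hd : ∀ t : ℝ, HasDerivAt
        (fun t : ℝ ↦ L (adjointAction (1 * lieExp (t • Z) : G) H)) 0 t := by
      intro t
      refine (hasDerivAt_mul_lieExp hφ Z 1 t).congr_deriv ?_
      rw [rightDeriv_adjointAction, h]
      have h0 : adjointAction (1 * lieExp (t • Z) : G) (0 : LieAlg E G) = 0 := by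
        simpa using adjointAction_smul (1 * lieExp (t • Z) : G) 0 (0 : LieAlg E G)
      exact (congrArg L h0).trans (map_zero L)
    have h3 := is_const_of_deriv_eq_zero (fun t ↦ (hd t).differentiableAt)
      (fun t ↦ (hd t).deriv) 1 0
    simp only [one_smul, zero_smul, one_mul, lieExp_zero, adjointAction_one] at h3
    exact Complex.ofReal_injective h3
  have h2 : ∀ v w : E, (∀ ℓ : E →L[ℝ] ℝ, ℓ v = ℓ w) → v = w := fun v w h ↦
    SeparatingDual.eq_iff_forall_dual_eq.2 h
  exact h2 _ _ h1

namespace RightModel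

variable {F : FunctionSpace E G} (R : RightModel F)

theorem translateEq_of_mem_analyticSubgroup {f : F.Obj} {s : Submodule ℝ (LieAlg E G)}
    (h : ∀ X ∈ s, toU X ∈ R.ann f) {p : G} (hp : p ∈ analyticSubgroup s) :
    F.IsTranslateEq f p 1 := by
  induction hp using Subgroup.closure_induction with
  | mem p hp =>
    obtain ⟨X, hX, rfl⟩ := hp
    have h1 := R.translateEq_lieExp f X 0 (by rw [map_zero, sub_zero]; exact h X hX)
    rwa [Complex.exp_zero] at h1
  | one => exact R.translateEq_one f
  | mul p q _ _ hp hq =>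
    have h1 := R.translateEq_mul f p q 1 1 hp hq
    rwa [mul_one] at h1
  | inv p _ hp =>
    have h1 := R.translateEq_inv f p 1 one_ne_zero hp
    rwa [inv_one] at h1

theorem toU_mem_ann_of_analyticSubgroup {f : F.Obj} {s : Submodule ℝ (LieAlg E G)}
    (h : ∀ p ∈ analyticSubgroup s, F.IsTranslateEq f p 1) {X : LieAlg E G} (hX : X ∈ s) :
    toU X ∈ R.ann f := by
  have h1 := R.sub_mem_ann f X 0 fun t ↦ by
    rw [mul_zero, Complex.exp_zero]
    exact h _ (lieExp_mem (s.smul_mem t hX))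
  rwa [map_zero, sub_zero] at h1

end RightModel

namespace IwasawaData

variable (D : IwasawaData E G) (Ξ : Set (Module.Dual ℝ D.a)) {χ : D.K →* ℂˣ}

theorem χ_lieExp_smul (hχ : Continuous χ) (Z : D.k) (t : ℝ) :
    (χ ⟨lieExp (t • (Z : LieAlg E G)), lieExp_mem (D.k.smul_mem t Z.2)⟩ : ℂ) =
      Complex.exp (t * D.dchi χ Z) := by
  refine eq_exp_deriv_of_map_add (φ := fun t : ℝ ↦
    ((χ ⟨lieExp (t • (Z : LieAlg E G)), lieExp_mem (D.k.smul_mem t Z.2)⟩ : ℂˣ) : ℂ)) ?_ ?_ ?_ t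
  · exact Units.continuous_val.comp
      (hχ.comp ((continuous_lieExp_smul (Z : LieAlg E G)).subtype_mk _))
  · have : (⟨lieExp ((0 : ℝ) • (Z : LieAlg E G)), lieExp_mem (D.k.smul_mem 0 Z.2)⟩ : D.K) = 1 :=
      Subtype.ext (show lieExp ((0 : ℝ) • (Z : LieAlg E G)) = 1 by rw [zero_smul, lieExp_zero])
    simp only [this, map_one, Units.val_one]
  · intro s t
    rw [← Units.val_mul, ← map_mul]
    congr 2
    exact Subtype.ext (lieExp_add_smul _ _ _)

theorem lieExp_mem_M {Z : LieAlg E G} (hZ : Z ∈ D.m) : lieExp Z ∈ D.M := by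
  refine ⟨lieExp_mem hZ.1, fun H hH ↦ adjointAction_lieExp_of_lie_eq_zero ?_⟩
  rw [← lie_skew, (D.mem_m_iff.1 hZ).2 H hH, neg_zero]

theorem dchi_eq_zero (hχΞ : ∀ k : D.K, (k : G) ∈ D.semisimplePart Ξ → χ k = 1) (Z : D.k)
    (hZ : (Z : LieAlg E G) ∈ D.derivedMXi Ξ) : D.dchi χ Z = 0 := by
  have h : (fun t : ℝ ↦ ((χ ⟨lieExp (t • (Z : LieAlg E G)),
      lieExp_mem (D.k.smul_mem t Z.2)⟩ : ℂˣ) : ℂ)) = fun _ ↦ 1 := funext fun t ↦ by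
    have h : lieExp (t • (Z : LieAlg E G)) ∈ D.semisimplePart Ξ :=
      lieExp_mem (Submodule.smul_mem _ t hZ)
    rw [hχΞ _ h, Units.val_one]
  rw [dchi, h, deriv_const]

variable {F : FunctionSpace E G}

/-- The infinitesimal form of `f(x m) = χ(m)⁻¹ f(x)`. -/
theorem toU_add_dchi_mem_ann (R : RightModel F) (hχ : Continuous χ) {f : F.Obj}
    (hf : ∀ m : D.K, (m : G) ∈ D.M → F.IsTranslateEq f m ((χ m)⁻¹ : ℂˣ)) (Z : D.k)
    (hZ : (Z : LieAlg E G) ∈ D.m) :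
    toU (Z : LieAlg E G) - algebraMap ℂ _ (-D.dchi χ Z) ∈ R.ann f := by
  refine R.sub_mem_ann f _ _ fun t ↦ ?_
  have h := hf ⟨lieExp (t • (Z : LieAlg E G)), lieExp_mem (D.k.smul_mem t Z.2)⟩
    (D.lieExp_mem_M (D.m.smul_mem t hZ))
  rwa [Units.val_inv_eq_inv_val, D.χ_lieExp_smul hχ, ← Complex.exp_neg, ← mul_neg] at h

variable {Ξ} in
theorem mem_sectionsXi_iff (R : RightModel F) {μ : D.aXi Ξ →ₗ[ℝ] ℂ} {f : F.Obj} :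
    f ∈ D.sectionsXi Ξ χ F μ ↔
    (∀ y ∈ D.semisimplePart Ξ, F.IsTranslateEq f y 1) ∧
    (∀ m : D.K, (m : G) ∈ D.M → F.IsTranslateEq f m ((χ m)⁻¹ : ℂˣ)) ∧
    (∀ H : D.aXi Ξ, F.IsTranslateEq f (lieExp (H : LieAlg E G))
      (Complex.exp (μ H - (D.rho (H : D.a) : ℂ)))) ∧
    ∀ n ∈ D.NXi Ξ, F.IsTranslateEq f n 1 := by
  have h1 : ((1 : D.K) : G) ∈ D.M := ⟨one_mem _, fun H _ ↦ adjointAction_one H⟩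
  constructor
  · intro h
    refine ⟨fun y hy ↦ ?_, fun m hm ↦ ?_, fun H ↦ ?_, fun n hn ↦ ?_⟩
    · simpa [lieExp_zero] using h y hy 1 h1 0 1 (one_mem _)
    · simpa [lieExp_zero] using h 1 (one_mem _) m hm 0 1 (one_mem _)
    · simpa using h 1 (one_mem _) 1 h1 H 1 (one_mem _)
    · simpa [lieExp_zero] using h 1 (one_mem _) 1 h1 0 n hn
  · rintro ⟨hy, hm, hH, hn⟩ y hy' m hm' H n hn'
    have h := R.translateEq_mul f _ _ _ _ (R.translateEq_mul f _ _ _ _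
      (R.translateEq_mul f _ _ _ _ (hy y hy') (hm m hm')) (hH H)) (hn n hn')
    rwa [one_mul, mul_one] at h

theorem mem_sections_iff (R : RightModel F) {ν : D.a →ₗ[ℝ] ℂ} {f : F.Obj} : f ∈ D.sections χ F ν ↔
    (∀ m : D.K, (m : G) ∈ D.M → F.IsTranslateEq f m ((χ m)⁻¹ : ℂˣ)) ∧
    (∀ H : D.a, F.IsTranslateEq f (lieExp (H : LieAlg E G))
      (Complex.exp (ν H - (D.rho H : ℂ)))) ∧
    ∀ n ∈ D.N, F.IsTranslateEq f n 1 := by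
  have h1 : ((1 : D.K) : G) ∈ D.M := ⟨one_mem _, fun H _ ↦ adjointAction_one H⟩
  constructor
  · intro h
    refine ⟨fun m hm ↦ ?_, fun H ↦ ?_, fun n hn ↦ ?_⟩
    · simpa [lieExp_zero] using h m hm 0 1 (one_mem _)
    · simpa using h 1 h1 H 1 (one_mem _)
    · simpa [lieExp_zero] using h 1 h1 0 n hn
  · rintro ⟨hm, hH, hn⟩ m hm' H n hn'
    have h := R.translateEq_mul f _ _ _ _ (R.translateEq_mul f _ _ _ _ (hm m hm') (hH H)) (hn n hn')
    rwa [mul_one] at h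

variable {Ξ}

/-- A section over `G/P_Ξ` is annihilated by `J_Θ(λ)`. -/
theorem JTheta_le_ann (R : RightModel F) (hχ : Continuous χ) {μ : D.aXi Ξ →ₗ[ℝ] ℂ} {f : F.Obj}
    (hf : f ∈ D.sectionsXi Ξ χ F μ) : D.JTheta Ξ χ μ ≤ R.ann f := by
  obtain ⟨hy, hm, hH, hn⟩ := (D.mem_sectionsXi_iff R).1 hf
  refine Ideal.span_le.2 ?_
  rintro _ ⟨X, -, c, ⟨Y, hY, Z, hZ, H, W, hW, rfl, rfl⟩, rfl⟩
  have h1 : toU Y ∈ R.ann f := R.toU_mem_ann_of_analyticSubgroup hy hY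
  have h2 := D.toU_add_dchi_mem_ann R hχ hm Z hZ
  have h3 : toU (H : LieAlg E G) - algebraMap ℂ _ (μ H - (D.rho (H : D.a) : ℂ)) ∈ R.ann f := by
    refine R.sub_mem_ann f _ _ fun t ↦ ?_
    have h := hH (t • H)
    simpa [mul_sub] using h
  have h4 : toU W ∈ R.ann f := R.toU_mem_ann_of_analyticSubgroup hn hW
  have h := add_mem (add_mem (add_mem h1 h2) h3) h4
  have e : toU (Y + (Z : LieAlg E G) + (H : LieAlg E G) + W) - algebraMap ℂ (UAlg E G)
      (-D.dchi χ Z + (μ H - (D.rho (H : D.a) : ℂ))) =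
      toU Y + (toU (Z : LieAlg E G) - algebraMap ℂ _ (-D.dchi χ Z)) +
        (toU (H : LieAlg E G) - algebraMap ℂ _ (μ H - (D.rho (H : D.a) : ℂ))) + toU W := by
    rw [toU_add, toU_add, toU_add, map_add]
    abel
  rw [SetLike.mem_coe, e]
  exact h

theorem sectionsXi_subset_sections (R : RightModel F) (hΞ : Ξ ⊆ restrictedRoots D.a)
    {μ : D.aXi Ξ →ₗ[ℝ] ℂ} {f : F.Obj} (hf : f ∈ D.sectionsXi Ξ χ F μ) :
    f ∈ D.sections χ F (D.shift Ξ μ) := by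
  obtain ⟨hy, hm, hH, hn⟩ := (D.mem_sectionsXi_iff R).1 hf
  have h1 : ∀ Y ∈ D.derivedMXi Ξ, toU Y ∈ R.ann f := fun Y hY ↦
    R.toU_mem_ann_of_analyticSubgroup hy hY
  have h4 : ∀ W ∈ D.nXi Ξ, toU W ∈ R.ann f := fun W hW ↦ R.toU_mem_ann_of_analyticSubgroup hn hW
  refine (D.mem_sections_iff R).2 ⟨hm, fun H ↦ ?_, fun n hn ↦ ?_⟩
  · refine R.translateEq_lieExp f _ _ ?_
    rw [D.shift_sub_rho]
    have h3 : toU ((D.projXi Ξ H : D.a) : LieAlg E G) - algebraMap ℂ _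
        (μ (D.projXi Ξ H) - (D.rho (D.projXi Ξ H : D.a) : ℂ)) ∈ R.ann f := by
      refine R.sub_mem_ann f _ _ fun t ↦ ?_
      have h := hH (t • D.projXi Ξ H)
      simpa [mul_sub] using h
    have h := add_mem h3 (h1 _ (D.sub_projXi_mem_derivedMXi Ξ hΞ H))
    rwa [sub_add_eq_add_sub, ← toU_add, ← Submodule.coe_add, add_sub_cancel] at h
  · refine R.translateEq_of_mem_analyticSubgroup (fun X hX ↦ ?_) hn
    obtain ⟨Y, hY, W, hW, rfl⟩ := Submodule.mem_sup.1 (D.n_le Ξ hΞ hX)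
    rw [toU_add]
    exact add_mem (h1 Y hY) (h4 W hW)

/-- A section over `G/P` is annihilated by `J_0(λ)`: `λ` is the differential of its weight because
the weight is trivial on `[𝔪_Ξ, 𝔪_Ξ] ∩ (𝔪 + 𝔞 + 𝔫)`. -/
theorem JZero_le_ann (R : RightModel F) (hχ : Continuous χ)
    (hχΞ : ∀ k : D.K, (k : G) ∈ D.semisimplePart Ξ → χ k = 1)
    {μ : D.aXi Ξ →ₗ[ℝ] ℂ} {f : F.Obj} (hf : f ∈ D.sections χ F (D.shift Ξ μ)) :
    D.JZero Ξ χ μ ≤ R.ann f := by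
  obtain ⟨hm, hH, hn⟩ := (D.mem_sections_iff R).1 hf
  have h2 := D.toU_add_dchi_mem_ann R hχ hm
  have h3 : ∀ H : D.a, toU (H : LieAlg E G) - algebraMap ℂ _
      (μ (D.projXi Ξ H) - (D.rho (D.projXi Ξ H : D.a) : ℂ)) ∈ R.ann f := by
    intro H
    refine R.sub_mem_ann f _ _ fun t ↦ ?_
    have h := hH (t • H)
    rw [D.shift_sub_rho] at h
    simpa [mul_sub] using h
  have h4 : ∀ W ∈ D.n, toU W ∈ R.ann f := fun W hW ↦ R.toU_mem_ann_of_analyticSubgroup hn hW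
  refine Ideal.span_le.2 ?_
  rintro _ ⟨X, hX, c, ⟨Y, hY, Z, hZ, H, W, hW, rfl, rfl⟩, rfl⟩
  have hYp : Y ∈ D.p₀ := by
    have hZp : (Z : LieAlg E G) ∈ D.p₀ := Submodule.mem_sup_left (Submodule.mem_sup_left hZ)
    have hHp : (H : LieAlg E G) ∈ D.p₀ := Submodule.mem_sup_left (Submodule.mem_sup_right H.1.2)
    have hWp : W ∈ D.p₀ := Submodule.mem_sup_right (D.nXi_le_n Ξ hW)
    have h := sub_mem (sub_mem (sub_mem hX hWp) hHp) hZp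
    rwa [add_sub_cancel_right, add_sub_cancel_right, add_sub_cancel_right] at h
  obtain ⟨Z', hZ', H', W', hW', rfl, hZd, hHd⟩ := D.exists_add_eq_of_mem_derivedMXi Ξ hY hYp
  have k1 := h2 ⟨Z', hZ'.1⟩ hZ'
  rw [D.dchi_eq_zero Ξ hχΞ _ hZd, neg_zero, map_zero, sub_zero] at k1
  have k2 := h3 H'
  rw [D.projXi_eq_zero_of_mem_mXi Ξ (D.derivedMXi_le_mXi Ξ hHd), Submodule.coe_zero, map_zero,
    map_zero, Complex.ofReal_zero, sub_zero, map_zero, sub_zero] at k2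
  have k3 := h3 H
  rw [D.projXi_of_mem Ξ H.2] at k3
  have h := add_mem (add_mem (add_mem (add_mem (add_mem k1 k2) (h4 W' hW')) (h2 Z hZ)) k3)
    (h4 W (D.nXi_le_n Ξ hW))
  have e : toU (Z' + (H' : LieAlg E G) + W' + (Z : LieAlg E G) + (H : LieAlg E G) + W) -
      algebraMap ℂ (UAlg E G) (-D.dchi χ Z + (μ H - (D.rho (H : D.a) : ℂ))) =
      toU Z' + toU (H' : LieAlg E G) + toU W' +
        (toU (Z : LieAlg E G) - algebraMap ℂ _ (-D.dchi χ Z)) +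
        (toU (H : LieAlg E G) - algebraMap ℂ _ (μ H - (D.rho (H : D.a) : ℂ))) + toU W := by
    simp only [toU_add, map_add]
    abel
  rw [SetLike.mem_coe, e]
  exact h

/-- A section over `G/P` that is annihilated by `J_Θ(λ)` is a section over `G/P_Ξ`. -/
theorem mem_sectionsXi_of_JTheta_le_ann (R : RightModel F)
    (hχΞ : ∀ k : D.K, (k : G) ∈ D.semisimplePart Ξ → χ k = 1)
    {μ : D.aXi Ξ →ₗ[ℝ] ℂ} {f : F.Obj} (hf : f ∈ D.sections χ F (D.shift Ξ μ))
    (hJ : D.JTheta Ξ χ μ ≤ R.ann f) : f ∈ D.sectionsXi Ξ χ F μ := by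
  obtain ⟨hm, hH, hn⟩ := (D.mem_sections_iff R).1 hf
  refine (D.mem_sectionsXi_iff R).2 ⟨fun y hy ↦ ?_, hm, fun H ↦ ?_, fun n h ↦ ?_⟩
  · refine R.translateEq_of_mem_analyticSubgroup (fun Y hY ↦ ?_) hy
    have hd : D.dchi χ 0 = 0 := D.dchi_eq_zero Ξ hχΞ 0 (zero_mem _)
    refine hJ (Ideal.subset_span ⟨Y, ?_, 0, ⟨Y, hY, 0, zero_mem _, 0, 0, zero_mem _, ?_, ?_⟩, ?_⟩)
    · exact Submodule.mem_sup_left (Submodule.mem_sup_left (D.derivedMXi_le_mXi Ξ hY))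
    · simp
    · simp [hd]
    · rw [map_zero, sub_zero]
  · have h := hH H
    rwa [D.shift_sub_rho, D.projXi_of_mem Ξ H.2] at h
  · exact hn n (Subgroup.closure_mono (Set.image_mono (D.nXi_le_n Ξ)) h)

end IwasawaData

end MainTheorem
end DegSeries

theorem mainTheorem7 {E : Type*} [NormedAddCommGroup E] [NormedSpace ℝ E] [FiniteDimensional ℝ E]
    {G : Type*} [TopologicalSpace G] [ChartedSpace E G] [Group G] [LieGroup 𝓘(ℝ, E) ω G]
    [T2Space G] [ConnectedSpace G] [LieAlgebra.IsSemisimple ℝ (DegSeries.LieAlg E G)]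
    (D : DegSeries.IwasawaData E G)
    (χ : D.K →* ℂˣ) (hχ : Continuous χ)
    (Ξ : Set (Module.Dual ℝ D.a)) (hΞ : Ξ ⊆ D.simple)
    (hχΞ : ∀ k : D.K, (k : G) ∈ D.semisimplePart Ξ → χ k = 1)
    (μ : D.aXi Ξ →ₗ[ℝ] ℂ)
    (I : Ideal (DegSeries.UAlg E G)) (hI : I.IsTwoSided)
    (hJ : D.JTheta Ξ χ μ = I ⊔ D.JZero Ξ χ μ)
    (F : DegSeries.FunctionSpace E G)
    (hF : F = DegSeries.analyticFunctions E G ∨ F = DegSeries.smoothFunctions E G ∨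
      F = DegSeries.distributions E G ∨ F = DegSeries.hyperfunctions E G) :
    D.sectionsXi Ξ χ F μ =
      {f ∈ D.sections χ F (D.shift Ξ μ) | ∀ T ∈ I, F.IsKilledBy f (DegSeries.antiAut T)} := by
  obtain ⟨R⟩ := DegSeries.nonempty_rightModel D hF
  have hΞ' : Ξ ⊆ DegSeries.restrictedRoots D.a := fun α hα ↦ D.positive_subset (hΞ hα).1
  ext f
  constructor
  · intro hf
    refine ⟨D.sectionsXi_subset_sections R hΞ' hf, ?_⟩
    exact (R.isKilledBy_iff f I hI).2 ((hJ ▸ le_sup_left : I ≤ _).trans (D.JTheta_le_ann R hχ hf))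
  · rintro ⟨hf, hk⟩
    refine D.mem_sectionsXi_of_JTheta_le_ann R hχΞ hf ?_
    rw [hJ]
    exact sup_le ((R.isKilledBy_iff f I hI).1 hk) (D.JZero_le_ann R hχ hχΞ hf)
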